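/- Let $n\ge 2$ and let $\mathfrak g$ be a finite-dimensional complex semisimple Lie algebra of type $D_n$ (simple for $n\ge3$, with $D_3=A_3$ and $D_2=A_1\times A_1$). Let $\mathfrak h\subset\mathfrak g$ be a Cartan subalgebra, let $\Delta$ be the root system of $\mathfrak g$ with respect to $\mathfrak h$, and let $\Delta^+\subset\Delta$ be a positive system. Thus the Cartan matrix of the simple roots of $\Delta^+$, suitably numbered, is that of type $D_n$. Let $\mathfrak b=\mathfrak h\oplus\bigoplus_{\alpha\in\Delta^+}\mathfrak g_\alpha$ be the corresponding Borel subalgebra, and let $\mathcal I^n$ be the set of ideals of $\mathfrak b$ all of whose elements are $\mathrm{ad}$-nilpotent. For $\mathfrak i\in\mathcal I^n$, the class of nilpotence $n(\mathfrak i)$ is the smallest $m\ge 0$ such that $m$-fold bracketing of $\mathfrak i$ with itself gives zero, i.e. such that $[\cdots[[\mathfrak i,\mathfrak i],\mathfrak i],\dots,\mathfrak i]=0$ with $m$ brackets ($m+1$ occurrences of $\mathfrak i$). Thus $n(\mathfrak i)\le 1$ if and only if $\mathfrak i$ is Abelian. Let $F_k$ be the Fibonacci numbers normalized by $F_0=F_1=1$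 and $F_{k+2}=F_{k+1}+F_k$. Then $$\#\{\mathfrak i\in\mathcal I^n : n(\mathfrak i)\le 2\}=5F_{2n-3}-2^{n-2},$$ $$\#\{\mathfrak i\in\mathcal I^n : n(\mathfrak i)\le 3\}=\frac{13}{2}\cdot 3^{n-2}-\frac32+4F_{2n}-7F_{2n-1}.$$ -/

import Mathlib

namespace TypeDIdeals

open LieAlgebra LieAlgebra.IsKilling

section Borel

variable {K L : Type*} [Field K] [CharZero K] [LieRing L] [LieAlgebra K L]
  [IsKilling K L] [FiniteDimensional K L]
  {H : LieSubalgebra K L} [H.IsCartanSubalgebra] [LieModule.IsTriangularizable K H L]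

/-- The subspace `𝔥 ⊕ ⨁_{α > 0} 𝔤_α`, where `𝔥 = H` and positivity of roots is relative to the
base `b` of the root system of `L` with respect to `H`. -/
def borelSubmodule (b : (rootSystem H).Base) : Submodule K L :=
  H.toSubmodule ⊔ ⨆ α : H.root, ⨆ _ : b.IsPos α, (rootSpace H α.1).toSubmodule

theorem rootSpace_le_borelSubmodule (b : (rootSystem H).Base) (α : H.root) (hα : b.IsPos α) :
    (rootSpace H α.1).toSubmodule ≤ borelSubmodule b :=
  le_sup_of_le_right (le_iSup₂_of_le α hα le_rfl)

theorem lie_cartan_mem_borelSubmodule (b : (rootSystem H).Base) {x y : L} (hx : x ∈ H)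
    (hy : y ∈ borelSubmodule b) : ⁅x, y⁆ ∈ borelSubmodule b := by
  have key : borelSubmodule b ≤ (borelSubmodule b).comap (ad K L x : L →ₗ[K] L) := by
    refine sup_le (fun z hz => ?_) (iSup₂_le fun α hα z hz => ?_)
    · exact Submodule.mem_sup_left (H.lie_mem hx hz)
    · exact rootSpace_le_borelSubmodule b α hα
        (LieSubmodule.lie_mem (rootSpace H α.1) (x := (⟨x, hx⟩ : H)) hz)
  exact key hy

theorem lie_rootSpace_mem_borelSubmodule (b : (rootSystem H).Base) (α β : H.root)
    (hα : b.IsPos α) (hβ : b.IsPos β) {x y : L} (hx : x ∈ rootSpace H α.1)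
    (hy : y ∈ rootSpace H β.1) : ⁅x, y⁆ ∈ borelSubmodule b := by
  have hxy : ⁅x, y⁆ ∈ rootSpace H ((α.1 : H → K) + β.1) :=
    lie_mem_genWeightSpace_of_mem_genWeightSpace hx hy
  by_cases h0 : ⁅x, y⁆ = 0
  · rw [h0]; exact Submodule.zero_mem _
  have hne : rootSpace H ((α.1 : H → K) + β.1) ≠ ⊥ := by
    intro h
    rw [h] at hxy
    exact h0 (by simpa using hxy)
  let γ : LieModule.Weight K H L := ⟨(α.1 : H → K) + β.1, hne⟩
  have hγ : γ.IsNonZero := by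
    intro h
    have hneg : (rootSystem H).root β =
        (rootSystem H).root α + (-2 : ℤ) • (rootSystem H).root α := by
      have : (rootSystem H).root β = - (rootSystem H).root α := by
        ext z
        have := congrFun (h : (γ : H → K) = 0) z
        exact eq_neg_of_add_eq_zero_right this
      rw [this]; module
    have h1 := b.height_add_zsmul hneg
    have h2 := b.isPos_iff.mp hα
    have h3 := b.isPos_iff.mp hβ
    simp only [smul_eq_mul] at h1
    omega
  let γ' : H.root := ⟨γ, by simpa using hγ⟩
  have hpos : b.IsPos γ' := hα.add hβ (by ext z; rfl)
  exact rootSpace_le_borelSubmodule b γ' hpos hxy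

theorem lie_mem_borelSubmodule (b : (rootSystem H).Base) {x y : L}
    (hx : x ∈ borelSubmodule b) (hy : y ∈ borelSubmodule b) : ⁅x, y⁆ ∈ borelSubmodule b := by
  have swap : ∀ u v : L, ⁅u, v⁆ ∈ borelSubmodule b → ⁅v, u⁆ ∈ borelSubmodule b := by
    intro u v h
    rw [← lie_skew]
    exact Submodule.neg_mem _ h
  have key : borelSubmodule b ≤ (borelSubmodule b).comap (ad K L y : L →ₗ[K] L) := by
    refine sup_le (fun z hz => swap z y (lie_cartan_mem_borelSubmodule b hz hy))
      (iSup₂_le fun α hα z hz => ?_)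
    have key' : borelSubmodule b ≤ (borelSubmodule b).comap (ad K L z : L →ₗ[K] L) := by
      refine sup_le (fun w hw => ?_) (iSup₂_le fun β hβ w hw => ?_)
      · exact swap w z
          (lie_cartan_mem_borelSubmodule b hw (rootSpace_le_borelSubmodule b α hα hz))
      · exact lie_rootSpace_mem_borelSubmodule b α β hα hβ hz hw
    exact swap z y (key' hy)
  exact swap y x (key hx)

/-- The Borel subalgebra `𝔟 = 𝔥 ⊕ ⨁_{α > 0} 𝔤_α`. -/
def borel (b : (rootSystem H).Base) : LieSubalgebra K L where
  toSubmodule := borelSubmodule b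
  lie_mem' hx hy := lie_mem_borelSubmodule b hx hy

/-- The set of `ad`-nilpotent ideals of the Borel subalgebra: the Lie ideals of `𝔟` all of whose
elements act nilpotently on `L` in the adjoint representation. -/
def adNilpotentIdeals (b : (rootSystem H).Base) : Set (LieIdeal K (borel b)) :=
  {I | ∀ x ∈ I, IsNilpotent (ad K L (x : L))}

/-- The class of nilpotence of an ideal `I`, regarded as a Lie algebra: the least `m` such that
`m`-fold bracketing of `I` with itself, `[…[[I, I], I], …, I]` with `m` brackets, is zero.
In particular it is `0` exactly for `I = 0`, and at most `1` exactly for `I` Abelian. -/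
noncomputable def nilpotenceClass {b : (rootSystem H).Base} (I : LieIdeal K (borel b)) : ℕ :=
  sInf {m | LieModule.lowerCentralSeries K I I m = ⊥}

/-- The root system of `L` with respect to `H` is of type `D_n`, `b` being the chosen base: for a
suitable numbering of the simple roots their Cartan matrix is the one of type `D_n`. -/
def IsTypeD (b : (rootSystem H).Base) (n : ℕ) : Prop :=
  ∃ e : b.support ≃ Fin n, ∀ i j, b.cartanMatrix i j = CartanMatrix.D n (e i) (e j)

end Borel

/-- Fibonacci numbers in the normalization `F_0 = F_1 = 1`. -/
def F (n : ℕ) : ℕ := Nat.fib (n + 1)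

end TypeDIdeals

/-! An `ad`-nilpotent ideal of `𝔟` is `𝔥`-stable and meets `𝔥` in zero, so it is the sum of the root
spaces of a set Φ of positive roots closed under adding positive roots. As `[𝔤_α, 𝔤_β] = 𝔤_{α+β}`
whenever `α + β` is a root, its lower central series is governed by repeated addition inside Φ, and
class at most `k` means that no `k + 1` elements of Φ can be added successively (`map_eq_rootSum`,
`map_lowerCentralSeries`, `ncard_ideals`). The Cartan matrix identifies the positive roots with the
vectors `e_i ± e_j`, `i < j < n` (`exists_equiv_dRoot`), and a counting problem remains.

Let `D i j` and `S i j` say that `e_i - e_j`, respectively `e_i + e_j`, lies in Φ. In the last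
column both are initial segments in `i`, so one contains the other, and the sign change of `e_{n-1}`
exchanges them. Hence the count is that of the Φ with `D` inside `S` in the last column, plus that
of those with proper inclusion (`ncard_eq_of_criterion`). For such one-sided Φ, `D i j` forces `S i
k` for every `k ≠ i`, and the bound on the class excludes a single kind of path: `(e_0 - e_k) + (e_k
+ e_l) + (e_1 - e_l)` for class two, and the same with `e_0 - e_k` split into two differences for
class three (`iterSum_two_eq_empty_iff`, `iterSum_three_eq_empty_iff`).

A one-sided Φ is coded by the bounds `d_0 ≤ … ≤ d_{t-1}` at which its nonempty rows of differences
begin, and by an order ideal `T` of the triangle `t ≤ i < j < n`, the part of `S` that is not forced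
(`IsCIdeal.exists_code`). In the critical cases the excluded path means that `T` avoids one
position: `(d_0, d_1)`, respectively `(d_1, d_{d_0})`. A triangle on `N ≥ 1` points has `2^(N-1)`
order ideals, and stripping a full first row or an empty last column gives recursions for those
avoiding a position.

Weighted by the number of lists and summed over `t`, that is, along antidiagonals, these recursions
collapse to `A_{m+1} = A_m + B_m + c_m`, `B_{m+1} = A_{m+1} + B_m`. The homogeneous part advances
Fibonacci numbers by two indices; the terms `c_m` produce the powers of 2 and 3
(`diagSum_pairWeight`, `diagSum_markWeight`). -/

namespace TypeDIdeals

/-! ### Addition as a relation, upward closed sets and iterated sums. -/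

section Abstract

variable {R : Type*}

/-- `Φ` is closed under addition of arbitrary elements, addition being the relation `A`. -/
def IsUp (A : R → R → R → Prop) (Φ : Set R) : Prop :=
  ∀ α ∈ Φ, ∀ β γ, A α β γ → γ ∈ Φ

/-- The elements that arise by successively adding `k + 1` elements of `Φ`. -/
def iterSum (A : R → R → R → Prop) (Φ : Set R) : ℕ → Set R
  | 0 => Φ
  | k + 1 => {γ | ∃ α ∈ Φ, ∃ β ∈ iterSum A Φ k, A α β γ}

end Abstract

/-! ### Sums of positive root spaces and their brackets. -/

section Lie

open LieAlgebra LieAlgebra.IsKilling LieModule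

theorem disjoint_of_forall_ne {K L : Type*} [Field K] [LieRing L]
    [LieAlgebra K L] {H : LieSubalgebra K L} [H.IsCartanSubalgebra] {ι : Sort*}
    (f : ι → H → K) (χ : H → K) (hf : ∀ i, f i ≠ χ) :
    Disjoint (rootSpace H χ).toSubmodule (⨆ i, (rootSpace H (f i)).toSubmodule) := by
  have h := iSupIndep_genWeightSpace K H L χ
  have h2 : ⨆ i, rootSpace H (f i) ≤ ⨆ ψ, ⨆ _ : ψ ≠ χ, rootSpace H ψ :=
    iSup_le fun i => le_iSup₂_of_le (f i) (hf i) le_rfl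
  have h3 := h.mono_right h2
  rw [← LieSubmodule.iSup_toSubmodule]
  exact LieSubmodule.disjoint_toSubmodule.mpr h3

variable {K L : Type*} [Field K] [CharZero K] [LieRing L] [LieAlgebra K L]
  [IsKilling K L] [FiniteDimensional K L]
  {H : LieSubalgebra K L} [H.IsCartanSubalgebra] [LieModule.IsTriangularizable K H L]

/-- `sl₂`-theory on the `α`-string through `β`. As `α + β` is a weight, `β` is `p + 1` steps below
the top of the string. With `x` a top vector, `y = f^(p+1) x` has weight `β`, and `e y` is `(p +
1)(chainLength - p) f^p x`, which is nonzero. -/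
theorem exists_lie_ne_zero {α β γ : Weight K H L} (hα : α.IsNonZero)
    (hγ : (γ : H → K) = α + β) : ∃ x ∈ rootSpace H α, ∃ y ∈ rootSpace H β, ⁅x, y⁆ ≠ 0 := by
  obtain ⟨x, hx, x0⟩ := (chainTop α β).exists_ne_zero
  obtain ⟨h, e, f, isSl2, he, hf⟩ := exists_isSl2Triple_of_weight_isNonZero hα
  obtain rfl := isSl2.h_eq_coroot hα he hf
  have prim : isSl2.HasPrimitiveVectorWith x (chainLength α β : K) :=
    have := lie_mem_genWeightSpace_of_mem_genWeightSpace he hx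
    ⟨x0, (chainLength_smul _ _ hx).symm, by rwa [genWeightSpace_add_chainTop _ _ hα] at this⟩
  have hpos : 1 ≤ chainTopCoeff α β := by
    by_contra h0
    have h1 : chainTopCoeff α β = 0 := by omega
    have := genWeightSpace_add_chainTop (M := L) α β hα
    rw [coe_chainTop, h1] at this
    apply γ.genWeightSpace_ne_bot
    rw [hγ]
    simpa using this
  obtain ⟨p, hp⟩ : ∃ p, chainTopCoeff α β = p + 1 := ⟨_, (Nat.sub_add_cancel hpos).symm⟩
  have hle : p + 1 ≤ chainLength α β := hp ▸ chainTopCoeff_le_chainLength α β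
  refine ⟨e, he, (toEnd K L L f ^ (p + 1)) x, ?_, ?_⟩
  · have := toEnd_pow_apply_mem hf hx (p + 1)
    convert this using 2
    rw [coe_chainTop, hp]
    ext z
    simp
  · rw [prim.lie_e_pow_succ_toEnd_f]
    refine smul_ne_zero (mul_ne_zero (by exact_mod_cast Nat.succ_ne_zero p) ?_)
      (prim.pow_toEnd_f_ne_zero_of_eq_nat rfl (by omega))
    rw [sub_ne_zero]
    exact_mod_cast (by omega : chainLength α β ≠ p)

/-- The positive roots. -/
abbrev PosRoot (b : (rootSystem H).Base) : Type _ := {α : H.root // b.IsPos α}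

/-- The relation `γ = α + β` for positive roots. -/
def rootAdd (b : (rootSystem H).Base) (α β γ : PosRoot b) : Prop :=
  (rootSystem H).root γ.1 = (rootSystem H).root α.1 + (rootSystem H).root β.1

/-- The sum of the root spaces of the roots in `Φ`. -/
def rootSum {b : (rootSystem H).Base} (Φ : Set (PosRoot b)) : Submodule K L :=
  ⨆ α ∈ Φ, (rootSpace H α.1.1).toSubmodule

variable {b : (rootSystem H).Base}

theorem rootAdd_iff {α β γ : PosRoot b} :
    rootAdd b α β γ ↔ (γ.1.1 : H → K) = (α.1.1 : H → K) + β.1.1 := by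
  constructor
  · intro h
    ext z
    exact LinearMap.congr_fun h z
  · intro h
    ext z
    exact congrFun h z

theorem rootSpace_le_rootSum {Φ : Set (PosRoot b)} {α : PosRoot b} (h : α ∈ Φ) :
    (rootSpace H α.1.1).toSubmodule ≤ rootSum Φ :=
  le_iSup₂_of_le α h le_rfl

theorem root_injective {α β : PosRoot b} (h : (α.1.1 : H → K) = β.1.1) : α = β :=
  Subtype.ext (Subtype.ext (DFunLike.coe_injective h))

theorem rootSpace_le_rootSum_iff {Φ : Set (PosRoot b)} {α : PosRoot b} :
    (rootSpace H α.1.1).toSubmodule ≤ rootSum Φ ↔ α ∈ Φ := by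
  refine ⟨fun h => ?_, rootSpace_le_rootSum⟩
  by_contra hα
  have : rootSum Φ = ⨆ β : Φ, (rootSpace H (β.1.1.1 : H → K)).toSubmodule := by
    rw [rootSum]
    exact iSup_subtype'
  rw [this] at h
  have hd := disjoint_of_forall_ne (fun β : Φ => (β.1.1.1 : H → K)) (α.1.1 : H → K)
    (fun β hβ => hα (root_injective hβ ▸ β.2))
  have := disjoint_self.mp (hd.mono_right h)
  exact α.1.1.genWeightSpace_ne_bot L (LieSubmodule.toSubmodule_eq_bot _ |>.mp this)

theorem rootSum_eq_bot_iff {Φ : Set (PosRoot b)} : rootSum Φ = ⊥ ↔ Φ = ∅ := by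
  constructor
  · intro h
    rw [Set.eq_empty_iff_forall_notMem]
    intro α hα
    have := rootSpace_le_rootSum hα
    rw [h, le_bot_iff] at this
    exact α.1.1.genWeightSpace_ne_bot L (LieSubmodule.toSubmodule_eq_bot _ |>.mp this)
  · rintro rfl
    simp [rootSum]

theorem rootSum_le_borel (Φ : Set (PosRoot b)) : rootSum Φ ≤ borelSubmodule b :=
  iSup₂_le fun α _ => rootSpace_le_borelSubmodule b α.1 α.2

theorem lie_eq_zero_or (α β : PosRoot b) {x y : L} (hx : x ∈ rootSpace H α.1.1)
    (hy : y ∈ rootSpace H β.1.1) :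
    ⁅x, y⁆ = 0 ∨ ∃ γ, rootAdd b α β γ ∧ ⁅x, y⁆ ∈ rootSpace H γ.1.1 := by
  have hxy : ⁅x, y⁆ ∈ rootSpace H ((α.1.1 : H → K) + β.1.1) :=
    lie_mem_genWeightSpace_of_mem_genWeightSpace hx hy
  by_cases h0 : ⁅x, y⁆ = 0
  · exact Or.inl h0
  refine Or.inr ?_
  have hne : rootSpace H ((α.1.1 : H → K) + β.1.1) ≠ ⊥ := by
    intro h
    rw [h] at hxy
    exact h0 (by simpa using hxy)
  let γ : LieModule.Weight K H L := ⟨(α.1.1 : H → K) + β.1.1, hne⟩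
  have hγ : γ.IsNonZero := by
    intro h
    -- If `α + β = 0`, then `β = α - 2α` has height opposite to that of `α`, so the two roots cannot
    -- both be positive.
    have hneg : (rootSystem H).root β.1 =
        (rootSystem H).root α.1 + (-2 : ℤ) • (rootSystem H).root α.1 := by
      have : (rootSystem H).root β.1 = - (rootSystem H).root α.1 := by
        ext z
        have := congrFun (h : (γ : H → K) = 0) z
        exact eq_neg_of_add_eq_zero_right this
      rw [this]; module
    have h1 := b.height_add_zsmul hneg
    have h2 := b.isPos_iff.mp α.2
    have h3 := b.isPos_iff.mp β.2
    simp only [smul_eq_mul] at h1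
    omega
  let γ' : H.root := ⟨γ, by simpa using hγ⟩
  have hadd : (rootSystem H).root γ' = (rootSystem H).root α.1 + (rootSystem H).root β.1 := by
    ext z; rfl
  exact ⟨⟨γ', α.2.add β.2 hadd⟩, hadd, hxy⟩

/-- Root spaces are lines, so one nonzero bracket, rescaled, gives every vector of `𝔤_γ`. -/
theorem exists_lie_eq {α β γ : PosRoot b} (h : rootAdd b α β γ) {z : L}
    (hz : z ∈ rootSpace H γ.1.1) :
    ∃ x ∈ rootSpace H α.1.1, ∃ y ∈ rootSpace H β.1.1, ⁅x, y⁆ = z := by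
  have h' := rootAdd_iff.mp h
  obtain ⟨x, hx, y, hy, hne⟩ := exists_lie_ne_zero (H.isNonZero_coe_root α.1) h'
  have hxy : ⁅x, y⁆ ∈ rootSpace H γ.1.1 := by
    rw [h']
    exact lie_mem_genWeightSpace_of_mem_genWeightSpace hx hy
  obtain ⟨c, hc⟩ := (finrank_eq_one_iff_of_nonzero' (⟨⁅x, y⁆, hxy⟩ : rootSpace H γ.1.1)
    (by simpa using hne)).mp (finrank_rootSpace_eq_one γ.1.1 (H.isNonZero_coe_root γ.1)) ⟨z, hz⟩
  refine ⟨c • x, Submodule.smul_mem _ c hx, y, hy, ?_⟩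
  rw [smul_lie]
  exact congrArg Subtype.val hc

/-- This turns brackets of subspaces into addition of roots; it is the inductive step from the lower
central series to `iterSum`. -/
theorem span_lie_rootSum (Φ Ψ : Set (PosRoot b)) :
    Submodule.span K {z | ∃ x ∈ rootSum Φ, ∃ y ∈ rootSum Ψ, ⁅x, y⁆ = z} =
      rootSum {γ | ∃ α ∈ Φ, ∃ β ∈ Ψ, rootAdd b α β γ} := by
  apply le_antisymm
  · rw [Submodule.span_le]
    rintro _ ⟨x, hx, y, hy, rfl⟩
    set T : Submodule K L := rootSum {γ | ∃ α ∈ Φ, ∃ β ∈ Ψ, rootAdd b α β γ} with hT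
    have key : rootSum Φ ≤ T.comap (-(ad K L y : L →ₗ[K] L)) := by
      refine iSup₂_le fun α hα u hu => ?_
      have key' : rootSum Ψ ≤ T.comap (ad K L u : L →ₗ[K] L) := by
        refine iSup₂_le fun β hβ w hw => ?_
        rcases lie_eq_zero_or α β hu hw with h0 | ⟨γ, hγ, hm⟩
        · change ⁅u, w⁆ ∈ T
          rw [h0]; exact T.zero_mem
        · exact rootSpace_le_rootSum (⟨α, hα, β, hβ, hγ⟩ : γ ∈ {γ | ∃ α ∈ Φ, ∃ β ∈ Ψ, rootAdd b α β γ}) hm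
      have := key' hy
      change -⁅y, u⁆ ∈ T
      rw [lie_skew]
      exact this
    have := key hx
    change -⁅y, x⁆ ∈ T at this
    rwa [lie_skew] at this
  · refine iSup₂_le ?_
    rintro γ ⟨α, hα, β, hβ, h⟩ z hz
    obtain ⟨x, hx, y, hy, rfl⟩ := exists_lie_eq h hz
    exact Submodule.subset_span ⟨x, rootSpace_le_rootSum hα hx, y, rootSpace_le_rootSum hβ hy, rfl⟩

theorem lie_mem_rootSum {Φ : Set (PosRoot b)} (hΦ : IsUp (rootAdd b) Φ) {x y : L}
    (hx : x ∈ borelSubmodule b) (hy : y ∈ rootSum Φ) : ⁅x, y⁆ ∈ rootSum Φ := by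
  have key : rootSum Φ ≤ (rootSum Φ).comap (ad K L x : L →ₗ[K] L) := by
    refine iSup₂_le fun α hα u hu => ?_
    have key' : borelSubmodule b ≤ (rootSum Φ).comap (-(ad K L u : L →ₗ[K] L)) := by
      refine sup_le (fun w hw => ?_) (iSup₂_le fun β hβ w hw => ?_)
      · change -⁅u, w⁆ ∈ rootSum Φ
        rw [lie_skew]
        exact rootSpace_le_rootSum hα (LieSubmodule.lie_mem (rootSpace H α.1.1) (x := (⟨w, hw⟩ : H)) hu)
      · change -⁅u, w⁆ ∈ rootSum Φ
        refine Submodule.neg_mem _ ?_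
        rcases lie_eq_zero_or α ⟨β, hβ⟩ hu hw with h0 | ⟨γ, hγ, hm⟩
        · rw [h0]; exact Submodule.zero_mem _
        · exact rootSpace_le_rootSum (hΦ α hα _ γ hγ) hm
    have := key' hx
    change -⁅u, x⁆ ∈ rootSum Φ at this
    rw [lie_skew] at this
    exact this
  exact key hy

/-- The ideal of the Borel subalgebra spanned by the root spaces of the roots in `Φ`. -/
def idealOf (Φ : Set (PosRoot b)) (hΦ : IsUp (rootAdd b) Φ) : LieIdeal K (borel b) where
  __ := (rootSum Φ).comap (borel b).toSubmodule.subtype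
  lie_mem {x _} hy := lie_mem_rootSum hΦ x.2 hy

theorem map_idealOf (Φ : Set (PosRoot b)) (hΦ : IsUp (rootAdd b) Φ) :
    (idealOf Φ hΦ).toSubmodule.map (borel b).toSubmodule.subtype = rootSum Φ := by
  change ((rootSum Φ).comap (borel b).toSubmodule.subtype).map (borel b).toSubmodule.subtype = _
  rw [Submodule.map_comap_subtype]
  exact inf_eq_right.mpr (rootSum_le_borel Φ)

end Lie

/-! ### `ad`-nilpotent ideals of the Borel subalgebra as sets of positive roots. -/

section Lie

open LieAlgebra LieAlgebra.IsKilling LieModule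

variable {K L : Type*} [Field K] [CharZero K] [LieRing L] [LieAlgebra K L]
  [IsKilling K L] [FiniteDimensional K L]
  {H : LieSubalgebra K L} [H.IsCartanSubalgebra] [LieModule.IsTriangularizable K H L]
  {b : (rootSystem H).Base}

/-- The linear form on the weight space taking the value one on each simple root. -/
noncomputable def heightForm (b : (rootSystem H).Base) : Module.Dual K H →ₗ[K] K :=
  b.toWeightBasis.constr K fun _ => (1 : K)

theorem heightForm_root (α : H.root) :
    heightForm b ((rootSystem H).root α) = (b.height α : K) := by
  classical
  obtain ⟨f, -, -, hf⟩ := b.exists_root_eq_sum_int α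
  rw [b.height_eq_sum hf, hf, map_sum, Int.cast_sum]
  refine Finset.sum_congr rfl fun j hj => ?_
  have h1 : heightForm b ((rootSystem H).root j) = 1 := by
    have := b.toWeightBasis.constr_basis K (fun _ => (1 : K)) ⟨j, hj⟩
    rwa [b.toWeightBasis_apply] at this
  rw [map_zsmul, h1, zsmul_one]

/-- The sum of the weight spaces of height at least `k`. -/
def heightFiltration (b : (rootSystem H).Base) (k : ℤ) : Submodule K L :=
  ⨆ χ : Weight K H L, ⨆ _ : ∃ m : ℤ, k ≤ m ∧ heightForm b χ.toLinear = (m : K),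
    (rootSpace H χ).toSubmodule

theorem exists_heightForm (b : (rootSystem H).Base) (χ : Weight K H L) :
    ∃ m : ℤ, heightForm b χ.toLinear = (m : K) := by
  by_cases h : χ.IsZero
  · exact ⟨0, by rw [Weight.coe_toLinear_eq_zero_iff.mpr h]; simp⟩
  · exact ⟨b.height ⟨χ, by simpa using h⟩, heightForm_root ⟨χ, by simpa using h⟩⟩

theorem exists_heightForm_bound (b : (rootSystem H).Base) :
    ∃ M : ℤ, 0 ≤ M ∧ ∀ (χ : Weight K H L) (m : ℤ), heightForm b χ.toLinear = (m : K) → -M ≤ m ∧ m < M := by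
  choose f hf using exists_heightForm b
  obtain ⟨M, hM⟩ := (Set.finite_range fun χ => |f χ|).bddAbove
  refine ⟨|M| + 1, by positivity, fun χ m hm => ?_⟩
  have h0 := le_abs_self M
  have h1 : m = f χ := by
    rw [hf χ] at hm
    exact_mod_cast hm.symm
  have h2 : |f χ| ≤ M := hM ⟨χ, rfl⟩
  have := abs_le.mp h2
  omega

/-- Positive roots have height at least one, so the bracket climbs at least one step of the
filtration. This is what makes `ad x` nilpotent. -/
theorem lie_mem_heightFiltration (Φ : Set (PosRoot b)) {x y : L} (hx : x ∈ rootSum Φ) {k : ℤ}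
    (hy : y ∈ heightFiltration b k) : ⁅x, y⁆ ∈ heightFiltration b (k + 1) := by
  have key : rootSum Φ ≤ (heightFiltration b (k + 1)).comap (-(ad K L y : L →ₗ[K] L)) := by
    refine iSup₂_le fun α hα u hu => ?_
    have key' : heightFiltration b k ≤
        (heightFiltration b (k + 1)).comap (ad K L u : L →ₗ[K] L) := by
      refine iSup₂_le fun χ ⟨m, hkm, hm⟩ w hw => ?_
      change ⁅u, w⁆ ∈ heightFiltration b (k + 1)
      have huw : ⁅u, w⁆ ∈ rootSpace H ((α.1.1 : H → K) + χ) :=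
        lie_mem_genWeightSpace_of_mem_genWeightSpace hu hw
      by_cases hne : rootSpace H ((α.1.1 : H → K) + χ) = ⊥
      · rw [hne] at huw
        have : ⁅u, w⁆ = 0 := by simpa using huw
        rw [this]; exact Submodule.zero_mem _
      let γ : Weight K H L := ⟨(α.1.1 : H → K) + χ, hne⟩
      have hγ : γ.toLinear = (rootSystem H).root α.1 + χ.toLinear := by
        ext z; rfl
      refine (le_iSup₂_of_le γ ⟨b.height α.1 + m, ?_, ?_⟩ le_rfl :
        (rootSpace H γ).toSubmodule ≤ heightFiltration b (k + 1)) huw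
      · have := b.isPos_iff.mp α.2
        omega
      · rw [hγ, map_add, hm, heightForm_root, Int.cast_add]
    change -⁅y, u⁆ ∈ heightFiltration b (k + 1)
    rw [lie_skew]
    exact key' hy
  have := key hx
  change -⁅y, x⁆ ∈ heightFiltration b (k + 1) at this
  rwa [lie_skew] at this

theorem isNilpotent_ad_of_mem_rootSum {Φ : Set (PosRoot b)} {x : L} (hx : x ∈ rootSum Φ) :
    _root_.IsNilpotent (ad K L x) := by
  obtain ⟨M, hM0, hM⟩ := exists_heightForm_bound b
  have htop : heightFiltration b (-M) = ⊤ := by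
    rw [eq_top_iff, ← LieSubmodule.top_toSubmodule (R := K) (L := H) (M := L),
      ← LieModule.iSup_genWeightSpace_eq_top', LieSubmodule.iSup_toSubmodule]
    refine iSup_le fun χ => ?_
    obtain ⟨m, hm⟩ := exists_heightForm b χ
    exact le_iSup₂_of_le χ ⟨m, (hM χ m hm).1, hm⟩ le_rfl
  have hbot : heightFiltration b M = ⊥ := by
    rw [eq_bot_iff]
    refine iSup₂_le fun χ ⟨m, hkm, hm⟩ => ?_
    have := (hM χ m hm).2
    omega
  have hpow : ∀ (n : ℕ) (y : L), (ad K L x ^ n) y ∈ heightFiltration b (-M + n) := by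
    intro n y
    induction n with
    | zero => simp [htop]
    | succ n ih =>
      rw [pow_succ', Module.End.mul_apply]
      have := lie_mem_heightFiltration Φ hx ih
      push_cast
      rw [← add_assoc]
      exact this
  -- The filtration is everything at `-M` and zero at `M`, so `2M` steps exhaust it.
  refine ⟨(2 * M).toNat, LinearMap.ext fun y => ?_⟩
  have := hpow (2 * M).toNat y
  rw [show -M + ((2 * M).toNat : ℤ) = M by omega, hbot] at this
  simpa using this

/-- The positive roots whose root spaces are contained in an ideal of the Borel subalgebra. -/
def rootsOf (I : LieIdeal K (borel b)) : Set (PosRoot b) :=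
  {α | (rootSpace H α.1.1).toSubmodule ≤ I.toSubmodule.map (borel b).toSubmodule.subtype}

theorem disjoint_borelSubmodule {χ : Weight K H L} (h0 : χ.IsNonZero)
    (hneg : ¬ b.IsPos ⟨χ, by simpa using h0⟩) :
    Disjoint (rootSpace H χ).toSubmodule (borelSubmodule b) := by
  -- The index `none` stands for the zero weight, whose weight space contains `H`.
  let f : Option (PosRoot b) → H → K := fun o => o.elim 0 fun α => α.1.1
  refine (disjoint_of_forall_ne f χ ?_).mono_right ?_
  · rintro (_ | α) h
    · exact h0 h.symm
    · apply hneg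
      have : α.1 = ⟨χ, by simpa using h0⟩ := Subtype.ext (DFunLike.coe_injective h)
      exact this ▸ α.2
  · refine sup_le ?_ (iSup₂_le fun α hα => ?_)
    · refine le_iSup_of_le none ?_
      intro x hx
      exact toLieSubmodule_le_rootSpace_zero K L H hx
    · exact le_iSup_of_le (some ⟨α, hα⟩) le_rfl

/-- Being `𝔥`-stable, `I` is the sum of its weight components. A component of weight zero is an
`ad`-nilpotent element of the Cartan subalgebra, hence zero; a nonzero component for a positive root
spans its whole line; a negative root space is disjoint from the Borel subalgebra. -/
theorem map_eq_rootSum {I : LieIdeal K (borel b)} (hI : I ∈ adNilpotentIdeals b) :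
    I.toSubmodule.map (borel b).toSubmodule.subtype = rootSum (rootsOf I) := by
  apply le_antisymm
  · let N : LieSubmodule K H L :=
      { toSubmodule := I.toSubmodule.map (borel b).toSubmodule.subtype
        lie_mem := by
          rintro x _ ⟨y, hy, rfl⟩
          exact ⟨⁅(⟨x, Submodule.mem_sup_left x.2⟩ : borel b), y⁆, I.lie_mem hy, rfl⟩ }
    have hN : N.toSubmodule = ⨆ χ : Weight K H L, (N ⊓ genWeightSpace L χ).toSubmodule :=
      (congrArg LieSubmodule.toSubmodule (eq_iSup_inf_genWeightSpace K H L N)).trans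
        (LieSubmodule.iSup_toSubmodule _)
    change N.toSubmodule ≤ _
    rw [hN]
    refine iSup_le fun χ => ?_
    rintro x ⟨⟨y, hy, rfl⟩, hx⟩
    by_cases h0 : χ.IsZero
    · have hyH : (y : L) ∈ H := by
        have : (y : L) ∈ rootSpace H (0 : H → K) := by
          rw [← show (χ : H → K) = 0 from h0]; exact hx
        rw [rootSpace_zero_eq] at this
        exact this
      have := eq_zero_of_isNilpotent_ad_of_mem_isCartanSubalgebra K L H hyH (hI y hy)
      change (y : L) ∈ _
      rw [this]
      exact Submodule.zero_mem _
    by_cases hpos : b.IsPos ⟨χ, by simpa using h0⟩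
    · by_cases hx0 : (y : L) = 0
      · change (y : L) ∈ _
        rw [hx0]
        exact Submodule.zero_mem _
      refine rootSpace_le_rootSum (α := ⟨⟨χ, by simpa using h0⟩, hpos⟩) ?_ hx
      intro z hz
      obtain ⟨c, hc⟩ := (finrank_eq_one_iff_of_nonzero' (⟨(y : L), hx⟩ : rootSpace H χ)
        (fun h => hx0 (congrArg Subtype.val h))).mp (finrank_rootSpace_eq_one χ h0) ⟨z, hz⟩
      have : z = c • (y : L) := (congrArg Subtype.val hc).symm
      rw [this]
      exact Submodule.smul_mem _ c ⟨y, hy, rfl⟩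
    · have hd : (y : L) ∈ (⊥ : Submodule K L) := (disjoint_borelSubmodule h0 hpos).le_bot ⟨hx, y.2⟩
      change (y : L) ∈ _
      rw [(Submodule.mem_bot K).mp hd]
      exact Submodule.zero_mem _
  · exact iSup₂_le fun α hα => hα

theorem isUp_rootsOf (I : LieIdeal K (borel b)) : IsUp (rootAdd b) (rootsOf I) := by
  intro α hα β γ h z hz
  obtain ⟨x, hx, y, hy, rfl⟩ := exists_lie_eq h hz
  obtain ⟨(x' : borel b), hx', rfl⟩ := hα hx
  refine ⟨⁅x', (⟨y, rootSpace_le_borelSubmodule b β.1 β.2 hy⟩ : borel b)⁆, ?_, rfl⟩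
  rw [← lie_skew]
  exact Submodule.neg_mem _ (I.lie_mem hx')

theorem rootsOf_idealOf (Φ : Set (PosRoot b)) (hΦ : IsUp (rootAdd b) Φ) :
    rootsOf (idealOf Φ hΦ) = Φ := by
  ext α
  change (rootSpace H α.1.1).toSubmodule ≤
    (idealOf Φ hΦ).toSubmodule.map (borel b).toSubmodule.subtype ↔ α ∈ Φ
  rw [map_idealOf, rootSpace_le_rootSum_iff]

theorem idealOf_mem (Φ : Set (PosRoot b)) (hΦ : IsUp (rootAdd b) Φ) :
    idealOf Φ hΦ ∈ adNilpotentIdeals b :=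
  fun _ hx => isNilpotent_ad_of_mem_rootSum (Φ := Φ) hx

theorem map_lowerCentralSeries {I : LieIdeal K (borel b)} (hI : I ∈ adNilpotentIdeals b) (k : ℕ) :
    (lowerCentralSeries K I I k).toSubmodule.map
        ((borel b).toSubmodule.subtype ∘ₗ I.toSubmodule.subtype) =
      rootSum (iterSum (rootAdd b) (rootsOf I) k) := by
  induction k with
  | zero =>
    rw [lowerCentralSeries_zero, LieSubmodule.top_toSubmodule, Submodule.map_comp,
      Submodule.map_subtype_top, map_eq_rootSum hI]
    rfl
  | succ k ih =>
    rw [lowerCentralSeries_succ, LieSubmodule.lieIdeal_oper_eq_linear_span', Submodule.map_span]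
    change _ = rootSum {γ | ∃ α ∈ rootsOf I, ∃ β ∈ iterSum (rootAdd b) (rootsOf I) k,
      rootAdd b α β γ}
    rw [← span_lie_rootSum, ← ih, ← map_eq_rootSum hI]
    congr 1
    ext z
    constructor
    · rintro ⟨_, ⟨x, -, y, hy, rfl⟩, rfl⟩
      exact ⟨_, ⟨x.1, x.2, rfl⟩, _, ⟨y, hy, rfl⟩, rfl⟩
    · rintro ⟨_, ⟨x, hx, rfl⟩, _, ⟨y, hy, rfl⟩, rfl⟩
      exact ⟨_, ⟨⟨x, hx⟩, trivial, y, hy, rfl⟩, rfl⟩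

theorem lowerCentralSeries_eq_bot_iff {I : LieIdeal K (borel b)} (hI : I ∈ adNilpotentIdeals b)
    (k : ℕ) : lowerCentralSeries K I I k = ⊥ ↔ iterSum (rootAdd b) (rootsOf I) k = ∅ := by
  rw [← rootSum_eq_bot_iff, ← map_lowerCentralSeries hI,
    ← LieSubmodule.toSubmodule_eq_bot]
  have hinj : Function.Injective ((borel b).toSubmodule.subtype ∘ₗ I.toSubmodule.subtype) :=
    (Submodule.subtype_injective _).comp (Submodule.subtype_injective _)
  exact ⟨fun h => by rw [h, Submodule.map_bot],
    fun h => Submodule.map_injective_of_injective hinj (h.trans (Submodule.map_bot _).symm)⟩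

/-- Roots reached by `k` additions have height greater than `k`, and heights are bounded. Hence the
infimum defining `nilpotenceClass` is over a nonempty set and is not the default value of `sInf`. -/
theorem exists_iterSum_eq_empty (Φ : Set (PosRoot b)) : ∃ k, iterSum (rootAdd b) Φ k = ∅ := by
  obtain ⟨M, hM0, hM⟩ := exists_heightForm_bound b
  have h : ∀ k, ∀ α ∈ iterSum (rootAdd b) Φ k, (k : ℤ) < b.height α.1 := by
    intro k
    induction k with
    | zero => exact fun α _ => b.isPos_iff.mp α.2
    | succ k ih =>
      rintro γ ⟨α, hα, β, hβ, hadd⟩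
      have h1 := b.isPos_iff.mp α.2
      have h2 := ih β hβ
      have h3 := b.height_add hadd
      push_cast
      omega
  refine ⟨M.toNat, Set.eq_empty_iff_forall_notMem.mpr fun α hα => ?_⟩
  have h1 := h _ α hα
  have h2 := (hM α.1.1 _ (heightForm_root α.1)).2
  omega

theorem nilpotenceClass_le_iff {I : LieIdeal K (borel b)} (hI : I ∈ adNilpotentIdeals b) (k : ℕ) :
    nilpotenceClass I ≤ k ↔ iterSum (rootAdd b) (rootsOf I) k = ∅ := by
  rw [← lowerCentralSeries_eq_bot_iff hI]
  constructor
  · intro h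
    obtain ⟨m, hm⟩ := exists_iterSum_eq_empty (rootsOf I)
    have h1 : lowerCentralSeries K I I (nilpotenceClass I) = ⊥ :=
      Nat.sInf_mem (s := {m | LieModule.lowerCentralSeries K I I m = ⊥})
        ⟨m, (lowerCentralSeries_eq_bot_iff hI m).mpr hm⟩
    exact le_bot_iff.mp (h1 ▸ antitone_lowerCentralSeries K I I h)
  · exact fun h => Nat.sInf_le h

theorem ncard_ideals (b : (rootSystem H).Base) (k : ℕ) :
    {I ∈ adNilpotentIdeals b | nilpotenceClass I ≤ k}.ncard =
      {Φ : Set (PosRoot b) | IsUp (rootAdd b) Φ ∧ iterSum (rootAdd b) Φ k = ∅}.ncard := by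
  refine Set.ncard_congr (fun I _ => rootsOf I) ?_ ?_ ?_
  · rintro I ⟨hI, hk⟩
    exact ⟨isUp_rootsOf I, (nilpotenceClass_le_iff hI k).mp hk⟩
  · rintro I J ⟨hI, -⟩ ⟨hJ, -⟩ h
    have := map_eq_rootSum hI
    rw [h, ← map_eq_rootSum hJ] at this
    exact LieSubmodule.toSubmodule_injective
      (Submodule.map_injective_of_injective (Submodule.subtype_injective _) this)
  · rintro Φ ⟨hΦ, hk⟩
    refine ⟨idealOf Φ hΦ, ⟨idealOf_mem Φ hΦ, ?_⟩, rootsOf_idealOf Φ hΦ⟩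
    rw [nilpotenceClass_le_iff (idealOf_mem Φ hΦ), rootsOf_idealOf]
    exact hk

end Lie

/-! ### Invariance of the count under bijections respecting addition. -/

section Transfer

variable {R R' : Type*} (A : R → R → R → Prop) (A' : R' → R' → R' → Prop) (g : R' ≃ R)

theorem iterSum_preimage (hg : ∀ x y z, A' x y z ↔ A (g x) (g y) (g z)) (Φ : Set R) (k : ℕ) :
    iterSum A' (g ⁻¹' Φ) k = g ⁻¹' iterSum A Φ k := by
  induction k with
  | zero => rfl
  | succ k ih =>
    ext z
    constructor
    · rintro ⟨x, hx, y, hy, h⟩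
      rw [ih] at hy
      exact ⟨g x, hx, g y, hy, (hg x y z).mp h⟩
    · rintro ⟨x, hx, y, hy, h⟩
      refine ⟨g.symm x, by simpa using hx, g.symm y, by rw [ih]; simpa using hy, (hg _ _ _).mpr ?_⟩
      simpa using h

theorem isUp_preimage_iff (hg : ∀ x y z, A' x y z ↔ A (g x) (g y) (g z)) (Φ : Set R) :
    IsUp A' (g ⁻¹' Φ) ↔ IsUp A Φ := by
  constructor
  · intro h α hα β γ hA
    have := h (g.symm α) (by simpa using hα) (g.symm β) (g.symm γ) ((hg _ _ _).mpr (by simpa using hA))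
    simpa using this
  · intro h α hα β γ hA
    exact h _ hα _ _ ((hg _ _ _).mp hA)

theorem ncard_isUp_congr (hg : ∀ x y z, A' x y z ↔ A (g x) (g y) (g z)) (k : ℕ) :
    {Φ : Set R | IsUp A Φ ∧ iterSum A Φ k = ∅}.ncard =
      {Φ : Set R' | IsUp A' Φ ∧ iterSum A' Φ k = ∅}.ncard := by
  refine Set.ncard_congr (fun Φ _ => g ⁻¹' Φ) ?_ ?_ ?_
  · rintro Φ ⟨h1, h2⟩
    refine ⟨(isUp_preimage_iff A A' g hg Φ).mpr h1, ?_⟩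
    rw [iterSum_preimage A A' g hg, h2, Set.preimage_empty]
  · intro Φ Ψ _ _ h
    exact g.surjective.preimage_injective h
  · rintro Φ ⟨h1, h2⟩
    have hΦ : g ⁻¹' (g '' Φ) = Φ := g.injective.preimage_image Φ
    refine ⟨g '' Φ, ⟨?_, ?_⟩, hΦ⟩
    · rw [← isUp_preimage_iff A A' g hg, hΦ]; exact h1
    · rw [← g.surjective.preimage_injective.eq_iff, ← iterSum_preimage A A' g hg, hΦ, h2,
        Set.preimage_empty]

end Transfer

/-! ### The root system of type `D_n` in coordinates. -/

section Model

/-- The positive roots of type `D_n`: the triple `(i, j, true)` stands for `e_i - e_j`, and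
`(i, j, false)` for `e_i + e_j`. -/
abbrev DRoot (n : ℕ) : Type := {x : ℕ × ℕ × Bool // x.1 < x.2.1 ∧ x.2.1 < n}

/-- The standard basis vectors. -/
def stdVec (i : ℕ) : ℕ → ℤ := Pi.single i 1

theorem stdVec_apply (i k : ℕ) : stdVec i k = if k = i then 1 else 0 := by
  simp [stdVec, Pi.single_apply]

/-- The vector of a positive root of type `D_n`. -/
def DRoot.vec {n : ℕ} (x : DRoot n) : ℕ → ℤ :=
  stdVec x.1.1 + (if x.1.2.2 then (-1 : ℤ) else 1) • stdVec x.1.2.1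

/-- Addition of positive roots of type `D_n`. -/
def DRoot.add {n : ℕ} (x y z : DRoot n) : Prop := z.vec = x.vec + y.vec

/-- The simple roots of type `D_n`. -/
def simpleVec (n i : ℕ) : ℕ → ℤ :=
  if i + 1 < n then stdVec i - stdVec (i + 1) else stdVec (n - 2) + stdVec (n - 1)

/-- The scalar product with a simple root of type `D_n`. -/
def simpleForm {A : Type*} [AddCommGroup A] (n i : ℕ) (f : ℕ → A) : A :=
  if i + 1 < n then f i - f (i + 1) else f (n - 2) + f (n - 1)

/-- The simple reflections of type `D_n`. -/
def simpleRefl (n i : ℕ) (f : ℕ → ℤ) : ℕ → ℤ := f - simpleForm n i f • simpleVec n i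

/-- All roots have squared length two, so pairing with a simple coroot is the scalar product with
the simple root. This equality is how the Cartan matrix enters. -/
theorem simpleForm_simpleVec {n : ℕ} (hn : 2 ≤ n) (i j : Fin n) :
    CartanMatrix.D n i j = simpleForm n j (simpleVec n i) := by
  have hi := i.2
  have hj := j.2
  simp only [CartanMatrix.D, Matrix.of_apply, simpleForm, simpleVec, Fin.ext_iff]
  generalize (i : ℕ) = i at *
  generalize (j : ℕ) = j at *
  split_ifs <;> simp only [Pi.sub_apply, Pi.add_apply, stdVec_apply] <;> split_ifs <;> omega

theorem simpleRefl_add (n i : ℕ) (f g : ℕ → ℤ) :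
    simpleRefl n i (f + g) = simpleRefl n i f + simpleRefl n i g := by
  have : simpleForm n i (f + g) = simpleForm n i f + simpleForm n i g := by
    simp only [simpleForm, Pi.add_apply]; split_ifs <;> ring
  rw [simpleRefl, simpleRefl, simpleRefl, this]
  module

theorem simpleRefl_smul (n i : ℕ) (c : ℤ) (f : ℕ → ℤ) :
    simpleRefl n i (c • f) = c • simpleRefl n i f := by
  have : simpleForm n i (c • f) = c * simpleForm n i f := by
    simp only [simpleForm, Pi.smul_apply, smul_eq_mul]; split_ifs <;> ring
  rw [simpleRefl, simpleRefl, this]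
  module

/-- The permutation of the coordinates underlying a simple reflection. -/
def simplePerm (n k : ℕ) : Equiv.Perm ℕ :=
  if k + 1 < n then Equiv.swap k (k + 1) else Equiv.swap (n - 2) (n - 1)

/-- The signs occurring in a simple reflection. -/
def simpleSign (n k i : ℕ) : ℤ :=
  if k + 1 < n then 1 else if i = n - 2 ∨ i = n - 1 then -1 else 1

theorem simpleSign_eq (n k i : ℕ) : simpleSign n k i = 1 ∨ simpleSign n k i = -1 := by
  rw [simpleSign]; split_ifs <;> simp

theorem simplePerm_lt {n : ℕ} (hn : 2 ≤ n) (k : ℕ) {i : ℕ} (hi : i < n) : simplePerm n k i < n := by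
  rw [simplePerm]
  split_ifs <;> rw [Equiv.swap_apply_def] <;> split_ifs <;> omega

theorem simpleRefl_stdVec {n : ℕ} (hn : 2 ≤ n) (k i : ℕ) :
    simpleRefl n k (stdVec i) = simpleSign n k i • stdVec (simplePerm n k i) := by
  ext m
  simp only [simpleRefl, simpleForm, simpleVec, simplePerm, simpleSign]
  split_ifs with h1 h2
  · rw [Equiv.swap_apply_def]
    simp only [Pi.sub_apply, Pi.smul_apply, smul_eq_mul, stdVec_apply]
    split_ifs <;> omega
  · rw [Equiv.swap_apply_def]
    simp only [Pi.sub_apply, Pi.add_apply, Pi.smul_apply, smul_eq_mul, stdVec_apply]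
    split_ifs <;> omega
  · rw [Equiv.swap_apply_def]
    simp only [Pi.sub_apply, Pi.add_apply, Pi.smul_apply, smul_eq_mul, stdVec_apply]
    split_ifs <;> omega

/-- The set of all roots of type `D_n`. -/
def allVec (n : ℕ) : Set (ℕ → ℤ) :=
  {f | ∃ i j : ℕ, ∃ s t : ℤ, i < j ∧ j < n ∧ (s = 1 ∨ s = -1) ∧ (t = 1 ∨ t = -1) ∧
    f = s • stdVec i + t • stdVec j}

theorem mem_allVec_of_ne {n i j : ℕ} (hij : i ≠ j) (hi : i < n) (hj : j < n) {s t : ℤ}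
    (hs : s = 1 ∨ s = -1) (ht : t = 1 ∨ t = -1) : s • stdVec i + t • stdVec j ∈ allVec n := by
  rcases lt_or_gt_of_ne hij with h | h
  · exact ⟨i, j, s, t, h, hj, hs, ht, rfl⟩
  · exact ⟨j, i, t, s, h, hi, ht, hs, add_comm _ _⟩

theorem simpleRefl_mem_allVec {n : ℕ} (hn : 2 ≤ n) (k : ℕ) {f : ℕ → ℤ} (hf : f ∈ allVec n) :
    simpleRefl n k f ∈ allVec n := by
  obtain ⟨i, j, s, t, hij, hj, hs, ht, rfl⟩ := hf
  rw [simpleRefl_add, simpleRefl_smul, simpleRefl_smul, simpleRefl_stdVec hn,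
    simpleRefl_stdVec hn, smul_smul, smul_smul]
  refine mem_allVec_of_ne ((simplePerm n k).injective.ne hij.ne) (simplePerm_lt hn k (by omega))
    (simplePerm_lt hn k hj) ?_ ?_
  · rcases hs with rfl | rfl <;> rcases simpleSign_eq n k i with h | h <;> simp [h]
  · rcases ht with rfl | rfl <;> rcases simpleSign_eq n k j with h | h <;> simp [h]

theorem neg_mem_allVec {n : ℕ} {f : ℕ → ℤ} (hf : f ∈ allVec n) : -f ∈ allVec n := by
  obtain ⟨i, j, s, t, hij, hj, hs, ht, rfl⟩ := hf
  refine ⟨i, j, -s, -t, hij, hj, by omega, by omega, by module⟩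

theorem simpleVec_mem_allVec {n : ℕ} (hn : 2 ≤ n) (i : Fin n) : simpleVec n i ∈ allVec n := by
  rw [simpleVec]
  split_ifs with h
  · exact ⟨i, i + 1, 1, -1, by omega, h, by simp, by simp, by module⟩
  · exact ⟨n - 2, n - 1, 1, 1, by omega, by omega, by simp, by simp, by module⟩

/-- Adjacent transpositions carry `e_i - e_{i+1}` to every `e_i - e_j`. The last reflection sends
`e_i - e_{n-2}` to `e_i + e_{n-1}`, and transpositions then lower the second index of the sum. -/
theorem vec_mem_of_closed {n : ℕ} (hn : 2 ≤ n) (T : Set (ℕ → ℤ))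
    (h1 : ∀ i < n, simpleVec n i ∈ T) (h2 : ∀ i < n, ∀ f ∈ T, simpleRefl n i f ∈ T)
    (x : DRoot n) : x.vec ∈ T := by
  have hD : ∀ i j, i < j → j < n → stdVec i - stdVec j ∈ T := by
    intro i j hij
    induction j, hij using Nat.le_induction with
    | base =>
      intro hj
      have := h1 i (by omega)
      rwa [simpleVec, if_pos hj] at this
    | succ j hij ih =>
      intro hj
      have := h2 j (by omega) _ (ih (by omega))
      rw [sub_eq_add_neg, ← neg_one_smul ℤ, simpleRefl_add, simpleRefl_smul,
        simpleRefl_stdVec hn, simpleRefl_stdVec hn] at this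
      simp only [simpleSign, simplePerm, if_pos hj, Equiv.swap_apply_left] at this
      rw [Equiv.swap_apply_of_ne_of_ne (by omega) (by omega)] at this
      convert this using 1
      module
  have hS1 : ∀ i, i < n - 1 → stdVec i + stdVec (n - 1) ∈ T := by
    intro i hi
    by_cases h : i = n - 2
    · have := h1 (n - 1) (by omega)
      rwa [simpleVec, if_neg (by omega), ← h] at this
    · have := h2 (n - 1) (by omega) _ (hD i (n - 2) (by omega) (by omega))
      rw [sub_eq_add_neg, ← neg_one_smul ℤ, simpleRefl_add, simpleRefl_smul,
        simpleRefl_stdVec hn, simpleRefl_stdVec hn] at this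
      simp only [simpleSign, simplePerm, if_neg (show ¬ n - 1 + 1 < n by omega),
        Equiv.swap_apply_left] at this
      rw [Equiv.swap_apply_of_ne_of_ne (by omega) (by omega), if_neg (by omega),
        if_pos (by simp)] at this
      convert this using 1
      module
  have hS : ∀ d i j, j + d = n - 1 → i < j → stdVec i + stdVec j ∈ T := by
    intro d
    induction d with
    | zero => rintro i j rfl hij; exact hS1 i hij
    | succ d ih =>
      intro i j hj hij
      have := h2 j (by omega) _ (ih i (j + 1) (by omega) (by omega))
      rw [simpleRefl_add, simpleRefl_stdVec hn, simpleRefl_stdVec hn] at this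
      simp only [simpleSign, simplePerm, if_pos (show j + 1 < n by omega),
        Equiv.swap_apply_right, one_smul] at this
      rwa [Equiv.swap_apply_of_ne_of_ne (by omega) (by omega)] at this
  obtain ⟨⟨i, j, s⟩, hij, hj⟩ := x
  simp only at hij hj
  cases s
  · have := hS (n - 1 - j) i j (by omega) hij
    simpa [DRoot.vec] using this
  · have := hD i j hij hj
    simpa [DRoot.vec, sub_eq_add_neg] using this

theorem DRoot.vec_apply {n : ℕ} (x : DRoot n) (k : ℕ) :
    x.vec k = if k = x.1.1 then 1 else if k = x.1.2.1 then (if x.1.2.2 then -1 else 1) else 0 := by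
  have := x.2.1
  simp only [DRoot.vec, Pi.add_apply, Pi.smul_apply, stdVec_apply, smul_eq_mul]
  split_ifs <;> omega

theorem DRoot.vec_injective (n : ℕ) : Function.Injective (DRoot.vec (n := n)) := by
  rintro ⟨⟨i, j, s⟩, hij, hj⟩ ⟨⟨i', j', s'⟩, hij', hj'⟩ h
  have hi := congrFun h i
  have hjj := congrFun h j
  have hi' := congrFun h i'
  have hjj' := congrFun h j'
  simp only [DRoot.vec_apply] at hij hj hij' hj' hi hjj hi' hjj'
  have e1 : i = i' := by grind
  subst e1
  have e2 : j = j' := by grind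
  subst e2
  have e3 : s = s' := by grind
  subst e3
  rfl

end Model

/-! ### Identification of the positive roots with the coordinate model. -/

section Coordinates

open LieAlgebra LieAlgebra.IsKilling LieModule

variable {K : Type*} [Field K]

/-- Integral coordinate vectors, regarded as vectors over `K`. -/
def castVec (K : Type*) [Field K] (f : ℕ → ℤ) : ℕ → K := fun k => (f k : K)

theorem castVec_injective [CharZero K] : Function.Injective (castVec K) := by
  intro f g h
  ext k
  exact Int.cast_injective (α := K) (congrFun h k)

theorem castVec_add (f g : ℕ → ℤ) : castVec K (f + g) = castVec K f + castVec K g := by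
  ext k; simp [castVec]

theorem castVec_neg (f : ℕ → ℤ) : castVec K (-f) = -castVec K f := by
  ext k; simp [castVec]

theorem castVec_sub_zsmul (f g : ℕ → ℤ) (c : ℤ) :
    castVec K (f - c • g) = castVec K f - (c : K) • castVec K g := by
  ext k; simp [castVec]

theorem simpleForm_castVec (n i : ℕ) (f : ℕ → ℤ) :
    simpleForm n i (castVec K f) = (simpleForm n i f : ℤ) := by
  simp only [simpleForm, castVec]
  split_ifs <;> push_cast <;> rfl

/-- `simpleForm` as a linear form. -/
def simpleFormLin (K : Type*) [Field K] (n i : ℕ) : (ℕ → K) →ₗ[K] K where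
  toFun := simpleForm n i
  map_add' f g := by simp only [simpleForm, Pi.add_apply]; split_ifs <;> ring
  map_smul' c f := by
    simp only [simpleForm, Pi.smul_apply, smul_eq_mul, RingHom.id_apply]; split_ifs <;> ring

/-- The height of a coordinate vector. -/
noncomputable def coordHeight (K : Type*) [Field K] (n : ℕ) : (ℕ → K) →ₗ[K] K :=
  ∑ k ∈ Finset.range n, ((n : K) - 1 - k) • LinearMap.proj k

theorem coordHeight_stdVec {n i : ℕ} (hi : i < n) :
    coordHeight K n (castVec K (stdVec i)) = ((n - 1 - i : ℤ) : K) := by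
  rw [coordHeight, LinearMap.sum_apply, Finset.sum_eq_single i]
  · simp [castVec, stdVec]
  · intro k _ hk
    simp [castVec, stdVec_apply, hk]
  · intro h
    exact absurd (Finset.mem_range.mpr hi) h

variable [CharZero K] {L : Type*} [LieRing L] [LieAlgebra K L]
  [IsKilling K L] [FiniteDimensional K L]
  {H : LieSubalgebra K L} [H.IsCartanSubalgebra] [LieModule.IsTriangularizable K H L]
  {b : (rootSystem H).Base}

/-- The linear map from the weight space to coordinate vectors that takes the simple roots to the
standard simple roots of type `D_n`. -/
noncomputable def coords {n : ℕ} (e : b.support ≃ Fin n) : Module.Dual K H →ₗ[K] (ℕ → K) :=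
  b.toWeightBasis.constr K fun i => castVec K (simpleVec n (e i))

theorem coords_simple {n : ℕ} (e : b.support ≃ Fin n) (i : b.support) :
    coords e ((rootSystem H).root i) = castVec K (simpleVec n (e i)) := by
  have := b.toWeightBasis.constr_basis K (fun i => castVec K (simpleVec n (e i))) i
  rwa [b.toWeightBasis_apply] at this

variable {n : ℕ} {e : b.support ≃ Fin n}

/-- Both sides are linear in `x`, and on the basis of simple roots they are entries of the Cartan
matrix. -/
theorem apply_coroot_eq (hn : 2 ≤ n) (he : ∀ i j, b.cartanMatrix i j = CartanMatrix.D n (e i) (e j))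
    (x : Module.Dual K H) (i : b.support) :
    x ((rootSystem H).coroot i) = simpleForm n (e i) (coords e x) := by
  have key : Module.Dual.eval K H ((rootSystem H).coroot i) =
      (simpleFormLin K n (e i)) ∘ₗ coords e := by
    refine b.toWeightBasis.ext fun j => ?_
    rw [b.toWeightBasis_apply]
    change (rootSystem H).root j ((rootSystem H).coroot i) =
      simpleForm n (e i) (coords e ((rootSystem H).root j))
    rw [coords_simple, simpleForm_castVec, ← simpleForm_simpleVec hn, ← he]
    exact (b.algebraMap_cartanMatrixIn_apply ℤ j i).symm
  exact LinearMap.congr_fun key x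

/-- By `apply_coroot_eq`, the coordinates of `x` determine its values on the simple coroots, which
form a basis. -/
theorem coords_injective (hn : 2 ≤ n)
    (he : ∀ i j, b.cartanMatrix i j = CartanMatrix.D n (e i) (e j)) :
    Function.Injective (coords (K := K) e) := by
  rw [injective_iff_map_eq_zero]
  intro x hx
  refine b.toCoweightBasis.ext fun i => ?_
  rw [b.toCoweightBasis_apply, apply_coroot_eq hn he, hx]
  simp [simpleForm]

theorem coords_reflection (hn : 2 ≤ n)
    (he : ∀ i j, b.cartanMatrix i j = CartanMatrix.D n (e i) (e j))
    (α : H.root) (i : b.support) {f : ℕ → ℤ} (hf : coords e ((rootSystem H).root α) = castVec K f) :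
    coords e ((rootSystem H).root ((rootSystem H).reflectionPerm i α)) =
      castVec K (simpleRefl n (e i) f) := by
  rw [RootPairing.root_reflectionPerm, RootPairing.reflection_apply, map_sub, map_smul,
    coords_simple, hf, simpleRefl, castVec_sub_zsmul, ← simpleForm_castVec, ← hf,
    ← apply_coroot_eq hn he]
  rfl

/-- Every root comes from a simple root by simple reflections, and these preserve the vectors `±e_i
± e_j`. The converse inclusion, for positive roots, is `exists_root_coords`. -/
theorem exists_coords (hn : 2 ≤ n)
    (he : ∀ i j, b.cartanMatrix i j = CartanMatrix.D n (e i) (e j)) (α : H.root) :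
    ∃ f ∈ allVec n, coords e ((rootSystem H).root α) = castVec K f := by
  refine b.induction_reflect α
    (p := fun α => ∃ f ∈ allVec n, coords e ((rootSystem H).root α) = castVec K f) ?_ ?_ ?_
  · rintro i ⟨f, hf, h⟩
    refine ⟨-f, neg_mem_allVec hf, ?_⟩
    rw [RootPairing.root_reflectionPerm, RootPairing.reflection_apply_self, map_neg, h, castVec_neg]
  · intro i hi
    exact ⟨_, simpleVec_mem_allVec hn (e ⟨i, hi⟩), coords_simple e ⟨i, hi⟩⟩
  · rintro i j ⟨f, hf, h⟩ hj
    exact ⟨_, simpleRefl_mem_allVec hn _ hf, coords_reflection hn he i ⟨j, hj⟩ h⟩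

theorem exists_root_coords (hn : 2 ≤ n)
    (he : ∀ i j, b.cartanMatrix i j = CartanMatrix.D n (e i) (e j)) (x : DRoot n) :
    ∃ α : H.root, coords e ((rootSystem H).root α) = castVec K x.vec := by
  refine vec_mem_of_closed hn
    {f | ∃ α : H.root, coords e ((rootSystem H).root α) = castVec K f} ?_ ?_ x
  · intro i hi
    refine ⟨e.symm ⟨i, hi⟩, ?_⟩
    rw [coords_simple, Equiv.apply_symm_apply]
  · rintro i hi f ⟨α, hα⟩
    have := coords_reflection hn he α (e.symm ⟨i, hi⟩) hα
    rw [Equiv.apply_symm_apply] at this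
    exact ⟨_, this⟩

/-- The form with coefficients `n - 1 - k` takes the value one on every simple root, including
`e_{n-2} + e_{n-1}`. -/
theorem heightForm_eq (hn : 2 ≤ n) (e : b.support ≃ Fin n) :
    heightForm b = coordHeight K n ∘ₗ coords e := by
  refine b.toWeightBasis.ext fun i => ?_
  rw [heightForm, Module.Basis.constr_basis, LinearMap.comp_apply, b.toWeightBasis_apply,
    coords_simple, simpleVec]
  split_ifs with h
  · rw [sub_eq_add_neg, castVec_add, castVec_neg, map_add, map_neg, coordHeight_stdVec (by omega),
      coordHeight_stdVec h, ← Int.cast_neg, ← Int.cast_add]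
    rw [show ((n - 1 - (e i : ℕ) : ℤ) + -(n - 1 - ((e i : ℕ) + 1 : ℕ) : ℤ)) = 1 by push_cast; ring]
    simp
  · rw [castVec_add, map_add, coordHeight_stdVec (by omega), coordHeight_stdVec (by omega),
      ← Int.cast_add]
    rw [show ((n - 1 - (n - 2 : ℕ) : ℤ) + (n - 1 - (n - 1 : ℕ) : ℤ)) = 1 by omega]
    simp

theorem height_eq_of_coords (hn : 2 ≤ n) {α : H.root} {i j : ℕ} {s t : ℤ} (hi : i < n) (hj : j < n)
    (h : coords e ((rootSystem H).root α) = castVec K (s • stdVec i + t • stdVec j)) :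
    b.height α = s * (n - 1 - i) + t * (n - 1 - j) := by
  have h1 := heightForm_root (b := b) α
  have h2 : ∀ (c : ℤ) (f : ℕ → ℤ), castVec K (c • f) = (c : K) • castVec K f := by
    intro c f; ext k; simp [castVec]
  rw [heightForm_eq hn e, LinearMap.comp_apply, h, castVec_add, h2, h2, map_add, map_smul, map_smul,
    coordHeight_stdVec hi, coordHeight_stdVec hj, smul_eq_mul, smul_eq_mul] at h1
  exact_mod_cast h1.symm

theorem exists_equiv_dRoot (hn : 2 ≤ n) (hD : IsTypeD b n) :
    ∃ g : DRoot n ≃ PosRoot b, ∀ x y z, DRoot.add x y z ↔ rootAdd b (g x) (g y) (g z) := by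
  obtain ⟨e, he⟩ := hD
  choose r hr using exists_root_coords hn he
  have hpos : ∀ x, b.IsPos (r x) := by
    intro x
    have hx := x.2
    have := height_eq_of_coords (s := 1) (t := if x.1.2.2 then -1 else 1) hn
      (hx.1.trans hx.2) hx.2 ((hr x).trans (by rw [DRoot.vec, one_smul]))
    rw [b.isPos_iff, this]
    split_ifs <;> omega
  let g : DRoot n → PosRoot b := fun x => ⟨r x, hpos x⟩
  have hg : Function.Bijective g := by
    constructor
    · intro x y h
      apply DRoot.vec_injective
      apply castVec_injective (K := K)
      rw [← hr, ← hr, show r x = r y from congrArg Subtype.val h]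
    · rintro ⟨α, hα⟩
      obtain ⟨f, ⟨i, j, s, t, hij, hj, hs, ht, rfl⟩, h⟩ := exists_coords hn he α
      have hh := height_eq_of_coords hn (by omega) hj h
      have hα' := b.isPos_iff.mp hα
      -- Since `n - 1 - i > n - 1 - j ≥ 0`, the height has the sign of `s`.
      have hs1 : s = 1 := by
        rcases hs with rfl | rfl
        · rfl
        · rcases ht with rfl | rfl <;> omega
      refine ⟨⟨(i, j, decide (t = -1)), hij, hj⟩, Subtype.ext ((rootSystem H).root.injective ?_)⟩
      apply coords_injective hn he
      change coords e ((rootSystem H).root (r _)) = _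
      rw [hr, h, DRoot.vec, hs1, one_smul]
      rcases ht with rfl | rfl <;> simp
  refine ⟨Equiv.ofBijective g hg, fun x y z => ?_⟩
  change z.vec = x.vec + y.vec ↔
    (rootSystem H).root (r z) = (rootSystem H).root (r x) + (rootSystem H).root (r y)
  rw [← (coords_injective hn he).eq_iff, map_add, hr, hr, hr, ← castVec_add,
    castVec_injective.eq_iff]

end Coordinates

open LieAlgebra LieAlgebra.IsKilling LieModule in
theorem ncard_ideals_of_isTypeD {K L : Type*} [Field K] [CharZero K] [LieRing L] [LieAlgebra K L]
    [IsKilling K L] [FiniteDimensional K L] {H : LieSubalgebra K L} [H.IsCartanSubalgebra]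
    [LieModule.IsTriangularizable K H L] (b : (rootSystem H).Base) {n : ℕ} (hn : 2 ≤ n)
    (hD : IsTypeD b n) (k : ℕ) :
    {I ∈ adNilpotentIdeals b | nilpotenceClass I ≤ k}.ncard =
      {Φ : Set (DRoot n) | IsUp DRoot.add Φ ∧ iterSum DRoot.add Φ k = ∅}.ncard := by
  obtain ⟨g, hg⟩ := exists_equiv_dRoot hn hD
  rw [ncard_ideals, ncard_isUp_congr _ _ g hg]

/-! ### Upward closed sets as pairs of relations `D` (differences) and `S` (sums). -/

section Relations

variable {n : ℕ}

instance : Finite (DRoot n) := by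
  let f : DRoot n → Fin n × Fin n × Bool := fun x =>
    (⟨x.1.1, x.2.1.trans x.2.2⟩, ⟨x.1.2.1, x.2.2⟩, x.1.2.2)
  refine Finite.of_injective f fun x y h => ?_
  simp only [f, Prod.mk.injEq, Fin.mk.injEq] at h
  exact Subtype.ext (Prod.ext h.1 (Prod.ext h.2.1 h.2.2))

/-- `e_i - e_j` belongs to `Φ`. -/
def diffRel (Φ : Set (DRoot n)) (i j : ℕ) : Prop :=
  (i < j ∧ j < n) ∧ ∃ x ∈ Φ, x.vec = stdVec i - stdVec j

/-- `e_i + e_j` belongs to `Φ`. -/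
def sumRel (Φ : Set (DRoot n)) (i j : ℕ) : Prop :=
  (i ≠ j ∧ i < n ∧ j < n) ∧ ∃ x ∈ Φ, x.vec = stdVec i + stdVec j

/-- The sums of an element of `Φ` and an element of `Ψ`. -/
def addSet (Φ Ψ : Set (DRoot n)) : Set (DRoot n) :=
  {z | ∃ x ∈ Φ, ∃ y ∈ Ψ, DRoot.add x y z}

theorem vec_mk_true {i j : ℕ} (h : i < j ∧ j < n) :
    DRoot.vec (⟨(i, j, true), h⟩ : DRoot n) = stdVec i - stdVec j := by
  simp [DRoot.vec, sub_eq_add_neg]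

theorem vec_mk_false {i j : ℕ} (h : i < j ∧ j < n) :
    DRoot.vec (⟨(i, j, false), h⟩ : DRoot n) = stdVec i + stdVec j := by
  simp [DRoot.vec]

theorem exists_vec_diff {i j : ℕ} (h : i < j ∧ j < n) :
    ∃ x : DRoot n, x.vec = stdVec i - stdVec j := ⟨_, vec_mk_true h⟩

theorem exists_vec_sum {i j : ℕ} (h : i ≠ j ∧ i < n ∧ j < n) :
    ∃ x : DRoot n, x.vec = stdVec i + stdVec j := by
  rcases lt_or_gt_of_ne h.1 with h1 | h1
  · exact ⟨_, vec_mk_false ⟨h1, h.2.2⟩⟩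
  · exact ⟨_, (vec_mk_false ⟨h1, h.2.1⟩).trans (add_comm _ _)⟩

theorem sumRel_symm {Φ : Set (DRoot n)} {i j : ℕ} (h : sumRel Φ i j) : sumRel Φ j i :=
  ⟨⟨h.1.1.symm, h.1.2.2, h.1.2.1⟩, by simpa [add_comm] using h.2⟩

theorem diffRel_mk {Φ : Set (DRoot n)} {i j : ℕ} (h : i < j ∧ j < n) :
    diffRel Φ i j ↔ (⟨(i, j, true), h⟩ : DRoot n) ∈ Φ := by
  constructor
  · rintro ⟨-, x, hx, hv⟩
    rw [← vec_mk_true h, (DRoot.vec_injective n).eq_iff] at hv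
    exact hv ▸ hx
  · exact fun hx => ⟨h, _, hx, vec_mk_true h⟩

theorem sumRel_mk {Φ : Set (DRoot n)} {i j : ℕ} (h : i < j ∧ j < n) :
    sumRel Φ i j ↔ (⟨(i, j, false), h⟩ : DRoot n) ∈ Φ := by
  constructor
  · rintro ⟨-, x, hx, hv⟩
    rw [← vec_mk_false h, (DRoot.vec_injective n).eq_iff] at hv
    exact hv ▸ hx
  · exact fun hx => ⟨⟨h.1.ne, h.1.trans h.2, h.2⟩, _, hx, vec_mk_false h⟩

theorem ext_of_rel {Φ Ψ : Set (DRoot n)} (h1 : ∀ i j, diffRel Φ i j ↔ diffRel Ψ i j)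
    (h2 : ∀ i j, sumRel Φ i j ↔ sumRel Ψ i j) : Φ = Ψ := by
  ext ⟨⟨i, j, s⟩, h⟩
  cases s
  · rw [← sumRel_mk h, ← sumRel_mk h, h2]
  · rw [← diffRel_mk h, ← diffRel_mk h, h1]

theorem diffRel_addSet_of {Φ Ψ : Set (DRoot n)} {i j k : ℕ} (h1 : diffRel Φ i j)
    (h2 : diffRel Ψ j k) : diffRel (addSet Φ Ψ) i k := by
  obtain ⟨⟨h, h'⟩, x, hx, hxv⟩ := h1
  obtain ⟨⟨h'', h'''⟩, y, hy, hyv⟩ := h2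
  obtain ⟨z, hz⟩ := exists_vec_diff (⟨h.trans h'', h'''⟩ : i < k ∧ k < n)
  exact ⟨⟨h.trans h'', h'''⟩, z, ⟨x, hx, y, hy, by rw [DRoot.add, hxv, hyv, hz]; abel⟩, hz⟩

theorem diffRel_addSet_of' {Φ Ψ : Set (DRoot n)} {i j k : ℕ} (h1 : diffRel Φ j k)
    (h2 : diffRel Ψ i j) : diffRel (addSet Φ Ψ) i k := by
  obtain ⟨⟨h, h'⟩, x, hx, hxv⟩ := h1
  obtain ⟨⟨h'', h'''⟩, y, hy, hyv⟩ := h2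
  obtain ⟨z, hz⟩ := exists_vec_diff (⟨h''.trans h, h'⟩ : i < k ∧ k < n)
  exact ⟨⟨h''.trans h, h'⟩, z, ⟨x, hx, y, hy, by rw [DRoot.add, hxv, hyv, hz]; abel⟩, hz⟩

theorem sumRel_addSet_of {Φ Ψ : Set (DRoot n)} {i j k : ℕ} (hik : i ≠ k) (h1 : diffRel Φ i j)
    (h2 : sumRel Ψ j k) : sumRel (addSet Φ Ψ) i k := by
  obtain ⟨⟨h, h'⟩, x, hx, hxv⟩ := h1
  obtain ⟨⟨-, -, h''⟩, y, hy, hyv⟩ := h2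
  have hik' : i ≠ k ∧ i < n ∧ k < n := ⟨hik, h.trans h', h''⟩
  obtain ⟨z, hz⟩ := exists_vec_sum hik'
  exact ⟨hik', z, ⟨x, hx, y, hy, by rw [DRoot.add, hxv, hyv, hz]; abel⟩, hz⟩

theorem sumRel_addSet_of' {Φ Ψ : Set (DRoot n)} {i j k : ℕ} (hik : i ≠ k) (h1 : sumRel Φ j k)
    (h2 : diffRel Ψ i j) : sumRel (addSet Φ Ψ) i k := by
  obtain ⟨⟨h, h'⟩, x, hx, hxv⟩ := h2
  obtain ⟨⟨-, -, h''⟩, y, hy, hyv⟩ := h1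
  have hik' : i ≠ k ∧ i < n ∧ k < n := ⟨hik, h.trans h', h''⟩
  obtain ⟨z, hz⟩ := exists_vec_sum hik'
  exact ⟨hik', z, ⟨y, hy, x, hx, by rw [DRoot.add, hxv, hyv, hz]; abel⟩, hz⟩

/-- Comparing coordinates at the six indices leaves only difference plus difference and difference
plus sum; two sums never add to a root. The alternatives inside record which index cancels and how
the result is ordered. -/
theorem add_cases {i j i' j' i'' j'' : ℕ} {s s' s'' : Bool} (h : i < j ∧ j < n)
    (h' : i' < j' ∧ j' < n) (h'' : i'' < j'' ∧ j'' < n)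
    (hadd : DRoot.add (⟨(i, j, s), h⟩ : DRoot n) ⟨(i', j', s'), h'⟩ ⟨(i'', j'', s''), h''⟩) :
    (s = true ∧ s' = true ∧ s'' = true ∧
      ((j = i' ∧ i'' = i ∧ j'' = j') ∨ (j' = i ∧ i'' = i' ∧ j'' = j))) ∨
    (s = true ∧ s' = false ∧ s'' = false ∧
      ((i' = j ∧ (i'' = i ∧ j'' = j' ∨ i'' = j' ∧ j'' = i)) ∨
        (j' = j ∧ (i'' = i ∧ j'' = i' ∨ i'' = i' ∧ j'' = i)))) ∨
    (s = false ∧ s' = true ∧ s'' = false ∧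
      ((i = j' ∧ (i'' = i' ∧ j'' = j ∨ i'' = j ∧ j'' = i')) ∨
        (j = j' ∧ (i'' = i' ∧ j'' = i ∨ i'' = i ∧ j'' = i')))) := by
  have e : ∀ k, DRoot.vec (⟨(i'', j'', s''), h''⟩ : DRoot n) k =
      DRoot.vec (⟨(i, j, s), h⟩ : DRoot n) k + DRoot.vec (⟨(i', j', s'), h'⟩ : DRoot n) k :=
    fun k => congrFun hadd k
  simp only [DRoot.vec_apply] at e
  have e1 := e i
  have e2 := e j
  have e3 := e i'
  have e4 := e j'
  have e5 := e i''
  have e6 := e j''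
  clear e hadd
  cases s <;> cases s' <;> cases s'' <;> simp at e1 e2 e3 e4 e5 e6 ⊢ <;> grind

theorem diffRel_addSet {Φ Ψ : Set (DRoot n)} {i k : ℕ} (h : diffRel (addSet Φ Ψ) i k) :
    ∃ j, (diffRel Φ i j ∧ diffRel Ψ j k) ∨ (diffRel Φ j k ∧ diffRel Ψ i j) := by
  have hik := h.1
  rw [diffRel_mk hik] at h
  obtain ⟨⟨⟨a, c, s⟩, hx'⟩, hx, ⟨⟨a', c', s'⟩, hy'⟩, hy, hadd⟩ := h
  rcases add_cases _ _ _ hadd with ⟨rfl, rfl, -, h | h⟩ | ⟨-, -, h, -⟩ | ⟨-, -, h, -⟩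
  · obtain ⟨rfl, rfl, rfl⟩ := h
    exact ⟨c, Or.inl ⟨(diffRel_mk _).mpr hx, (diffRel_mk _).mpr hy⟩⟩
  · obtain ⟨rfl, rfl, rfl⟩ := h
    exact ⟨c', Or.inr ⟨(diffRel_mk _).mpr hx, (diffRel_mk _).mpr hy⟩⟩
  · simp at h
  · simp at h

/-- A decomposition of `e_i + e_k` with a prescribed orientation. -/
def SumSplit (Φ Ψ : Set (DRoot n)) (i k : ℕ) : Prop :=
  ∃ j, (diffRel Φ i j ∧ sumRel Ψ j k) ∨ (sumRel Φ j k ∧ diffRel Ψ i j)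

theorem sumRel_addSet {Φ Ψ : Set (DRoot n)} {i k : ℕ} (h : sumRel (addSet Φ Ψ) i k) :
    SumSplit Φ Ψ i k ∨ SumSplit Φ Ψ k i := by
  wlog hik : i < k generalizing i k
  · exact (this (sumRel_symm h) (lt_of_le_of_ne (not_lt.mp hik) h.1.1.symm)).symm
  have hik' : i < k ∧ k < n := ⟨hik, h.1.2.2⟩
  rw [sumRel_mk hik'] at h
  obtain ⟨⟨⟨a, c, s⟩, hx'⟩, hx, ⟨⟨a', c', s'⟩, hy'⟩, hy, hadd⟩ := h
  rcases add_cases _ _ _ hadd with ⟨-, -, h, -⟩ | ⟨rfl, rfl, -, h⟩ | ⟨rfl, rfl, -, h⟩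
  · simp at h
  · rcases h with ⟨rfl, ⟨rfl, rfl⟩ | ⟨rfl, rfl⟩⟩ | ⟨rfl, ⟨rfl, rfl⟩ | ⟨rfl, rfl⟩⟩
    · exact Or.inl ⟨_, Or.inl ⟨(diffRel_mk _).mpr hx, (sumRel_mk _).mpr hy⟩⟩
    · exact Or.inr ⟨_, Or.inl ⟨(diffRel_mk _).mpr hx, (sumRel_mk _).mpr hy⟩⟩
    · exact Or.inl ⟨_, Or.inl ⟨(diffRel_mk _).mpr hx, sumRel_symm ((sumRel_mk _).mpr hy)⟩⟩
    · exact Or.inr ⟨_, Or.inl ⟨(diffRel_mk _).mpr hx, sumRel_symm ((sumRel_mk _).mpr hy)⟩⟩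
  · rcases h with ⟨rfl, ⟨rfl, rfl⟩ | ⟨rfl, rfl⟩⟩ | ⟨rfl, ⟨rfl, rfl⟩ | ⟨rfl, rfl⟩⟩
    · exact Or.inl ⟨_, Or.inr ⟨(sumRel_mk _).mpr hx, (diffRel_mk _).mpr hy⟩⟩
    · exact Or.inr ⟨_, Or.inr ⟨(sumRel_mk _).mpr hx, (diffRel_mk _).mpr hy⟩⟩
    · exact Or.inl ⟨_, Or.inr ⟨sumRel_symm ((sumRel_mk _).mpr hx), (diffRel_mk _).mpr hy⟩⟩
    · exact Or.inr ⟨_, Or.inr ⟨sumRel_symm ((sumRel_mk _).mpr hx), (diffRel_mk _).mpr hy⟩⟩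

theorem eq_empty_iff_rel {Φ : Set (DRoot n)} :
    Φ = ∅ ↔ (∀ i j, ¬ diffRel Φ i j) ∧ ∀ i j, ¬ sumRel Φ i j := by
  constructor
  · rintro rfl
    exact ⟨fun i j ⟨_, x, hx, _⟩ => hx, fun i j ⟨_, x, hx, _⟩ => hx⟩
  · rintro ⟨h1, h2⟩
    rw [Set.eq_empty_iff_forall_notMem]
    rintro ⟨⟨i, j, s⟩, h⟩ hx
    cases s
    · exact h2 i j ((sumRel_mk h).mpr hx)
    · exact h1 i j ((diffRel_mk h).mpr hx)

/-- The closure properties of the relations attached to an ideal of positive roots of type `D_n`. -/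
structure IsDIdeal (n : ℕ) (D S : ℕ → ℕ → Prop) : Prop where
  D_lt : ∀ {i j}, D i j → i < j ∧ j < n
  S_ne : ∀ {i j}, S i j → i ≠ j ∧ i < n ∧ j < n
  S_symm : ∀ {i j}, S i j → S j i
  D_left : ∀ {i j k}, D i j → k ≤ i → D k j
  D_right : ∀ {i j k}, D i j → j ≤ k → k < n → D i k
  S_left : ∀ {i j k}, S i j → k ≤ i → k ≠ j → S k j
  D_S : ∀ {i j k}, D i j → k < n → k ≠ i → k ≠ j → S i k

theorem isUp_iff_addSet {Φ : Set (DRoot n)} : IsUp DRoot.add Φ ↔ addSet Φ Set.univ ⊆ Φ :=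
  ⟨fun h z ⟨x, hx, y, _, hz⟩ => h x hx y z hz, fun h x hx y _ hz => h ⟨x, hx, y, trivial, hz⟩⟩

theorem diffRel_univ {i j : ℕ} (h : i < j ∧ j < n) : diffRel (Set.univ : Set (DRoot n)) i j :=
  (diffRel_mk h).mpr trivial

theorem sumRel_univ {i j : ℕ} (h : i ≠ j ∧ i < n ∧ j < n) :
    sumRel (Set.univ : Set (DRoot n)) i j :=
  ⟨h, (exists_vec_sum h).imp fun _ hx => ⟨trivial, hx⟩⟩

theorem diffRel_mono {Φ Ψ : Set (DRoot n)} (h : Φ ⊆ Ψ) {i j : ℕ} (hr : diffRel Φ i j) :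
    diffRel Ψ i j := ⟨hr.1, hr.2.imp fun _ hx => ⟨h hx.1, hx.2⟩⟩

theorem sumRel_mono {Φ Ψ : Set (DRoot n)} (h : Φ ⊆ Ψ) {i j : ℕ} (hr : sumRel Φ i j) :
    sumRel Ψ i j := ⟨hr.1, hr.2.imp fun _ hx => ⟨h hx.1, hx.2⟩⟩

/-- Each closure rule adds one positive root: `e_k - e_i` in `D_left` and `S_left`, `e_j - e_k` in
`D_right`, `e_j + e_k` in `D_S`. Conversely, every decomposition of a sum falls under one of them.
-/
theorem isUp_iff_isDIdeal {Φ : Set (DRoot n)} :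
    IsUp DRoot.add Φ ↔ IsDIdeal n (diffRel Φ) (sumRel Φ) := by
  rw [isUp_iff_addSet]
  constructor
  · intro h
    refine ⟨fun h => h.1, fun h => h.1, sumRel_symm, ?_, ?_, ?_, ?_⟩
    · intro i j k hij hki
      rcases hki.eq_or_lt with rfl | hki
      · exact hij
      · exact diffRel_mono h (diffRel_addSet_of' hij (diffRel_univ ⟨hki, hij.1.1.trans hij.1.2⟩))
    · intro i j k hij hjk hk
      rcases hjk.eq_or_lt with rfl | hjk
      · exact hij
      · exact diffRel_mono h (diffRel_addSet_of hij (diffRel_univ ⟨hjk, hk⟩))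
    · intro i j k hij hki hkj
      rcases hki.eq_or_lt with rfl | hki
      · exact hij
      · exact sumRel_mono h (sumRel_addSet_of' hkj hij (diffRel_univ ⟨hki, hij.1.2.1⟩))
    · intro i j k hij hk hki hkj
      exact sumRel_mono h (sumRel_addSet_of hki.symm hij (sumRel_univ ⟨hkj.symm, hij.1.2, hk⟩))
  · intro h
    have hS : ∀ i k, i ≠ k → SumSplit Φ Set.univ i k → sumRel Φ i k := by
      rintro i k hik ⟨j, ⟨h1, h2⟩ | ⟨h1, h2⟩⟩
      · exact h.D_S h1 h2.1.2.2 hik.symm h2.1.1.symm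
      · exact h.S_left h1 h2.1.1.le hik
    rintro ⟨⟨i, j, s⟩, hij⟩ hx
    cases s
    · rw [← sumRel_mk hij] at hx ⊢
      rcases sumRel_addSet hx with h1 | h1
      · exact hS _ _ hx.1.1 h1
      · exact sumRel_symm (hS _ _ hx.1.1.symm h1)
    · rw [← diffRel_mk hij] at hx ⊢
      obtain ⟨k, ⟨h1, h2⟩ | ⟨h1, h2⟩⟩ := diffRel_addSet hx
      · exact h.D_right h1 h2.1.1.le hij.2
      · exact h.D_left h1 h2.1.1.le

/-- The set of positive roots with given relations. -/
def ofRel (n : ℕ) (D S : ℕ → ℕ → Prop) : Set (DRoot n) :=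
  {x | if x.1.2.2 then D x.1.1 x.1.2.1 else S x.1.1 x.1.2.1}

theorem diffRel_ofRel {D S : ℕ → ℕ → Prop} (h : IsDIdeal n D S) :
    diffRel (ofRel n D S) = D := by
  ext i j
  constructor
  · intro hx
    rw [diffRel_mk hx.1] at hx
    simpa [ofRel] using hx
  · intro hx
    rw [diffRel_mk (h.D_lt hx)]
    simpa [ofRel] using hx

theorem sumRel_ofRel {D S : ℕ → ℕ → Prop} (h : IsDIdeal n D S) :
    sumRel (ofRel n D S) = S := by
  have key : ∀ i j, i < j → (sumRel (ofRel n D S) i j ↔ S i j) := by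
    intro i j hij
    constructor
    · intro hx
      rw [sumRel_mk ⟨hij, hx.1.2.2⟩] at hx
      simpa [ofRel] using hx
    · intro hx
      rw [sumRel_mk ⟨hij, (h.S_ne hx).2.2⟩]
      simpa [ofRel] using hx
  ext i j
  rcases lt_trichotomy i j with hij | rfl | hij
  · exact key i j hij
  · exact ⟨fun hx => absurd rfl hx.1.1, fun hx => absurd rfl (h.S_ne hx).1⟩
  · exact ⟨fun hx => h.S_symm ((key j i hij).mp (sumRel_symm hx)),
      fun hx => sumRel_symm ((key j i hij).mpr (h.S_symm hx))⟩

theorem ncard_isUp_eq_ncard_rel (P : Set (DRoot n) → Prop) (Q : (ℕ → ℕ → Prop) → (ℕ → ℕ → Prop) → Prop)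
    (hPQ : ∀ Φ, IsUp DRoot.add Φ → (P Φ ↔ Q (diffRel Φ) (sumRel Φ))) :
    {Φ : Set (DRoot n) | IsUp DRoot.add Φ ∧ P Φ}.ncard =
      {p : (ℕ → ℕ → Prop) × (ℕ → ℕ → Prop) | IsDIdeal n p.1 p.2 ∧ Q p.1 p.2}.ncard := by
  refine Set.ncard_congr (fun Φ _ => (diffRel Φ, sumRel Φ)) ?_ ?_ ?_
  · rintro Φ ⟨h1, h2⟩
    exact ⟨isUp_iff_isDIdeal.mp h1, (hPQ Φ h1).mp h2⟩
  · intro Φ Ψ _ _ h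
    have h1 := congrArg Prod.fst h
    have h2 := congrArg Prod.snd h
    exact ext_of_rel (fun i j => iff_of_eq (congrFun (congrFun h1 i) j))
      (fun i j => iff_of_eq (congrFun (congrFun h2 i) j))
  · rintro ⟨D, S⟩ ⟨h1, h2⟩
    have hd := diffRel_ofRel h1
    have hs := sumRel_ofRel h1
    have hup : IsUp DRoot.add (ofRel n D S) := by
      rw [isUp_iff_isDIdeal, hd, hs]; exact h1
    refine ⟨ofRel n D S, ⟨hup, ?_⟩, by rw [hd, hs]⟩
    rw [hPQ _ hup, hd, hs]
    exact h2

end Relations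

/-! ### Class at most two or three as the absence of one path. -/

section Criteria

variable {n : ℕ}

/-- The condition that `e_i - e_{n-1}` is present only when `e_i + e_{n-1}` is. -/
def IsSided (n : ℕ) (D S : ℕ → ℕ → Prop) : Prop := ∀ i, D i (n - 1) → S i (n - 1)

/-- Whether some `e_i + e_{n-1}` is present without `e_i - e_{n-1}`. -/
def IsStrict (n : ℕ) (D S : ℕ → ℕ → Prop) : Prop := ∃ i, S i (n - 1) ∧ ¬ D i (n - 1)

/-- The criterion for class at most two. -/
def NoPathThree (D S : ℕ → ℕ → Prop) : Prop :=
  ∀ k l, D 0 k → S k l → ¬ D 1 l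

/-- The criterion for class at most three. -/
def NoPathFour (D S : ℕ → ℕ → Prop) : Prop :=
  ∀ a k l, D 0 a → D a k → S k l → ¬ D 1 l

/-- Moving `j` to `n - 1` frees every `k` other than `n - 1`; that remaining value is what sidedness
supplies. -/
theorem IsDIdeal.D_S' {D S : ℕ → ℕ → Prop} (h : IsDIdeal n D S) (hs : IsSided n D S) {i j k : ℕ}
    (hD : D i j) (hk : k < n) (hki : k ≠ i) : S i k := by
  by_cases hkj : k = n - 1
  · subst hkj
    exact hs i (h.D_right hD (by have := h.D_lt hD; omega) hk)
  · exact h.D_S (h.D_right hD (by have := h.D_lt hD; omega) (by omega) : D i (n - 1)) hk hki hkj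

/-- A path of length two. -/
theorem iterSum_one_cases {Φ : Set (DRoot n)} {i k : ℕ} (h : diffRel (iterSum DRoot.add Φ 1) i k) :
    ∃ j, diffRel Φ i j ∧ diffRel Φ j k := by
  obtain ⟨j, h | h⟩ := diffRel_addSet (Φ := Φ) (Ψ := Φ) h
  · exact ⟨j, h⟩
  · exact ⟨j, h.2, h.1⟩

theorem sumRel_iterSum_one_cases {Φ : Set (DRoot n)} {i k : ℕ}
    (h : sumRel (iterSum DRoot.add Φ 1) i k) :
    ∃ j, (diffRel Φ i j ∧ sumRel Φ j k) ∨ (diffRel Φ k j ∧ sumRel Φ j i) := by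
  rcases sumRel_addSet (Φ := Φ) (Ψ := Φ) h with ⟨j, h | h⟩ | ⟨j, h | h⟩
  · exact ⟨j, Or.inl h⟩
  · exact ⟨j, Or.inl h.symm⟩
  · exact ⟨j, Or.inr h⟩
  · exact ⟨j, Or.inr h.symm⟩

variable {Φ : Set (DRoot n)}

/-- One-sidedness turns `D j k` into `S j k`. As `j ≥ 1`, also `D 0 j` and `D 1 k`, which together
form the forbidden path. -/
theorem diffRel_chain_false
    (h : IsDIdeal n (diffRel Φ) (sumRel Φ)) (hs : IsSided n (diffRel Φ) (sumRel Φ))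
    (hP : NoPathThree (diffRel Φ) (sumRel Φ)) {i j k : ℕ}
    (h1 : diffRel Φ i j) (h2 : diffRel Φ j k) : False :=
  hP j k (h.D_left h1 (Nat.zero_le i)) (h.D_S' hs h2 h2.1.2 h2.1.1.ne')
    (h.D_left h2 (by have := h1.1; omega))

theorem sum_path_false (h : IsDIdeal n (diffRel Φ) (sumRel Φ))
    (hP : NoPathThree (diffRel Φ) (sumRel Φ)) {i j k l : ℕ} (hil : i ≠ l)
    (h1 : diffRel Φ i j) (h2 : sumRel Φ j k) (h3 : diffRel Φ l k) : False := by
  rcases lt_or_gt_of_ne hil with hlt | hlt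
  · exact hP j k (h.D_left h1 (Nat.zero_le i)) h2 (h.D_left h3 (by omega))
  · exact hP k j (h.D_left h3 (Nat.zero_le l)) (h.S_symm h2) (h.D_left h1 (by omega))

/-- The path sums to `e_0 + e_1`. Conversely, a triple sum contains either two chained differences
or a difference, a sum and a difference; the closure rules move the outer indices of the latter down
to 0 and 1. -/
theorem iterSum_two_eq_empty_iff
    (h : IsDIdeal n (diffRel Φ) (sumRel Φ)) (hs : IsSided n (diffRel Φ) (sumRel Φ)) :
    iterSum DRoot.add Φ 2 = ∅ ↔ NoPathThree (diffRel Φ) (sumRel Φ) := by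
  rw [eq_empty_iff_rel]
  constructor
  · rintro ⟨-, h2⟩ k l hk hkl hl
    have h3 : sumRel (iterSum DRoot.add Φ 1) 0 l :=
      sumRel_addSet_of (by have := hl.1; omega) hk hkl
    exact h2 1 0 (sumRel_addSet_of (by omega) hl (sumRel_symm h3))
  · intro hP
    constructor
    · intro i k hik
      obtain ⟨j, ⟨h1, h2⟩ | ⟨h1, h2⟩⟩ := diffRel_addSet (Φ := Φ) (Ψ := iterSum DRoot.add Φ 1) hik
      · obtain ⟨m, h3, h4⟩ := iterSum_one_cases h2
        exact diffRel_chain_false h hs hP h3 h4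
      · obtain ⟨m, h3, h4⟩ := iterSum_one_cases h2
        exact diffRel_chain_false h hs hP h3 h4
    · have key : ∀ i k, i ≠ k → ¬ SumSplit Φ (iterSum DRoot.add Φ 1) i k := by
        rintro i k hik ⟨j, ⟨h1, h2⟩ | ⟨h1, h2⟩⟩
        · obtain ⟨m, ⟨h3, h4⟩ | ⟨h3, h4⟩⟩ := sumRel_iterSum_one_cases h2
          · exact diffRel_chain_false h hs hP h1 h3
          · exact sum_path_false h hP hik h1 (h.S_symm h4) h3
        · obtain ⟨m, h3, h4⟩ := iterSum_one_cases h2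
          exact diffRel_chain_false h hs hP h3 h4
      intro i k hik
      rcases sumRel_addSet (Φ := Φ) (Ψ := iterSum DRoot.add Φ 1) hik with h1 | h1
      · exact key i k hik.1.1 h1
      · exact key k i hik.1.1.symm h1

/-- Here `i ≥ 1` gives both `D 0 j` and `D 1 j`, and `D j k` gives `S k j`, so the forbidden path
occurs with `l = j`. -/
theorem diffRel_chain_false_of_pos
    (h : IsDIdeal n (diffRel Φ) (sumRel Φ)) (hs : IsSided n (diffRel Φ) (sumRel Φ))
    (hP : NoPathFour (diffRel Φ) (sumRel Φ)) {i j k : ℕ}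
    (hi : 0 < i) (h1 : diffRel Φ i j) (h2 : diffRel Φ j k) : False :=
  hP j k j (h.D_left h1 (Nat.zero_le i)) h2
    (h.S_symm (h.D_S' hs h2 h2.1.2 h2.1.1.ne')) (h.D_left h1 hi)

theorem diffRel_chain_three_false
    (h : IsDIdeal n (diffRel Φ) (sumRel Φ)) (hs : IsSided n (diffRel Φ) (sumRel Φ))
    (hP : NoPathFour (diffRel Φ) (sumRel Φ)) {i j k l : ℕ}
    (h1 : diffRel Φ i j) (h2 : diffRel Φ j k) (h3 : diffRel Φ k l) : False :=
  diffRel_chain_false_of_pos h hs hP (by have := h1.1; omega) h2 h3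

theorem sum_path_four_false
    (h : IsDIdeal n (diffRel Φ) (sumRel Φ)) (hs : IsSided n (diffRel Φ) (sumRel Φ))
    (hP : NoPathFour (diffRel Φ) (sumRel Φ)) {i a k l m : ℕ} (him : i ≠ m)
    (h1 : diffRel Φ i a) (h2 : diffRel Φ a k) (h3 : sumRel Φ k l) (h4 : diffRel Φ m l) : False := by
  by_cases hi : i = 0
  · subst hi
    exact hP a k l h1 h2 h3 (h.D_left h4 (by omega))
  · exact diffRel_chain_false_of_pos h hs hP (by omega) h1 h2

theorem diffRel_iterSum_two_cases {i l : ℕ} (hil : diffRel (iterSum DRoot.add Φ 2) i l) :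
    ∃ j k, diffRel Φ i j ∧ diffRel Φ j k ∧ diffRel Φ k l := by
  obtain ⟨j, ⟨h1, h2⟩ | ⟨h1, h2⟩⟩ := diffRel_addSet (Φ := Φ) (Ψ := iterSum DRoot.add Φ 1) hil
  · obtain ⟨m, h3, h4⟩ := iterSum_one_cases h2
    exact ⟨j, m, h1, h3, h4⟩
  · obtain ⟨m, h3, h4⟩ := iterSum_one_cases h2
    exact ⟨m, j, h3, h4, h1⟩

/-- A fourfold sum contains either three chained differences, whose last two start at a positive
index, or two chained differences, a sum and another difference. In the latter, either the chain
starts at 0, and lowering the other end to 1 gives the path, or it starts at a positive index. -/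
theorem iterSum_three_eq_empty_iff
    (h : IsDIdeal n (diffRel Φ) (sumRel Φ)) (hs : IsSided n (diffRel Φ) (sumRel Φ)) :
    iterSum DRoot.add Φ 3 = ∅ ↔ NoPathFour (diffRel Φ) (sumRel Φ) := by
  rw [eq_empty_iff_rel]
  constructor
  · rintro ⟨-, h2⟩ a k l ha hak hkl hl
    have h3 : diffRel (iterSum DRoot.add Φ 1) 0 k := diffRel_addSet_of ha hak
    have h4 : sumRel (iterSum DRoot.add Φ 2) 0 l :=
      sumRel_addSet_of' (by have := hl.1; omega) hkl h3
    exact h2 1 0 (sumRel_addSet_of (by omega) hl (sumRel_symm h4))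
  · intro hP
    constructor
    · intro i k hik
      obtain ⟨j, ⟨h1, h2⟩ | ⟨h1, h2⟩⟩ := diffRel_addSet (Φ := Φ) (Ψ := iterSum DRoot.add Φ 2) hik
      all_goals
        obtain ⟨p, q, h3, h4, h5⟩ := diffRel_iterSum_two_cases h2
        exact diffRel_chain_three_false h hs hP h3 h4 h5
    · have key2 : ∀ i j k, i ≠ k → diffRel Φ i j → ¬ SumSplit Φ (iterSum DRoot.add Φ 1) j k := by
        rintro i j k hik h0 ⟨m, ⟨h1, h2⟩ | ⟨h1, h2⟩⟩
        · obtain ⟨p, ⟨h3, h4⟩ | ⟨h3, h4⟩⟩ := sumRel_iterSum_one_cases h2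
          · exact diffRel_chain_three_false h hs hP h0 h1 h3
          · exact sum_path_four_false h hs hP hik h0 h1 (h.S_symm h4) h3
        · obtain ⟨p, h3, h4⟩ := iterSum_one_cases h2
          exact diffRel_chain_three_false h hs hP h0 h3 h4
      have key3 : ∀ i j k, i ≠ k → diffRel Φ i j → ¬ SumSplit Φ (iterSum DRoot.add Φ 1) k j := by
        rintro i j k hik h0 ⟨m, ⟨h1, h2⟩ | ⟨h1, h2⟩⟩
        · obtain ⟨p, ⟨h3, h4⟩ | ⟨h3, h4⟩⟩ := sumRel_iterSum_one_cases h2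
          · exact sum_path_four_false h hs hP hik.symm h1 h3 h4 h0
          · exact sum_path_four_false h hs hP hik h0 h3 h4 h1
        · obtain ⟨p, h3, h4⟩ := iterSum_one_cases h2
          exact sum_path_four_false h hs hP hik.symm h3 h4 h1 h0
      have key : ∀ i k, i ≠ k → ¬ SumSplit Φ (iterSum DRoot.add Φ 2) i k := by
        rintro i k hik ⟨j, ⟨h1, h2⟩ | ⟨h1, h2⟩⟩
        · rcases sumRel_addSet (Φ := Φ) (Ψ := iterSum DRoot.add Φ 1) h2 with h3 | h3
          · exact key2 i j k hik h1 h3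
          · exact key3 i j k hik h1 h3
        · obtain ⟨p, q, h3, h4, h5⟩ := diffRel_iterSum_two_cases h2
          exact diffRel_chain_three_false h hs hP h3 h4 h5
      intro i k hik
      rcases sumRel_addSet (Φ := Φ) (Ψ := iterSum DRoot.add Φ 2) hik with h1 | h1
      · exact key i k hik.1.1 h1
      · exact key k i hik.1.1.symm h1

end Criteria

/-! ### The sign change of the last coordinate and reduction to one-sided ideals. -/

section Swap

variable {n : ℕ}

/-- The automorphism of the root system of type `D_n` that changes the sign of the last
coordinate. -/
def swapLast (n : ℕ) : DRoot n ≃ DRoot n where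
  toFun x := ⟨(x.1.1, x.1.2.1, if x.1.2.1 = n - 1 then !x.1.2.2 else x.1.2.2), x.2⟩
  invFun x := ⟨(x.1.1, x.1.2.1, if x.1.2.1 = n - 1 then !x.1.2.2 else x.1.2.2), x.2⟩
  left_inv := by
    rintro ⟨⟨i, j, s⟩, h⟩
    by_cases hj : j = n - 1 <;> simp [hj]
  right_inv := by
    rintro ⟨⟨i, j, s⟩, h⟩
    by_cases hj : j = n - 1 <;> simp [hj]

theorem vec_swapLast (x : DRoot n) (k : ℕ) :
    (swapLast n x).vec k = if k = n - 1 then -x.vec k else x.vec k := by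
  obtain ⟨⟨i, j, s⟩, hij, hj⟩ := x
  simp only at hij hj
  simp only [DRoot.vec_apply, swapLast, Equiv.coe_fn_mk]
  cases s <;> grind

theorem add_swapLast (x y z : DRoot n) :
    DRoot.add x y z ↔ DRoot.add (swapLast n x) (swapLast n y) (swapLast n z) := by
  simp only [DRoot.add, funext_iff, Pi.add_apply, vec_swapLast]
  refine forall_congr' fun k => ?_
  split_ifs <;> omega

theorem diffRel_swapLast (Φ : Set (DRoot n)) (i : ℕ) :
    diffRel (swapLast n ⁻¹' Φ) i (n - 1) ↔ sumRel Φ i (n - 1) := by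
  constructor
  · intro h
    rw [diffRel_mk h.1] at h
    rw [sumRel_mk (by have := (diffRel_mk _ |>.mpr h).1; omega)]
    simpa [swapLast] using h
  · intro h
    have h1 : i < n - 1 ∧ n - 1 < n := by have := h.1; omega
    rw [sumRel_mk h1] at h
    rw [diffRel_mk h1]
    simpa [swapLast] using h

theorem sumRel_swapLast (Φ : Set (DRoot n)) (i : ℕ) :
    sumRel (swapLast n ⁻¹' Φ) i (n - 1) ↔ diffRel Φ i (n - 1) := by
  constructor
  · intro h
    have h1 : i < n - 1 ∧ n - 1 < n := by have := h.1; omega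
    rw [sumRel_mk h1] at h
    rw [diffRel_mk h1]
    simpa [swapLast] using h
  · intro h
    have h1 : i < n - 1 ∧ n - 1 < n := h.1
    rw [diffRel_mk h1] at h
    rw [sumRel_mk h1]
    simpa [swapLast] using h

/-- The last columns of `D` and `S` are initial segments in `i`, hence comparable. If `D` is not
contained in `S`, it properly contains it, and the sign change exchanges the two. -/
theorem isSided_swapLast {Φ : Set (DRoot n)} (h : IsDIdeal n (diffRel Φ) (sumRel Φ)) :
    ¬ IsSided n (diffRel Φ) (sumRel Φ) ↔
      IsSided n (diffRel (swapLast n ⁻¹' Φ)) (sumRel (swapLast n ⁻¹' Φ)) ∧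
        IsStrict n (diffRel (swapLast n ⁻¹' Φ)) (sumRel (swapLast n ⁻¹' Φ)) := by
  simp only [IsSided, IsStrict, diffRel_swapLast, sumRel_swapLast, not_forall, exists_prop]
  constructor
  · rintro ⟨i, h1, h2⟩
    refine ⟨fun j hj => ?_, i, h1, h2⟩
    rcases le_total i j with hij | hij
    · exact absurd (h.S_left hj hij h1.1.1.ne) h2
    · exact h.D_left h1 hij
  · exact fun h => h.2

theorem ncard_isUp_split (k : ℕ) :
    {Φ : Set (DRoot n) | IsUp DRoot.add Φ ∧ iterSum DRoot.add Φ k = ∅}.ncard =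
      {Φ : Set (DRoot n) | IsUp DRoot.add Φ ∧ (iterSum DRoot.add Φ k = ∅ ∧
        IsSided n (diffRel Φ) (sumRel Φ))}.ncard +
      {Φ : Set (DRoot n) | IsUp DRoot.add Φ ∧ (iterSum DRoot.add Φ k = ∅ ∧
        IsSided n (diffRel Φ) (sumRel Φ) ∧ IsStrict n (diffRel Φ) (sumRel Φ))}.ncard := by
  have h1 : {Φ : Set (DRoot n) | IsUp DRoot.add Φ ∧ iterSum DRoot.add Φ k = ∅} =
      {Φ : Set (DRoot n) | IsUp DRoot.add Φ ∧ (iterSum DRoot.add Φ k = ∅ ∧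
        IsSided n (diffRel Φ) (sumRel Φ))} ∪
      {Φ : Set (DRoot n) | IsUp DRoot.add Φ ∧ (iterSum DRoot.add Φ k = ∅ ∧
        ¬ IsSided n (diffRel Φ) (sumRel Φ))} := by
    ext Φ
    simp only [Set.mem_ofPred_eq, Set.mem_union]
    tauto
  rw [h1, Set.ncard_union_eq (Set.disjoint_left.mpr fun Φ h2 h3 => h3.2.2 h2.2.2)
    (Set.toFinite _) (Set.toFinite _)]
  congr 1
  have hup := isUp_preimage_iff DRoot.add DRoot.add (swapLast n) add_swapLast
  have hit := fun Φ => iterSum_preimage DRoot.add DRoot.add (swapLast n) add_swapLast Φ k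
  have hemp : ∀ Φ, iterSum DRoot.add (swapLast n ⁻¹' Φ) k = ∅ ↔ iterSum DRoot.add Φ k = ∅ := by
    intro Φ
    rw [hit, Set.preimage_eq_empty_iff]
    simp
  refine Set.ncard_congr (fun Φ _ => swapLast n ⁻¹' Φ) ?_ ?_ ?_
  · rintro Φ ⟨h1, h2, h3⟩
    exact ⟨(hup Φ).mpr h1, (hemp Φ).mpr h2, (isSided_swapLast (isUp_iff_isDIdeal.mp h1)).mp h3⟩
  · intro Φ Ψ _ _ h
    exact (swapLast n).surjective.preimage_injective h
  · rintro Φ ⟨h1, h2, h3⟩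
    obtain ⟨Ψ, rfl⟩ : ∃ Ψ, swapLast n ⁻¹' Ψ = Φ :=
      ⟨swapLast n '' Φ, (swapLast n).injective.preimage_image Φ⟩
    exact ⟨Ψ, ⟨(hup Ψ).mp h1, (hemp Ψ).mp h2,
      (isSided_swapLast (isUp_iff_isDIdeal.mp ((hup Ψ).mp h1))).mpr h3⟩, rfl⟩

/-- The closure properties of the relations attached to a one-sided ideal. -/
structure IsCIdeal (n : ℕ) (D S : ℕ → ℕ → Prop) : Prop where
  D_lt : ∀ {i j}, D i j → i < j ∧ j < n
  S_ne : ∀ {i j}, S i j → i ≠ j ∧ i < n ∧ j < n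
  S_symm : ∀ {i j}, S i j → S j i
  D_left : ∀ {i j k}, D i j → k ≤ i → D k j
  D_right : ∀ {i j k}, D i j → j ≤ k → k < n → D i k
  S_left : ∀ {i j k}, S i j → k ≤ i → k ≠ j → S k j
  D_S : ∀ {i j k}, D i j → k < n → k ≠ i → S i k

theorem isCIdeal_iff {D S : ℕ → ℕ → Prop} : IsCIdeal n D S ↔ IsDIdeal n D S ∧ IsSided n D S := by
  constructor
  · intro h
    exact ⟨⟨h.D_lt, h.S_ne, h.S_symm, h.D_left, h.D_right, h.S_left, fun h1 h2 h3 _ => h.D_S h1 h2 h3⟩,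
      fun i hi => h.D_S hi (h.D_lt hi).2 (h.D_lt hi).1.ne'⟩
  · rintro ⟨h, hs⟩
    exact ⟨h.D_lt, h.S_ne, h.S_symm, h.D_left, h.D_right, h.S_left, h.D_S' hs⟩

/-- Pairs of relations, encoding sets of positive roots of type `D_n`. -/
abbrev RelPair : Type := (ℕ → ℕ → Prop) × (ℕ → ℕ → Prop)

theorem ncard_eq_of_criterion (k : ℕ) (Q : (ℕ → ℕ → Prop) → (ℕ → ℕ → Prop) → Prop)
    (hQ : ∀ Φ : Set (DRoot n), IsDIdeal n (diffRel Φ) (sumRel Φ) →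
      IsSided n (diffRel Φ) (sumRel Φ) →
      (iterSum DRoot.add Φ k = ∅ ↔ Q (diffRel Φ) (sumRel Φ))) :
    {Φ : Set (DRoot n) | IsUp DRoot.add Φ ∧ iterSum DRoot.add Φ k = ∅}.ncard =
      {p : RelPair | IsCIdeal n p.1 p.2 ∧ Q p.1 p.2}.ncard +
      {p : RelPair | IsCIdeal n p.1 p.2 ∧ Q p.1 p.2 ∧ IsStrict n p.1 p.2}.ncard := by
  rw [ncard_isUp_split,
    ncard_isUp_eq_ncard_rel _ (fun D S => Q D S ∧ IsSided n D S),
    ncard_isUp_eq_ncard_rel _ (fun D S => Q D S ∧ IsSided n D S ∧ IsStrict n D S)]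
  · congr 2
    · ext p
      simp only [Set.mem_ofPred_eq, isCIdeal_iff]
      tauto
    · ext p
      simp only [Set.mem_ofPred_eq, isCIdeal_iff]
      tauto
  · intro Φ hΦ
    have := hQ Φ (isUp_iff_isDIdeal.mp hΦ)
    tauto
  · intro Φ hΦ
    have := hQ Φ (isUp_iff_isDIdeal.mp hΦ)
    tauto

end Swap

/-! ### Order ideals of a triangle and those avoiding a position. -/

section Triangles

/-- The order ideals of the triangle of pairs `i < j` in `[a, b)`, as relations. -/
def triangleIdeals (a b : ℕ) : Set (ℕ → ℕ → Prop) :=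
  {T | (∀ i j, T i j → a ≤ i ∧ i < j ∧ j < b) ∧
    ∀ i j i' j', T i j → a ≤ i' → i' ≤ i → j' ≤ j → i' < j' → T i' j'}

/-- `T` holds at the least strictly increasing pair above `(p, v)`. -/
def Reaches (T : ℕ → ℕ → Prop) (p v : ℕ) : Prop := T p (max v (p + 1))

/-- Add the full first row `a` (up to column `c`) to a relation. -/
def addRow (a c : ℕ) (T : ℕ → ℕ → Prop) : ℕ → ℕ → Prop :=
  fun i j => (i = a ∧ a < j ∧ j ≤ c) ∨ T i j

theorem finite_triangleIdeals (a b : ℕ) : (triangleIdeals a b).Finite := by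
  have hfin : ((Set.Iio b ×ˢ Set.Iio b : Set (ℕ × ℕ))).Finite :=
    (Set.finite_Iio b).prod (Set.finite_Iio b)
  refine Set.Finite.of_finite_image (f := fun T => {p : ℕ × ℕ | T p.1 p.2})
    (hfin.finite_subsets.subset ?_) ?_
  · rintro _ ⟨T, hT, rfl⟩ ⟨i, j⟩ hij
    obtain ⟨_, h2, h3⟩ := hT.1 i j hij
    exact ⟨lt_trans h2 h3, h3⟩
  · intro T _ T' _ h
    funext i j
    exact congrArg (fun s : Set (ℕ × ℕ) => (i, j) ∈ s) h

theorem triangleIdeals_of_le {a b : ℕ} (h : b ≤ a + 1) :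
    triangleIdeals a b = {fun _ _ => False} := by
  ext T
  constructor
  · intro hT
    refine Set.mem_singleton_iff.2 ?_
    funext i j
    refine eq_false fun hij => ?_
    have := hT.1 i j hij
    omega
  · rintro rfl
    exact ⟨fun _ _ h => h.elim, fun _ _ _ _ h => h.elim⟩

/-- Any element of the last column would bring the corner `(a, c)` with it. -/
theorem mem_triangleIdeals_pred {a c : ℕ} (hac : a < c) {T : ℕ → ℕ → Prop} :
    T ∈ triangleIdeals a c ↔ T ∈ triangleIdeals a (c + 1) ∧ ¬ T a c := by
  constructor
  · rintro ⟨h1, h2⟩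
    refine ⟨⟨fun i j hij => ?_, h2⟩, fun h => ?_⟩
    · have := h1 i j hij; omega
    · have := h1 _ _ h; omega
  · rintro ⟨⟨h1, h2⟩, h3⟩
    refine ⟨fun i j hij => ?_, h2⟩
    obtain ⟨h4, h5, h6⟩ := h1 i j hij
    refine ⟨h4, h5, lt_of_le_of_ne (by omega) ?_⟩
    rintro rfl
    exact h3 (h2 i j a j hij le_rfl h4 le_rfl hac)

theorem addRow_mem {a c : ℕ} {T : ℕ → ℕ → Prop}
    (hT : T ∈ triangleIdeals (a + 1) (c + 1)) : addRow a c T ∈ triangleIdeals a (c + 1) := by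
  constructor
  · rintro i j (⟨rfl, h1, h2⟩ | h)
    · omega
    · have := hT.1 i j h; omega
  · rintro i j i' j' h h1 h2 h3 h4
    rcases h1.eq_or_lt with rfl | h1
    · left
      refine ⟨rfl, h4, ?_⟩
      rcases h with ⟨_, _, h⟩ | h
      · omega
      · have := hT.1 i j h; omega
    · rcases h with ⟨rfl, h5, h6⟩ | h
      · omega
      · exact Or.inr (hT.2 i j i' j' h h1 h2 h3 h4)

theorem addRow_restrict {a c : ℕ} {T : ℕ → ℕ → Prop} (hT : T ∈ triangleIdeals a (c + 1))
    (h : T a c) : addRow a c (fun i j => a + 1 ≤ i ∧ T i j) = T := by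
  funext i j
  refine propext ⟨?_, fun hij => ?_⟩
  · rintro (⟨rfl, h1, h2⟩ | h1)
    · exact hT.2 i c i j h le_rfl le_rfl h2 h1
    · exact h1.2
  · obtain ⟨h1, h2, h3⟩ := hT.1 i j hij
    rcases h1.eq_or_lt with rfl | h1
    · exact Or.inl ⟨rfl, h2, by omega⟩
    · exact Or.inr ⟨h1, hij⟩

theorem restrict_mem {a b : ℕ} {T : ℕ → ℕ → Prop} (hT : T ∈ triangleIdeals a b) :
    (fun i j => a + 1 ≤ i ∧ T i j) ∈ triangleIdeals (a + 1) b :=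
  ⟨fun i j h => ⟨h.1, (hT.1 i j h.2).2⟩,
    fun i j i' j' h h1 h2 h3 h4 => ⟨h1, hT.2 i j i' j' h.2 (by omega) h2 h3 h4⟩⟩

theorem addRow_injOn (a c : ℕ) : Set.InjOn (addRow a c) (triangleIdeals (a + 1) (c + 1)) := by
  intro T hT T' hT' h
  funext i j
  have hij := congrFun (congrFun h i) j
  by_cases hi : i = a
  · have h1 : ¬ T i j := fun h => by have := hT.1 i j h; omega
    have h2 : ¬ T' i j := fun h => by have := hT'.1 i j h; omega
    simp [h1, h2]
  · simpa [addRow, hi] using hij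

theorem ncard_strict_sep {a c : ℕ} (hac : a < c) (P : (ℕ → ℕ → Prop) → Prop) :
    {T | T ∈ triangleIdeals a (c + 1) ∧ T a c ∧ P T}.ncard =
      {T | T ∈ triangleIdeals (a + 1) (c + 1) ∧ P (addRow a c T)}.ncard := by
  have : {T | T ∈ triangleIdeals a (c + 1) ∧ T a c ∧ P T} =
      addRow a c '' {T | T ∈ triangleIdeals (a + 1) (c + 1) ∧ P (addRow a c T)} := by
    ext T
    constructor
    · rintro ⟨hT, h, hP⟩
      exact ⟨_, ⟨restrict_mem hT, by rwa [addRow_restrict hT h]⟩, addRow_restrict hT h⟩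
    · rintro ⟨T, ⟨hT, hP⟩, rfl⟩
      exact ⟨addRow_mem hT, Or.inl ⟨rfl, hac, le_rfl⟩, hP⟩
  rw [this, Set.InjOn.ncard_image ((addRow_injOn a c).mono fun T hT => hT.1)]

/-- Split by the corner `(a, c)`: if it is present, the first row is full and may be stripped;
otherwise the last column is empty. Either way the triangle has one point fewer. -/
theorem ncard_sep_succ {a c : ℕ} (hac : a < c) (P : (ℕ → ℕ → Prop) → Prop) :
    {T | T ∈ triangleIdeals a (c + 1) ∧ P T}.ncard =
      {T | T ∈ triangleIdeals (a + 1) (c + 1) ∧ P (addRow a c T)}.ncard +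
        {T | T ∈ triangleIdeals a c ∧ P T}.ncard := by
  rw [← ncard_strict_sep hac P, ← Set.ncard_union_eq
    (Set.disjoint_left.2 fun T h1 h2 => ((mem_triangleIdeals_pred hac).1 h2.1).2 h1.2.1)
    ((finite_triangleIdeals a (c + 1)).subset fun T h => h.1)
    ((finite_triangleIdeals a c).subset fun T h => h.1)]
  congr 1
  ext T
  simp only [Set.mem_union, Set.mem_ofPred_eq, mem_triangleIdeals_pred hac]
  tauto

/-- The number of order ideals of a triangle on `N` points. -/
def triangleCount (N : ℕ) : ℕ := 2 ^ (N - 1)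

theorem triangleCount_succ_succ (N : ℕ) :
    triangleCount (N + 2) = triangleCount (N + 1) + triangleCount (N + 1) := by
  simp only [triangleCount, Nat.add_sub_cancel, show N + 2 - 1 = N + 1 from rfl, pow_succ]
  ring

theorem ncard_triangleIdeals (a N : ℕ) :
    (triangleIdeals a (a + N)).ncard = triangleCount N := by
  induction N generalizing a with
  | zero => rw [triangleIdeals_of_le (by omega)]; simp [triangleCount]
  | succ N ih =>
    rcases N with _ | N
    · rw [triangleIdeals_of_le (by omega)]; simp [triangleCount]
    · have h := ncard_sep_succ (a := a) (c := a + (N + 1)) (by omega) (fun _ => True)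
      simp only [and_true, Set.ofPred_mem_eq] at h
      rw [triangleCount_succ_succ, ← ih a, ← add_assoc a (N + 1) 1, h, ih a, ← ih (a + 1)]
      congr 3
      omega

theorem ncard_triangleIdeals_eq {a b N : ℕ} (h : b = a + N) :
    (triangleIdeals a b).ncard = triangleCount N := h ▸ ncard_triangleIdeals a N

theorem reaches_addRow {a c p v : ℕ} (hac : a < c) (hv : v ≤ c) (T : ℕ → ℕ → Prop) :
    Reaches (addRow a c T) p v ↔ p = a ∨ Reaches T p v := by
  unfold Reaches addRow
  constructor
  · rintro (h | h)
    exacts [Or.inl h.1, Or.inr h]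
  · rintro (rfl | h)
    · exact Or.inl ⟨rfl, by omega, by omega⟩
    · exact Or.inr h

/-- The number of order ideals of a triangle on `N` points which do not reach `(p, v)`. -/
def avoidCount : ℕ → ℕ → ℕ → ℕ
  | 0, _, _ => 0
  | N + 1, p, v => (if p = 0 then 0 else avoidCount N (p - 1) (v - 1)) +
      if v = N then triangleCount N else avoidCount N p v

theorem not_reaches {a b p v : ℕ} (hv : b ≤ v) {T : ℕ → ℕ → Prop}
    (hT : T ∈ triangleIdeals a b) : ¬ Reaches T p v := fun h => by
  have := hT.1 _ _ h; omega

/-- Under the splitting by the corner, a full first row is fatal exactly for `p = 0` and otherwise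
shifts both coordinates by one. If the last column is empty and `v` points to it, every ideal avoids
the position. -/
theorem ncard_not_reaches (a N p v : ℕ) (hpv : p ≤ v) (hv : v < N) :
    {T | T ∈ triangleIdeals a (a + N) ∧ ¬ Reaches T (a + p) (a + v)}.ncard =
      avoidCount N p v := by
  induction N generalizing a p v with
  | zero => omega
  | succ N ih =>
    -- A one-point triangle has no corner, so this case precedes the use of `ncard_sep_succ`.
    rcases N with _ | N
    · obtain rfl : v = 0 := by omega
      obtain rfl : p = 0 := by omega
      rw [triangleIdeals_of_le (by omega)]
      have : {T : ℕ → ℕ → Prop | T ∈ ({fun _ _ => False} : Set (ℕ → ℕ → Prop)) ∧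
          ¬ Reaches T (a + 0) (a + 0)} = {fun _ _ => False} := by
        ext T
        constructor
        · exact fun h => h.1
        · rintro rfl
          exact ⟨rfl, fun h => h⟩
      rw [this]
      simp [avoidCount, triangleCount]
    · rw [← add_assoc a (N + 1) 1, ncard_sep_succ (by omega), avoidCount]
      congr 1
      · split_ifs with hp
        · rw [Set.ncard_eq_zero ((finite_triangleIdeals (a + 1) (a + (N + 1) + 1)).subset
            fun T h => h.1)]
          refine Set.eq_empty_of_forall_notMem fun T h => h.2 ?_
          exact (reaches_addRow (by omega) (by omega) T).2 (Or.inl (by omega))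
        · rw [← ih (a + 1) (p - 1) (v - 1) (by omega) (by omega),
            show a + 1 + (p - 1) = a + p by omega, show a + 1 + (v - 1) = a + v by omega,
            show a + (N + 1) + 1 = a + 1 + (N + 1) by omega]
          congr 1
          ext T
          refine and_congr_right fun _ => not_congr ?_
          rw [reaches_addRow (by omega) (by omega)]
          exact or_iff_right (by omega)
      · split_ifs with hvN
        · rw [← ncard_triangleIdeals a (N + 1)]
          congr 1
          ext T
          exact ⟨fun h => h.1, fun h => ⟨h, not_reaches (by omega) h⟩⟩
        · exact ih a p v hpv (by omega)

theorem ncard_strict_not_reaches (a N p v : ℕ) (hpv : p ≤ v) (hv : v < N + 1) :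
    {T | T ∈ triangleIdeals a (a + (N + 1)) ∧ T a (a + N) ∧
      ¬ Reaches T (a + p) (a + v)}.ncard =
      if p = 0 then 0 else avoidCount N (p - 1) (v - 1) := by
  rcases N with _ | N
  · obtain rfl : v = 0 := by omega
    obtain rfl : p = 0 := by omega
    rw [if_pos rfl, Set.ncard_eq_zero ((finite_triangleIdeals _ _).subset fun T h => h.1)]
    refine Set.eq_empty_of_forall_notMem fun T h => ?_
    have := h.1.1 _ _ h.2.1
    omega
  · rw [← add_assoc a (N + 1) 1, ncard_strict_sep (by omega)]
    split_ifs with hp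
    · rw [Set.ncard_eq_zero ((finite_triangleIdeals (a + 1) (a + (N + 1) + 1)).subset
        fun T h => h.1)]
      refine Set.eq_empty_of_forall_notMem fun T h => h.2 ?_
      exact (reaches_addRow (by omega) (by omega) T).2 (Or.inl (by omega))
    · rw [← ncard_not_reaches (a + 1) (N + 1) (p - 1) (v - 1) (by omega) (by omega),
        show a + 1 + (p - 1) = a + p by omega, show a + 1 + (v - 1) = a + v by omega,
        show a + (N + 1) + 1 = a + 1 + (N + 1) by omega]
      congr 1
      ext T
      refine and_congr_right fun _ => not_congr ?_
      rw [reaches_addRow (by omega) (by omega)]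
      exact or_iff_right (by omega)

theorem ncard_strict (a N : ℕ) :
    {T | T ∈ triangleIdeals a (a + (N + 1)) ∧ T a (a + N)}.ncard =
      if N = 0 then 0 else triangleCount N := by
  split_ifs with hN
  · rw [Set.ncard_eq_zero ((finite_triangleIdeals _ _).subset fun T h => h.1)]
    refine Set.eq_empty_of_forall_notMem fun T h => ?_
    have := h.1.1 _ _ h.2
    omega
  · have h := ncard_strict_sep (a := a) (c := a + N) (by omega) (fun _ => True)
    simp only [and_true, Set.ofPred_mem_eq] at h
    rw [← add_assoc a N 1, h]
    exact ncard_triangleIdeals_eq (by omega)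

end Triangles

/-! ### Weakly increasing lists and sums over their entries. -/

section Sequences

open Finset

/-- The weakly increasing lists of length `r` with entries in `[v, b)`. -/
def seqs : ℕ → ℕ → ℕ → Finset (List ℕ)
  | 0, _, _ => {[]}
  | r + 1, v, b => (Ico v b).biUnion fun p => (seqs r p b).image (List.cons p)

theorem mem_seqs {r v b : ℕ} {l : List ℕ} :
    l ∈ seqs r v b ↔ l.length = r ∧ l.Pairwise (· ≤ ·) ∧ ∀ x ∈ l, v ≤ x ∧ x < b := by
  induction r generalizing v l with
  | zero =>
    simp only [seqs, mem_singleton, List.length_eq_zero_iff]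
    constructor
    · rintro rfl; simp
    · exact fun h => h.1
  | succ r ih =>
    simp only [seqs, mem_biUnion, mem_Ico, mem_image, ih]
    constructor
    · rintro ⟨p, hp, l, ⟨h1, h2, h3⟩, rfl⟩
      refine ⟨by simp [h1], List.pairwise_cons.2 ⟨fun x hx => (h3 x hx).1, h2⟩, ?_⟩
      intro x hx
      rcases List.mem_cons.1 hx with rfl | hx
      · exact hp
      · exact ⟨hp.1.trans (h3 x hx).1, (h3 x hx).2⟩
    · rintro ⟨h1, h2, h3⟩
      obtain ⟨p, l, rfl⟩ := List.exists_of_length_succ l h1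
      rw [List.pairwise_cons] at h2
      refine ⟨p, h3 p (by simp), l, ⟨by simpa using h1, h2.2, fun x hx => ⟨h2.1 x hx, ?_⟩⟩, rfl⟩
      exact (h3 x (by simp [hx])).2

theorem sum_seqs_succ (r v b : ℕ) (f : List ℕ → ℕ) :
    ∑ l ∈ seqs (r + 1) v b, f l = ∑ p ∈ Ico v b, ∑ l ∈ seqs r p b, f (p :: l) := by
  rw [seqs, sum_biUnion]
  · refine sum_congr rfl fun p _ => sum_image fun _ _ _ _ h => ?_
    exact (List.cons.inj h).2
  · intro p _ q _ hpq
    refine disjoint_left.2 fun l h1 h2 => hpq ?_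
    obtain ⟨l1, _, rfl⟩ := mem_image.1 h1
    obtain ⟨l2, _, h⟩ := mem_image.1 h2
    exact (List.cons.inj h).1.symm

theorem card_seqs (r v b : ℕ) : (seqs r v b).card = Nat.multichoose (b - v) r := by
  induction r generalizing v with
  | zero => simp [seqs]
  | succ r ih =>
    rw [card_eq_sum_ones, sum_seqs_succ]
    simp only [sum_const, smul_eq_mul, mul_one, ih]
    obtain ⟨k, hk⟩ : ∃ k, b - v = k := ⟨_, rfl⟩
    rw [hk]
    induction k generalizing v with
    | zero => rw [Ico_eq_empty (by omega)]; simp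
    | succ k ihk =>
      rw [sum_eq_sum_Ico_succ_bot (by omega), ihk (v + 1) (by omega), hk,
        Nat.multichoose_succ_succ, add_comm]

/-- The number of occurrences of each entry in all lists of `seqs r p b`, where `k = b - p`,
after averaging. -/
def entryWeight : ℕ → ℕ → ℕ
  | 0, _ => 0
  | r + 1, k => Nat.multichoose (k + 1) r

theorem entryWeight_succ (r k : ℕ) :
    entryWeight (r + 1) (k + 1) = entryWeight (r + 1) k + entryWeight r (k + 1) := by
  rcases r with _ | r
  · simp [entryWeight]
  · simp only [entryWeight]
    exact Nat.multichoose_succ_succ _ _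

/-- All values in `[v, b)` occur equally often in the lists taken together. For `k = b - v > 0` and
`r ≥ 1` the common number is `r/k` times `multichoose k r`, that is, `multichoose (k + 1) (r - 1)`;
the induction replaces the symmetry argument by Pascal's rule. -/
theorem sum_seqs_sum (r v b : ℕ) (f : ℕ → ℕ) :
    ∑ l ∈ seqs r v b, (l.map f).sum = entryWeight r (b - v) * ∑ x ∈ Ico v b, f x := by
  induction r generalizing v with
  | zero => simp [seqs, entryWeight]
  | succ r ih =>
    rw [sum_seqs_succ]
    obtain ⟨k, hk⟩ : ∃ k, b - v = k := ⟨_, rfl⟩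
    rw [hk]
    induction k generalizing v with
    | zero => rw [Ico_eq_empty (by omega)]; simp
    | succ k ihk =>
      rw [sum_eq_sum_Ico_succ_bot (by omega), ihk (v + 1) (by omega), entryWeight_succ,
        sum_eq_sum_Ico_succ_bot (by omega : v < b) f]
      simp only [List.map_cons, List.sum_cons, sum_add_distrib, sum_const, smul_eq_mul, ih,
        card_seqs, hk, sum_eq_sum_Ico_succ_bot (by omega : v < b) f]
      simp only [entryWeight]
      ring

theorem sum_range_getD (l : List ℕ) (f : ℕ → ℕ) :
    ∑ i ∈ range l.length, f (l.getD i 0) = (l.map f).sum := by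
  induction l with
  | nil => simp
  | cons a l ih =>
    rw [List.length_cons, sum_range_succ', List.map_cons, List.sum_cons, ← ih, add_comm]
    simp

theorem ncard_sigma_finset {α β : Type*} [DecidableEq α] (F : Finset α) (A : α → Set β)
    (hA : ∀ d ∈ F, (A d).Finite) :
    {x : α × β | x.1 ∈ F ∧ x.2 ∈ A x.1}.ncard = ∑ d ∈ F, (A d).ncard := by
  induction F using Finset.induction_on with
  | empty => simp
  | insert d F hd ih =>
    have hfin : ∀ G : Finset α, G ⊆ insert d F →
        {x : α × β | x.1 ∈ G ∧ x.2 ∈ A x.1}.Finite := by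
      intro G hG
      have : {x : α × β | x.1 ∈ G ∧ x.2 ∈ A x.1} ⊆
          ⋃ e ∈ (G : Set α), (fun y => (e, y)) '' A e := by
        rintro ⟨e, y⟩ ⟨h1, h2⟩
        exact Set.mem_biUnion h1 ⟨y, h2, rfl⟩
      refine (Set.Finite.biUnion G.finite_toSet fun e he => ?_).subset this
      exact (hA e (hG he)).image _
    have hunion : {x : α × β | x.1 ∈ insert d F ∧ x.2 ∈ A x.1} =
        ((fun y => (d, y)) '' A d) ∪ {x : α × β | x.1 ∈ F ∧ x.2 ∈ A x.1} := by
      ext ⟨e, y⟩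
      simp only [mem_insert, Set.mem_ofPred_eq, Set.mem_union, Set.mem_image, Prod.mk.injEq]
      constructor
      · rintro ⟨rfl | h, hy⟩
        exacts [Or.inl ⟨y, hy, rfl, rfl⟩, Or.inr ⟨h, hy⟩]
      · rintro (⟨y, hy, rfl, rfl⟩ | ⟨h, hy⟩)
        exacts [⟨Or.inl rfl, hy⟩, ⟨Or.inr h, hy⟩]
    have hdisj : Disjoint ((fun y => (d, y)) '' A d)
        {x : α × β | x.1 ∈ F ∧ x.2 ∈ A x.1} := by
      refine Set.disjoint_left.2 ?_
      rintro _ ⟨y, _, rfl⟩ h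
      exact hd h.1
    rw [hunion, Set.ncard_union_eq hdisj ((hA d (mem_insert_self d F)).image _)
      (hfin F (subset_insert d F)), sum_insert hd, ih fun e he => hA e (mem_insert_of_mem he),
      Set.ncard_image_of_injective _ fun x y h => (Prod.mk.inj h).2]

end Sequences

/-! ### One-sided ideals as lists of column bounds with a triangle ideal. -/

section Encoding

/-- The pair of relations encoded by a list of column bounds and a triangle relation. -/
def relPairOf (n : ℕ) (x : List ℕ × (ℕ → ℕ → Prop)) : RelPair :=
  (fun i j => ∃ c, x.1[i]? = some c ∧ c ≤ j ∧ j < n,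
   fun i j => i ≠ j ∧ i < n ∧ j < n ∧
    (i < x.1.length ∨ j < x.1.length ∨ x.2 (min i j) (max i j)))

/-- The codes of the ideals. -/
structure IsCode (n : ℕ) (x : List ℕ × (ℕ → ℕ → Prop)) : Prop where
  length_lt : x.1.length < n
  sorted : x.1.Pairwise (· ≤ ·)
  bound : ∀ i c, x.1[i]? = some c → i < c ∧ c < n
  mem : x.2 ∈ triangleIdeals x.1.length n

variable {n : ℕ} {d : List ℕ} {T : ℕ → ℕ → Prop}

theorem IsCode.mono (h : IsCode n (d, T)) {i k c e : ℕ} (hki : k ≤ i) (hc : d[i]? = some c)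
    (he : d[k]? = some e) : e ≤ c := by
  obtain ⟨hi, rfl⟩ := List.getElem?_eq_some_iff.1 hc
  obtain ⟨hk, rfl⟩ := List.getElem?_eq_some_iff.1 he
  rcases hki.eq_or_lt with rfl | hki
  · exact le_rfl
  · exact List.pairwise_iff_getElem.1 h.sorted k i hk hi hki

theorem IsCode.last_iff (h : IsCode n (d, T)) (i : ℕ) :
    (relPairOf n (d, T)).1 i (n - 1) ↔ i < d.length := by
  have := h.length_lt
  constructor
  · rintro ⟨c, hc, _⟩
    exact (List.getElem?_eq_some_iff.1 hc).1
  · intro hi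
    have h1 := h.bound i d[i] (List.getElem?_eq_getElem hi)
    exact ⟨d[i], List.getElem?_eq_getElem hi, by omega, by omega⟩

theorem IsCode.triangle_iff (h : IsCode n (d, T)) {i j : ℕ} :
    T i j ↔ d.length ≤ i ∧ i < j ∧ (relPairOf n (d, T)).2 i j := by
  constructor
  · intro hT
    obtain ⟨h1, h2, h3⟩ := h.mem.1 i j hT
    refine ⟨h1, h2, h2.ne, h2.trans h3, h3, Or.inr (Or.inr ?_)⟩
    rwa [min_eq_left h2.le, max_eq_right h2.le]
  · rintro ⟨h1, h2, _, _, _, h3 | h3 | h3⟩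
    · exact absurd h3 (not_lt.2 h1)
    · exact absurd h3 (not_lt.2 (h1.trans h2.le))
    · rwa [min_eq_left h2.le, max_eq_right h2.le] at h3

theorem IsCode.isCIdeal (h : IsCode n (d, T)) :
    IsCIdeal n (relPairOf n (d, T)).1 (relPairOf n (d, T)).2 where
  D_lt := by
    rintro i j ⟨c, hc, h1, h2⟩
    have := h.bound i c hc
    omega
  S_ne := fun hij => ⟨hij.1, hij.2.1, hij.2.2.1⟩
  S_symm := by
    rintro i j ⟨h1, h2, h3, h4⟩
    refine ⟨h1.symm, h3, h2, ?_⟩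
    rw [min_comm, max_comm]
    tauto
  D_left := by
    rintro i j k ⟨c, hc, h1, h2⟩ hk
    have hi := (List.getElem?_eq_some_iff.1 hc).1
    have hk' : k < d.length := lt_of_le_of_lt hk hi
    have he : d[k]? = some d[k] := List.getElem?_eq_getElem hk'
    exact ⟨d[k], he, (h.mono hk hc he).trans h1, h2⟩
  D_right := by
    rintro i j k ⟨c, hc, h1, h2⟩ h3 h4
    exact ⟨c, hc, h1.trans h3, h4⟩
  S_left := by
    rintro i j k ⟨h1, h2, h3, h4⟩ hk hkj
    refine ⟨hkj, lt_of_le_of_lt hk h2, h3, ?_⟩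
    simp only at h4 ⊢
    rcases h4 with h4 | h4 | h4
    · left; omega
    · exact Or.inr (Or.inl h4)
    · by_cases hkd : k < d.length
      · exact Or.inl hkd
      by_cases hjd : j < d.length
      · exact Or.inr (Or.inl hjd)
      · exact Or.inr (Or.inr (h.mem.2 _ _ _ _ h4 (by simp only; omega) (by omega) (by omega)
          (by omega)))
  D_S := by
    rintro i j k ⟨c, hc, h1, h2⟩ h3 h4
    have := h.bound i c hc
    exact ⟨h4.symm, by omega, h3, Or.inl (List.getElem?_eq_some_iff.1 hc).1⟩

/-- The last column of `D` recovers the length of the list, the minimum of each row its entry, and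
`S` above the diagonal beyond that length recovers `T`. -/
theorem relPairOf_injOn : Set.InjOn (relPairOf n) {x | IsCode n x} := by
  rintro ⟨d, T⟩ h ⟨d', T'⟩ h' heq
  have hlen : d.length = d'.length := by
    have h1 : ∀ i, i < d.length ↔ i < d'.length := fun i => by
      rw [← IsCode.last_iff h, ← IsCode.last_iff h', heq]
    have h2 := h1 d.length
    have h3 := h1 d'.length
    omega
  have hle : ∀ {d d' : List ℕ} {T T' : ℕ → ℕ → Prop}, IsCode n (d', T') →
      relPairOf n (d, T) = relPairOf n (d', T') →
      ∀ i (hi : i < d.length) (hi' : i < d'.length), d[i] ≤ d'[i] := by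
    intro d d' T T' h' heq i hi hi'
    have h1 : (relPairOf n (d', T')).1 i d'[i] :=
      ⟨d'[i], List.getElem?_eq_getElem hi', le_rfl,
        (h'.bound i _ (List.getElem?_eq_getElem hi')).2⟩
    rw [← heq] at h1
    obtain ⟨c, hc, h2, _⟩ := h1
    obtain ⟨_, rfl⟩ := List.getElem?_eq_some_iff.1 hc
    exact h2
  have hd : d = d' := List.ext_getElem hlen fun i hi hi' =>
    le_antisymm (hle h' heq i hi hi') (hle h heq.symm i hi' hi)
  subst hd
  refine Prod.ext rfl ?_
  funext i j
  exact propext ((IsCode.triangle_iff h).trans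
    ((by rw [heq] : _ ↔ _).trans (IsCode.triangle_iff h').symm))

/-- Take `t` to be the number of nonempty rows of `D` and `d_i` the least `j` with `D i j`. Rows of
`S` below `t` are full, so only the pairs `t ≤ i < j` carry information. -/
theorem IsCIdeal.exists_code (hn : 0 < n) {p : RelPair} (h : IsCIdeal n p.1 p.2) :
    ∃ x, IsCode n x ∧ relPairOf n x = p := by
  obtain ⟨D, S⟩ := p
  obtain ⟨t, ht, htn⟩ : ∃ t, (∀ i, D i (n - 1) ↔ i < t) ∧ t < n := by
    classical
    have hex : ∃ i, ¬ D i (n - 1) := ⟨n - 1, fun h1 => by have := h.D_lt h1; omega⟩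
    refine ⟨Nat.find hex, fun i => ⟨fun h1 => ?_, fun h1 => ?_⟩, ?_⟩
    · by_contra h2
      exact Nat.find_spec hex (h.D_left h1 (not_lt.1 h2))
    · exact not_not.1 (Nat.find_min hex h1)
    · refine lt_of_le_of_lt (Nat.find_min' hex (m := n - 1) fun h1 => ?_) (by omega)
      have := h.D_lt h1
      omega
  have hDt : ∀ {i j}, D i j → i < t := fun {i j} hij => by
    have := h.D_lt hij
    exact (ht i).1 (h.D_right hij (by omega) (by omega))
  have hmem : ∀ i, i < t → D i (sInf {j | D i j}) := fun i hi =>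
    Nat.sInf_mem (s := {j | D i j}) ⟨n - 1, (ht i).2 hi⟩
  set d := (List.range t).map fun i => sInf {j | D i j} with hd
  have hlen : d.length = t := by simp [hd]
  have hget : ∀ i c, d[i]? = some c ↔ i < t ∧ sInf {j | D i j} = c := by
    intro i c
    by_cases hi : i < t <;> simp [hd, hi]
  refine ⟨(d, fun i j => t ≤ i ∧ i < j ∧ S i j), ⟨?_, ?_, ?_, ?_⟩, ?_⟩
  · rwa [hlen]
  · refine List.pairwise_iff_getElem.2 fun i j hi hj hij => ?_
    simp only [hd, List.getElem_map, List.getElem_range]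
    exact Nat.sInf_le (h.D_left (hmem j (hlen ▸ hj)) hij.le)
  · intro i c hc
    obtain ⟨hi, rfl⟩ := (hget i c).1 hc
    exact h.D_lt (hmem i hi)
  · rw [hlen]
    refine ⟨fun i j hij => ⟨hij.1, hij.2.1, (h.S_ne hij.2.2).2.2⟩, ?_⟩
    rintro i j i' j' ⟨h1, h2, h3⟩ h4 h5 h6 h7
    exact ⟨h4, h7, h.S_symm (h.S_left (h.S_symm (h.S_left h3 h5 (by omega))) h6 (by omega))⟩
  · refine Prod.ext ?_ ?_
    · funext i j
      refine propext ⟨?_, fun hij => ?_⟩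
      · rintro ⟨c, hc, h1, h2⟩
        obtain ⟨hi, rfl⟩ := (hget i c).1 hc
        exact h.D_right (hmem i hi) h1 h2
      · exact ⟨_, (hget i _).2 ⟨hDt hij, rfl⟩, Nat.sInf_le hij, (h.D_lt hij).2⟩
    · funext i j
      refine propext ⟨?_, fun hij => ?_⟩
      · simp only [relPairOf, hlen]
        rintro ⟨h1, h2, h3, h4 | h4 | h4⟩
        · exact h.D_S ((ht i).2 h4) h3 h1.symm
        · exact h.S_symm (h.D_S ((ht j).2 h4) h2 h1)
        · rcases lt_or_gt_of_ne h1 with h5 | h5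
          · rw [min_eq_left h5.le, max_eq_right h5.le] at h4
            exact h4.2.2
          · rw [min_eq_right h5.le, max_eq_left h5.le] at h4
            exact h.S_symm h4.2.2
      · obtain ⟨h1, h2, h3⟩ := h.S_ne hij
        refine ⟨h1, h2, h3, ?_⟩
        simp only [hlen]
        by_cases h4 : i < t
        · exact Or.inl h4
        by_cases h5 : j < t
        · exact Or.inr (Or.inl h5)
        right; right
        rcases lt_or_gt_of_ne h1 with h6 | h6
        · rw [min_eq_left h6.le, max_eq_right h6.le]
          exact ⟨not_lt.1 h4, h6, hij⟩
        · rw [min_eq_right h6.le, max_eq_left h6.le]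
          exact ⟨not_lt.1 h5, h6, h.S_symm hij⟩

theorem ncard_isCIdeal (hn : 0 < n) (Q : (ℕ → ℕ → Prop) → (ℕ → ℕ → Prop) → Prop) :
    {p : RelPair | IsCIdeal n p.1 p.2 ∧ Q p.1 p.2}.ncard =
      {x | IsCode n x ∧ Q (relPairOf n x).1 (relPairOf n x).2}.ncard := by
  have : {p : RelPair | IsCIdeal n p.1 p.2 ∧ Q p.1 p.2} =
      relPairOf n '' {x | IsCode n x ∧ Q (relPairOf n x).1 (relPairOf n x).2} := by
    ext p
    constructor
    · rintro ⟨h, hQ⟩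
      obtain ⟨x, hx, rfl⟩ := h.exists_code hn
      exact ⟨x, ⟨hx, hQ⟩, rfl⟩
    · rintro ⟨x, ⟨hx, hQ⟩, rfl⟩
      exact ⟨IsCode.isCIdeal hx, hQ⟩
  rw [this, Set.InjOn.ncard_image (relPairOf_injOn.mono fun x hx => hx.1)]

/-- A sum `e_i + e_{n-1}` without the difference has `i ≥ t`, so it forces the corner `(t, n - 1)`
of the triangle. -/
theorem IsCode.isStrict_iff (h : IsCode n (d, T)) :
    IsStrict n (relPairOf n (d, T)).1 (relPairOf n (d, T)).2 ↔ T d.length (n - 1) := by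
  constructor
  · rintro ⟨i, h1, h2⟩
    rw [h.last_iff, not_lt] at h2
    have h3 := h.isCIdeal.S_ne h1
    exact h.mem.2 i (n - 1) _ _ (h.triangle_iff.2 ⟨h2, by omega, h1⟩) le_rfl h2 le_rfl (by omega)
  · intro hT
    exact ⟨d.length, (h.triangle_iff.1 hT).2.2, by rw [h.last_iff]; omega⟩

/-- The square `[p, n) × [v, n)` meets the sum relation iff its corner does. -/
theorem IsCode.exists_sum_iff (h : IsCode n (d, T)) {p v : ℕ} (hpv : p ≤ v) (hv : v < n)
    (hpn : p < d.length → p + 1 < n) :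
    (∃ k l, p ≤ k ∧ v ≤ l ∧ (relPairOf n (d, T)).2 k l) ↔ p < d.length ∨ Reaches T p v := by
  constructor
  · rintro ⟨k, l, h1, h2, h3, h4, h5, h6⟩
    by_contra! h7
    simp only at h6
    refine h7.2 ?_
    rcases h6 with h6 | h6 | h6
    · omega
    · omega
    · exact h.mem.2 _ _ _ _ h6 h7.1 (by omega) (by omega) (by omega)
  · rintro (h1 | h1)
    · have := hpn h1
      -- On the diagonal the corner `(p, p)` is not a root, and `(p, p + 1)` replaces it.
      by_cases h2 : p = v
      · exact ⟨p, p + 1, le_rfl, by omega, by omega, by omega, by omega, Or.inl h1⟩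
      · exact ⟨p, v, le_rfl, le_rfl, h2, by omega, hv, Or.inl h1⟩
    · have h2 := h.mem.1 _ _ h1
      exact ⟨p, _, le_rfl, le_max_left _ _, (h.triangle_iff.1 h1).2.2⟩

/-- `D 0 k` and `D 1 l` mean `k ≥ d_0` and `l ≥ d_1`, so the question is whether `S` meets the
region with corner `(d_0, d_1)`. -/
theorem IsCode.noPathThree_iff (h : IsCode n (d, T)) :
    NoPathThree (relPairOf n (d, T)).1 (relPairOf n (d, T)).2 ↔
      ∀ p v, d[0]? = some p → d[1]? = some v → d.length ≤ p ∧ ¬ Reaches T p v := by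
  have key : ∀ p v, d[0]? = some p → d[1]? = some v →
      ((∃ k l, p ≤ k ∧ v ≤ l ∧ (relPairOf n (d, T)).2 k l) ↔
        p < d.length ∨ Reaches T p v) := fun p v hp hv =>
    h.exists_sum_iff (h.mono (by omega) hv hp) (h.bound _ _ hv).2 fun h1 => by
      have := h.length_lt
      simp only at this
      omega
  constructor
  · intro hN p v hp hv
    by_contra! hcon
    obtain ⟨k, l, h1, h2, h3⟩ := (key p v hp hv).2 (by
      by_contra! h4
      exact h4.2 (hcon h4.1))
    exact hN k l ⟨p, hp, h1, h3.2.1⟩ h3 ⟨v, hv, h2, h3.2.2.1⟩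
  · rintro hR k l ⟨p, hp, h1, h2⟩ h3 ⟨v, hv, h4, h5⟩
    obtain ⟨h6, h7⟩ := hR p v hp hv
    rcases (key p v hp hv).1 ⟨k, l, h1, h4, h3⟩ with h8 | h8
    · omega
    · exact h7 h8

/-- Lowering the intermediate index `a` to `d_0` only enlarges the choice of `k`, so the region has
corner `(d_1, d_{d_0})`. If `d_0` is at least the length of the list, there is no second difference
and no condition. -/
theorem IsCode.noPathFour_iff (h : IsCode n (d, T)) :
    NoPathFour (relPairOf n (d, T)).1 (relPairOf n (d, T)).2 ↔
      ∀ p v q, d[0]? = some p → d[1]? = some v → d[p]? = some q →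
        d.length ≤ v ∧ ¬ Reaches T v q := by
  have key : ∀ p v q, d[0]? = some p → d[1]? = some v → d[p]? = some q →
      ((∃ k l, v ≤ k ∧ q ≤ l ∧ (relPairOf n (d, T)).2 k l) ↔
        v < d.length ∨ Reaches T v q) := fun p v q hp hv hq =>
    h.exists_sum_iff (h.mono (h.bound _ _ hp).1 hq hv) (h.bound _ _ hq).2 fun h1 => by
      have := h.length_lt
      simp only at this
      omega
  constructor
  · intro hN p v q hp hv hq
    by_contra! hcon
    obtain ⟨k, l, h1, h2, h3⟩ := (key p v q hp hv hq).2 (by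
      by_contra! h4
      exact h4.2 (hcon h4.1))
    exact hN p l k ⟨p, hp, le_rfl, (h.bound _ _ hp).2⟩ ⟨q, hq, h2, h3.2.2.1⟩
      (h.isCIdeal.S_symm h3) ⟨v, hv, h1, h3.2.1⟩
  · rintro hR a k l ⟨p, hp, h1, h2⟩ h3 h4 ⟨v, hv, h5, h6⟩
    obtain ⟨q, hq, h7, h8⟩ := h.isCIdeal.D_left h3 h1
    obtain ⟨h9, h10⟩ := hR p v q hp hv hq
    rcases (key p v q hp hv hq).1 ⟨l, k, h5, h7, h.isCIdeal.S_symm h4⟩ with h11 | h11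
    · omega
    · exact h10 h11

end Encoding

/-! ### The counts as weighted sums over lists. -/

section Counting

open Finset

/-- The lists all of whose entries are at least their length. -/
def highLists (n : ℕ) : Finset (List ℕ) := (range n).biUnion fun t => seqs t t n

/-- The lists whose first entry is positive and below the length, all others being at least
the length. -/
def lowHeadLists (n : ℕ) : Finset (List ℕ) :=
  (range (n - 1)).biUnion fun s => (Ico 1 (s + 1)).biUnion fun q =>
    (seqs s (s + 1) n).image (List.cons q)

theorem mem_highLists {n : ℕ} {d : List ℕ} : d ∈ highLists n ↔
    d.length < n ∧ d.Pairwise (· ≤ ·) ∧ ∀ x ∈ d, d.length ≤ x ∧ x < n := by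
  simp only [highLists, mem_biUnion, mem_range, mem_seqs]
  constructor
  · rintro ⟨t, ht, rfl, h⟩
    exact ⟨ht, h⟩
  · exact fun h => ⟨_, h.1, rfl, h.2⟩

theorem mem_lowHeadLists {n : ℕ} {d : List ℕ} : d ∈ lowHeadLists n ↔
    ∃ q l, d = q :: l ∧ d.length < n ∧ 0 < q ∧ q < d.length ∧ l.Pairwise (· ≤ ·) ∧
      ∀ x ∈ l, d.length ≤ x ∧ x < n := by
  simp only [lowHeadLists, mem_biUnion, mem_range, mem_Ico, mem_image, mem_seqs]
  constructor
  · rintro ⟨t, ht, q, hq, l, ⟨rfl, h1, h2⟩, rfl⟩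
    exact ⟨q, l, rfl, by simp only [List.length_cons]; omega, hq.1, hq.2, h1, h2⟩
  · rintro ⟨q, l, rfl, h1, h2, h3, h4, h5⟩
    simp only [List.length_cons] at h1
    exact ⟨l.length, by omega, q, ⟨h2, h3⟩, l, ⟨rfl, h4, h5⟩, rfl⟩

theorem isCode_noPathThree_iff {n : ℕ} {d : List ℕ} {T : ℕ → ℕ → Prop} :
    (IsCode n (d, T) ∧ NoPathThree (relPairOf n (d, T)).1 (relPairOf n (d, T)).2) ↔
      d ∈ highLists n ∧ T ∈ triangleIdeals d.length n ∧
        ∀ p v, d[0]? = some p → d[1]? = some v → ¬ Reaches T p v := by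
  rw [mem_highLists]
  constructor
  · rintro ⟨h, hN⟩
    rw [h.noPathThree_iff] at hN
    refine ⟨⟨h.length_lt, h.sorted, fun x hx => ?_⟩, h.mem, fun p v hp hv => (hN p v hp hv).2⟩
    obtain ⟨i, hi⟩ := List.mem_iff_getElem?.1 hx
    refine ⟨?_, (h.bound i x hi).2⟩
    rcases d with _ | ⟨p, _ | ⟨v, l⟩⟩
    · simp at hx
    · have := h.bound i x hi
      simp only [List.length_singleton]
      omega
    · exact (hN p v rfl rfl).1.trans (h.mono (Nat.zero_le i) hi rfl)
  · rintro ⟨⟨h1, h2, h3⟩, h4, h5⟩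
    have h : IsCode n (d, T) := ⟨h1, h2, fun i c hc => by
      have h6 := h3 c (List.mem_iff_getElem?.2 ⟨i, hc⟩)
      have h7 := (List.getElem?_eq_some_iff.1 hc).1
      simp only at h7
      omega, h4⟩
    refine ⟨h, h.noPathThree_iff.2 fun p v hp hv => ⟨?_, h5 p v hp hv⟩⟩
    exact (h3 p (List.mem_iff_getElem?.2 ⟨0, hp⟩)).1

/-- If `d_0` is at least the length, so are all entries and the path condition is void. Otherwise
`d_0 ≥ 1` makes `d_1` exist and the criterion forces `d_1`, hence every later entry, up to the
length. -/
theorem isCode_noPathFour_iff {n : ℕ} {d : List ℕ} {T : ℕ → ℕ → Prop} :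
    (IsCode n (d, T) ∧ NoPathFour (relPairOf n (d, T)).1 (relPairOf n (d, T)).2) ↔
      d ∈ highLists n ∪ lowHeadLists n ∧ T ∈ triangleIdeals d.length n ∧
        ∀ p v q, d[0]? = some p → d[1]? = some v → d[p]? = some q → ¬ Reaches T v q := by
  rw [mem_union, mem_highLists, mem_lowHeadLists]
  constructor
  · rintro ⟨h, hN⟩
    rw [h.noPathFour_iff] at hN
    refine ⟨?_, h.mem, fun p v q hp hv hq => (hN p v q hp hv hq).2⟩
    rcases d with _ | ⟨p, l⟩
    · exact Or.inl ⟨h.length_lt, by simp, by simp⟩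
    have hall : ∀ i x, (p :: l)[i]? = some x → x < n := fun i x hx => (h.bound i x hx).2
    by_cases hp : (p :: l).length ≤ p
    · refine Or.inl ⟨h.length_lt, h.sorted, fun x hx => ?_⟩
      obtain ⟨i, hi⟩ := List.mem_iff_getElem?.1 hx
      exact ⟨hp.trans (h.mono (Nat.zero_le i) hi rfl), hall i x hi⟩
    · rw [not_le] at hp
      have hp0 : 0 < p := (h.bound 0 p rfl).1
      refine Or.inr ⟨p, l, rfl, h.length_lt, hp0, hp, (List.pairwise_cons.1 h.sorted).2,
        fun x hx => ?_⟩
      obtain ⟨i, hi⟩ := List.mem_iff_getElem?.1 hx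
      have hi' : (p :: l)[i + 1]? = some x := hi
      refine ⟨?_, hall _ x hi'⟩
      have h1 : 1 < (p :: l).length := lt_of_le_of_lt hp0 hp
      have hv := List.getElem?_eq_getElem h1
      exact (hN p _ _ rfl hv (List.getElem?_eq_getElem hp)).1.trans
        (h.mono (Nat.le_add_left 1 i) hi' hv)
  · rintro ⟨⟨h1, h2, h3⟩ | ⟨p, l, rfl, h1, h2, h3, h4, h5⟩, h6, h7⟩
    · have h : IsCode n (d, T) := ⟨h1, h2, fun i c hc => by
        have h6 := h3 c (List.mem_iff_getElem?.2 ⟨i, hc⟩)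
        have h7 := (List.getElem?_eq_some_iff.1 hc).1
        simp only at h7
        omega, h6⟩
      refine ⟨h, h.noPathFour_iff.2 fun p v q hp hv hq => ⟨?_, h7 p v q hp hv hq⟩⟩
      exact (h3 v (List.mem_iff_getElem?.2 ⟨1, hv⟩)).1
    · have h : IsCode n (p :: l, T) := ⟨h1, ?_, ?_, h6⟩
      · refine ⟨h, h.noPathFour_iff.2 fun p' v q hp hv hq => ⟨?_, h7 p' v q hp hv hq⟩⟩
        exact (h5 v (List.mem_iff_getElem?.2 ⟨0, hv⟩)).1
      · exact List.pairwise_cons.2 ⟨fun x hx => h3.le.trans (h5 x hx).1, h4⟩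
      · rintro (_ | i) c hc
        · obtain rfl : p = c := Option.some.inj hc
          exact ⟨h2, h3.trans h1⟩
        · have h8 : l[i]? = some c := hc
          have h9 := h5 c (List.mem_iff_getElem?.2 ⟨i, h8⟩)
          have h10 := (List.getElem?_eq_some_iff.1 h8).1
          simp only [List.length_cons] at h9
          omega

theorem disjoint_high_lowHead (n : ℕ) : Disjoint (highLists n) (lowHeadLists n) := by
  refine disjoint_left.2 fun d h1 h2 => ?_
  obtain ⟨q, l, rfl, _, _, h3, _⟩ := mem_lowHeadLists.1 h2
  have := ((mem_highLists.1 h1).2.2 q (by simp)).1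
  omega

theorem sum_highLists (n : ℕ) (f : List ℕ → ℕ) :
    ∑ d ∈ highLists n, f d = ∑ t ∈ range n, ∑ d ∈ seqs t t n, f d := by
  refine sum_biUnion fun s _ t _ hst => disjoint_left.2 fun d h1 h2 => hst ?_
  rw [← (mem_seqs.1 h1).1, ← (mem_seqs.1 h2).1]

theorem sum_lowHeadLists (n : ℕ) (f : List ℕ → ℕ) :
    ∑ d ∈ lowHeadLists n, f d =
      ∑ s ∈ range (n - 1), ∑ l ∈ seqs s (s + 1) n, ∑ i ∈ range s, f ((i + 1) :: l) := by
  rw [lowHeadLists, sum_biUnion]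
  · refine sum_congr rfl fun s _ => ?_
    rw [sum_comm, sum_biUnion]
    · rw [sum_Ico_eq_sum_range]
      refine sum_congr rfl fun q _ => ?_
      rw [sum_image fun _ _ _ _ h => (List.cons.inj h).2, add_comm 1 q]
    · intro p _ q _ hpq
      refine disjoint_left.2 fun l h1 h2 => hpq ?_
      obtain ⟨l1, _, rfl⟩ := mem_image.1 h1
      obtain ⟨l2, _, h⟩ := mem_image.1 h2
      exact (List.cons.inj h).1.symm
  · intro s _ t _ hst
    refine disjoint_left.2 fun d h1 h2 => hst ?_
    simp only [mem_biUnion, mem_image] at h1 h2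
    obtain ⟨p, _, l, hl, rfl⟩ := h1
    obtain ⟨q, _, l', hl', h⟩ := h2
    rw [← (mem_seqs.1 hl).1, ← (mem_seqs.1 hl').1, (List.cons.inj h).2]

variable (X : ℕ → (ℕ → ℕ → Prop) → Prop) (n : ℕ)

/-- The number of triangle ideals with the property `X`. -/
noncomputable def baseCount (t : ℕ) : ℕ := {T | T ∈ triangleIdeals t n ∧ X t T}.ncard

/-- The number of triangle ideals with the property `X` not reaching `(p, v)`. -/
noncomputable def sepCount (t p v : ℕ) : ℕ :=
  {T | T ∈ triangleIdeals t n ∧ X t T ∧ ¬ Reaches T p v}.ncard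

theorem ncard_noPathThree_sum :
    {x | (IsCode n x ∧ NoPathThree (relPairOf n x).1 (relPairOf n x).2) ∧
      X x.1.length x.2}.ncard = ∑ d ∈ highLists n,
        {T | T ∈ triangleIdeals d.length n ∧ X d.length T ∧
          ∀ p v, d[0]? = some p → d[1]? = some v → ¬ Reaches T p v}.ncard := by
  rw [← ncard_sigma_finset _ _ fun d _ =>
    (finite_triangleIdeals d.length n).subset fun T h => h.1]
  congr 1
  ext ⟨d, T⟩
  simp only [Set.mem_ofPred_eq, isCode_noPathThree_iff]
  tauto

theorem ncard_noPathFour_sum :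
    {x | (IsCode n x ∧ NoPathFour (relPairOf n x).1 (relPairOf n x).2) ∧
      X x.1.length x.2}.ncard = ∑ d ∈ highLists n ∪ lowHeadLists n,
        {T | T ∈ triangleIdeals d.length n ∧ X d.length T ∧
          ∀ p v q, d[0]? = some p → d[1]? = some v → d[p]? = some q →
            ¬ Reaches T v q}.ncard := by
  rw [← ncard_sigma_finset _ _ fun d _ =>
    (finite_triangleIdeals d.length n).subset fun T h => h.1]
  congr 1
  ext ⟨d, T⟩
  simp only [Set.mem_ofPred_eq, isCode_noPathFour_iff]
  tauto

/-- Lists of length 0 and 1 are unconstrained. For length `r + 2` with first entries `p ≤ v`, the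
other `r` entries lie in `[v, m + 2)`, which gives the multiset coefficient. -/
theorem ncard_noPathThree (m : ℕ) :
    {x | (IsCode (m + 2) x ∧ NoPathThree (relPairOf (m + 2) x).1 (relPairOf (m + 2) x).2) ∧
      X x.1.length x.2}.ncard =
    baseCount X (m + 2) 0 + (m + 1) * baseCount X (m + 2) 1 +
      ∑ r ∈ range m, ∑ p ∈ Ico (r + 2) (m + 2), ∑ v ∈ Ico p (m + 2),
        Nat.multichoose (m + 2 - v) r * sepCount X (m + 2) (r + 2) p v := by
  rw [ncard_noPathThree_sum, sum_highLists, sum_range_succ', sum_range_succ', add_comm,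
    add_left_comm, add_comm]
  congr 1
  · have hshort : ∀ d : List ℕ, d.length ≤ 1 →
        {T | T ∈ triangleIdeals d.length (m + 2) ∧ X d.length T ∧
          ∀ p v, d[0]? = some p → d[1]? = some v → ¬ Reaches T p v}.ncard =
        baseCount X (m + 2) d.length := by
      intro d hd
      rw [baseCount]
      congr 1
      ext T
      refine and_congr_right fun _ => and_iff_left fun p v _ hv => ?_
      rw [List.getElem?_eq_none hd] at hv
      exact absurd hv (by simp)
    congr 1
    · rw [seqs, sum_singleton, hshort [] (by simp), List.length_nil]
    · rw [zero_add, sum_congr rfl fun d hd => (?_ : _ = baseCount X (m + 2) 1), sum_const,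
        card_seqs, smul_eq_mul]
      · simp
      · have hlen := (mem_seqs.1 hd).1
        rw [hshort d hlen.le, hlen]
  · refine sum_congr rfl fun r _ => ?_
    rw [sum_seqs_succ]
    refine sum_congr rfl fun p _ => ?_
    rw [sum_seqs_succ]
    refine sum_congr rfl fun v _ => ?_
    rw [sum_congr rfl fun l hl => (?_ : _ = sepCount X (m + 2) (r + 2) p v), sum_const,
      card_seqs, smul_eq_mul]
    have hlen := (mem_seqs.1 hl).1
    rw [sepCount, List.length_cons, List.length_cons, hlen]
    congr 1
    ext T
    refine and_congr_right fun _ => and_congr_right fun _ => ⟨fun h => h _ _ rfl rfl, ?_⟩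
    rintro h p' v' hp hv
    obtain rfl := Option.some.inj hp
    obtain rfl := Option.some.inj hv
    exact h

/-- For a list `(i + 1) :: l` with low head, the position to avoid is `(l_0, l_i)`. Summing over `i`
gives one term for the first entry `p` of `l` and one for each later entry; the latter are collected
by `entryWeight`. -/
theorem ncard_noPathFour (m : ℕ) :
    {x | (IsCode (m + 2) x ∧ NoPathFour (relPairOf (m + 2) x).1 (relPairOf (m + 2) x).2) ∧
      X x.1.length x.2}.ncard =
    ∑ t ∈ range (m + 2), Nat.multichoose (m + 2 - t) t * baseCount X (m + 2) t +
      ∑ r ∈ range m, ∑ p ∈ Ico (r + 2) (m + 2),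
        (Nat.multichoose (m + 2 - p) r * sepCount X (m + 2) (r + 2) p p +
          entryWeight r (m + 2 - p) *
            ∑ v ∈ Ico p (m + 2), sepCount X (m + 2) (r + 2) p v) := by
  rw [ncard_noPathFour_sum, sum_union (disjoint_high_lowHead _), sum_highLists,
    sum_lowHeadLists]
  congr 1
  · refine sum_congr rfl fun t _ => ?_
    rw [sum_congr rfl fun d hd => (?_ : _ = baseCount X (m + 2) t), sum_const,
        card_seqs, smul_eq_mul]
    obtain ⟨hlen, _, hd⟩ := mem_seqs.1 hd
    have hvac : ∀ p q, d[0]? = some p → ¬ d[p]? = some q := by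
      intro p q hp hq
      have h1 := hd p (List.mem_iff_getElem?.2 ⟨0, hp⟩)
      have h2 := (List.getElem?_eq_some_iff.1 hq).1
      omega
    rw [baseCount, hlen]
    congr 1
    ext T
    refine and_congr_right fun _ => and_iff_left fun p v q hp _ hq => (hvac p q hp hq).elim
  -- The tail of a list with low head is nonempty; the term of length zero vanishes and the index
  -- shifts by one.
  · rw [show m + 2 - 1 = m + 1 from rfl, sum_range_succ']
    simp only [range_zero, sum_empty, sum_const_zero, add_zero]
    refine sum_congr rfl fun r _ => ?_
    have hsum : ∀ l ∈ seqs (r + 1) (r + 1 + 1) (m + 2), ∀ i ∈ range (r + 1),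
        {T | T ∈ triangleIdeals ((i + 1) :: l).length (m + 2) ∧ X ((i + 1) :: l).length T ∧
          ∀ p v q, ((i + 1) :: l)[0]? = some p → ((i + 1) :: l)[1]? = some v →
            ((i + 1) :: l)[p]? = some q → ¬ Reaches T v q}.ncard =
        sepCount X (m + 2) (r + 2) (l.getD 0 0) (l.getD i 0) := by
      intro l hl i hi
      have hlen := (mem_seqs.1 hl).1
      have hi : i < l.length := hlen ▸ mem_range.1 hi
      have h0 : 0 < l.length := lt_of_le_of_lt (Nat.zero_le i) hi
      have hv : ((i + 1) :: l)[1]? = some (l.getD 0 0) := by simp [h0]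
      have hq : ((i + 1) :: l)[i + 1]? = some (l.getD i 0) := by simp [hi]
      rw [sepCount, List.length_cons, hlen]
      congr 1
      ext T
      refine and_congr_right fun _ => and_congr_right fun _ => ⟨fun h => h _ _ _ rfl hv hq, ?_⟩
      intro h p v q hp hv' hq'
      obtain rfl := Option.some.inj hp
      rw [hv] at hv'
      rw [hq] at hq'
      obtain rfl := Option.some.inj hv'
      obtain rfl := Option.some.inj hq'
      exact h
    rw [sum_congr rfl fun l hl => sum_congr rfl (hsum l hl)]
    have hmap : ∀ l ∈ seqs (r + 1) (r + 1 + 1) (m + 2),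
        ∑ i ∈ range (r + 1), sepCount X (m + 2) (r + 2) (l.getD 0 0) (l.getD i 0) =
          (l.map (sepCount X (m + 2) (r + 2) (l.getD 0 0))).sum := by
      intro l hl
      rw [← sum_range_getD, (mem_seqs.1 hl).1]
    rw [sum_congr rfl hmap, sum_seqs_succ]
    refine sum_congr rfl fun p _ => ?_
    simp only [List.map_cons, List.sum_cons, List.getD_cons_zero, sum_add_distrib, sum_const,
      smul_eq_mul, card_seqs, sum_seqs_sum]

end Counting

/-! ### Recursions for the weighted counts and their closed forms. -/

section Recursions

open Finset

/-! ### Pairs of adjacent entries -/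

/-- `avoidCount` summed over the first coordinate. -/
def colCount (N v : ℕ) : ℕ := ∑ p ∈ range (v + 1), avoidCount N p v

theorem sum_shifted_avoidCount (N v : ℕ) :
    ∑ p ∈ range (v + 1), (if p = 0 then 0 else avoidCount N (p - 1) (v - 1)) =
      if v = 0 then 0 else colCount N (v - 1) := by
  rw [sum_range_succ']
  rcases v with _ | v
  · simp
  · simp [colCount]

theorem colCount_succ (N v : ℕ) : colCount (N + 1) v =
    (if v = 0 then 0 else colCount N (v - 1)) +
      if v = N then (N + 1) * triangleCount N else colCount N v := by
  rw [← sum_shifted_avoidCount, colCount]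
  simp only [avoidCount, sum_add_distrib]
  congr 1
  split_ifs with h
  · simp [h]
  · rfl

/-- The weighted number of non-reaching triples. -/
def pairWeight (N r : ℕ) : ℕ := ∑ v ∈ range N, Nat.multichoose (N - v) r * colCount N v

/-- `pairWeight` with the weights of the next larger triangle. -/
def pairWeight' (N r : ℕ) : ℕ := ∑ v ∈ range N, Nat.multichoose (N + 1 - v) r * colCount N v

theorem sum_shifted_colCount (N r : ℕ) :
    ∑ v ∈ range (N + 1), Nat.multichoose (N + 1 - v) r *
      (if v = 0 then 0 else colCount N (v - 1)) = pairWeight N r := by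
  rw [sum_range_succ']
  simp [pairWeight, Nat.add_sub_add_right]

/-- Ideals with the corner contribute the shifted sum, of weight `pairWeight N r`. Those without it
keep their positions but have the weights of the larger triangle; positions in the last column give
the inhomogeneous term. -/
theorem pairWeight_succ (N r : ℕ) :
    pairWeight (N + 1) r = pairWeight N r + pairWeight' N r + (N + 1) * triangleCount N := by
  rw [pairWeight]
  simp only [colCount_succ, mul_add, sum_add_distrib, sum_shifted_colCount, add_assoc]
  congr 1
  rw [sum_range_succ, pairWeight']
  congr 1
  · refine sum_congr rfl fun v hv => ?_
    rw [if_neg (mem_range.1 hv).ne]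
  · simp

theorem pairWeight'_zero (N : ℕ) : pairWeight' N 0 = pairWeight N 0 := by
  simp [pairWeight', pairWeight]

theorem pairWeight'_succ (N r : ℕ) :
    pairWeight' N (r + 1) = pairWeight N (r + 1) + pairWeight' N r := by
  simp only [pairWeight', pairWeight, ← sum_add_distrib]
  refine sum_congr rfl fun v hv => ?_
  rw [show N + 1 - v = N - v + 1 by have := mem_range.1 hv; omega, Nat.multichoose_succ_succ]
  ring

theorem sum_triangle (N r : ℕ) (f : ℕ → ℕ → ℕ) :
    ∑ p ∈ range N, ∑ v ∈ Ico p N, Nat.multichoose (N - v) r * f p v =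
      ∑ v ∈ range N, Nat.multichoose (N - v) r * ∑ p ∈ range (v + 1), f p v := by
  rw [range_eq_Ico, sum_Ico_Ico_comm]
  simp only [mul_sum, range_eq_Ico]

/-! ### Pairs with an arbitrary later entry -/

/-- `avoidCount` summed over the second coordinate. -/
def rowCount (N p : ℕ) : ℕ := ∑ v ∈ Ico p N, avoidCount N p v

theorem sum_shifted_row (N p : ℕ) :
    ∑ v ∈ Ico p (N + 1), (if p = 0 then 0 else avoidCount N (p - 1) (v - 1)) =
      if p = 0 then 0 else rowCount N (p - 1) := by
  rcases p with _ | p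
  · simp
  · simp [rowCount, ← sum_Ico_add' _ p N 1]

theorem rowCount_succ {N p : ℕ} (hp : p ≤ N) : rowCount (N + 1) p =
    (if p = 0 then 0 else rowCount N (p - 1)) + (rowCount N p + triangleCount N) := by
  rw [← sum_shifted_row, rowCount]
  simp only [avoidCount, sum_add_distrib]
  congr 1
  rw [sum_Ico_succ_top hp, if_pos rfl, rowCount]
  congr 1
  refine sum_congr rfl fun v hv => ?_
  rw [if_neg (mem_Ico.1 hv).2.ne]

/-- The weighted number of non-reaching lists with a marked entry. -/
def markWeight (N r : ℕ) : ℕ := ∑ p ∈ range N,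
  (Nat.multichoose (N - p) r * avoidCount N p p + entryWeight r (N - p) * rowCount N p)

/-- `markWeight` with the weights of the next larger triangle. -/
def markWeight' (N r : ℕ) : ℕ := ∑ p ∈ range N,
  (Nat.multichoose (N + 1 - p) r * avoidCount N p p + entryWeight r (N + 1 - p) * rowCount N p)

theorem sum_shifted_mark (N r : ℕ) :
    ∑ p ∈ range (N + 1), (Nat.multichoose (N + 1 - p) r *
      (if p = 0 then 0 else avoidCount N (p - 1) (p - 1)) +
        entryWeight r (N + 1 - p) * if p = 0 then 0 else rowCount N (p - 1)) =
      markWeight N r := by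
  rw [sum_range_succ']
  simp [markWeight, Nat.add_sub_add_right]

theorem one_add_sum_entryWeight (N r : ℕ) :
    1 + ∑ p ∈ range (N + 1), entryWeight r (N + 1 - p) = Nat.multichoose (N + 2) r := by
  rcases r with _ | r
  · simp [entryWeight]
  · induction N with
    | zero =>
      simp only [entryWeight, zero_add, sum_range_one, Nat.multichoose_succ_succ 1 r]
      simp
    | succ N ih =>
      rw [sum_range_succ', Nat.multichoose_succ_succ, ← ih]
      simp [entryWeight, add_assoc]

/-- The same splitting by the corner as for `pairWeight_succ`. The inhomogeneous terms combine
through `one_add_sum_entryWeight`, whose leading 1 is the contribution of `p = N`. -/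
theorem markWeight_succ (N r : ℕ) : markWeight (N + 1) r =
    markWeight N r + markWeight' N r + triangleCount N * Nat.multichoose (N + 2) r := by
  have h : ∀ p ∈ range (N + 1),
      Nat.multichoose (N + 1 - p) r * avoidCount (N + 1) p p +
        entryWeight r (N + 1 - p) * rowCount (N + 1) p =
      (Nat.multichoose (N + 1 - p) r *
        (if p = 0 then 0 else avoidCount N (p - 1) (p - 1)) +
        entryWeight r (N + 1 - p) * if p = 0 then 0 else rowCount N (p - 1)) +
      ((Nat.multichoose (N + 1 - p) r * (if p = N then triangleCount N else avoidCount N p p) +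
        entryWeight r (N + 1 - p) * rowCount N p) +
        triangleCount N * entryWeight r (N + 1 - p)) := by
    intro p hp
    rw [rowCount_succ (Nat.lt_succ_iff.1 (mem_range.1 hp)), avoidCount]
    ring
  have h' : ∑ p ∈ range (N + 1),
      (Nat.multichoose (N + 1 - p) r * (if p = N then triangleCount N else avoidCount N p p) +
        entryWeight r (N + 1 - p) * rowCount N p) = markWeight' N r + triangleCount N := by
    rw [sum_range_succ, markWeight']
    congr 1
    · refine sum_congr rfl fun p hp => ?_
      rw [if_neg (mem_range.1 hp).ne]
    · simp [rowCount]
  rw [markWeight, sum_congr rfl h, sum_add_distrib, sum_shifted_mark, sum_add_distrib, h',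
    ← mul_sum, ← one_add_sum_entryWeight]
  ring

theorem markWeight'_zero (N : ℕ) : markWeight' N 0 = markWeight N 0 := by
  simp [markWeight', markWeight, entryWeight]

theorem markWeight'_succ (N r : ℕ) :
    markWeight' N (r + 1) = markWeight N (r + 1) + markWeight' N r := by
  simp only [markWeight', markWeight, ← sum_add_distrib]
  refine sum_congr rfl fun p hp => ?_
  rw [show N + 1 - p = N - p + 1 by have := mem_range.1 hp; omega, Nat.multichoose_succ_succ,
    entryWeight_succ]
  ring

/-! ### Antidiagonal sums -/

/-- The sum of `f` over the `m`-th antidiagonal. -/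
def diagSum (f : ℕ → ℕ → ℕ) (m : ℕ) : ℕ := ∑ r ∈ range (m + 1), f (m - r) r

theorem diagSum_eq_of_zero {f : ℕ → ℕ → ℕ} (h : ∀ r, f 0 r = 0) (m : ℕ) :
    diagSum f m = ∑ r ∈ range m, f (m - r) r := by
  rw [diagSum, sum_range_succ, Nat.sub_self, h, add_zero]

theorem diagSum_succ_of_first {f g k : ℕ → ℕ → ℕ} (h0 : ∀ r, f 0 r = 0)
    (h : ∀ N r, f (N + 1) r = f N r + g N r + k N r) (m : ℕ) :
    diagSum f (m + 1) = diagSum f m + diagSum g m + diagSum k m := by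
  rw [diagSum_eq_of_zero h0]
  simp only [diagSum, ← sum_add_distrib]
  refine sum_congr rfl fun r hr => ?_
  rw [← h, Nat.sub_add_comm (Nat.lt_succ_iff.1 (mem_range.1 hr))]

/-- Pascal's rule lowers `r` at fixed `N`, so the second summand moves to the previous antidiagonal.
-/
theorem diagSum_succ_of_second {f g : ℕ → ℕ → ℕ} (h0 : ∀ N, g N 0 = f N 0)
    (h : ∀ N r, g N (r + 1) = f N (r + 1) + g N r) (m : ℕ) :
    diagSum g (m + 1) = diagSum f (m + 1) + diagSum g m := by
  simp only [diagSum]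
  rw [sum_range_succ', sum_range_succ' _ (m + 1)]
  simp only [h0, h, Nat.add_sub_add_right, sum_add_distrib]
  ring

theorem diagSum_pairWeight_succ (m : ℕ) : diagSum pairWeight (m + 1) =
    diagSum pairWeight m + diagSum pairWeight' m +
      diagSum (fun N _ => (N + 1) * triangleCount N) m :=
  diagSum_succ_of_first (fun r => by simp [pairWeight]) pairWeight_succ m

theorem diagSum_markWeight_succ (m : ℕ) : diagSum markWeight (m + 1) =
    diagSum markWeight m + diagSum markWeight' m +
      diagSum (fun N r => triangleCount N * Nat.multichoose (N + 2) r) m :=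
  diagSum_succ_of_first (fun r => by simp [markWeight]) markWeight_succ m

theorem diagSum_triangleCount (m : ℕ) :
    diagSum (fun N _ => (N + 1) * triangleCount N) m = m * 2 ^ m + 1 := by
  induction m with
  | zero => simp [diagSum, triangleCount]
  | succ m ih =>
    rw [diagSum, sum_range_succ']
    simp only [Nat.add_sub_add_right]
    rw [diagSum] at ih
    rw [ih]
    simp only [triangleCount, Nat.sub_zero, Nat.add_sub_cancel]
    ring

theorem multichoose_sub {t k : ℕ} (h : t ≤ k) :
    Nat.multichoose (k - t + 1) t = Nat.choose k t := by
  rw [Nat.multichoose_eq]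
  congr 1
  omega

theorem sum_choose_mul_two_pow (k : ℕ) :
    ∑ t ∈ range (k + 1), Nat.choose k t * 2 ^ (k - t) = 3 ^ k := by
  have := add_pow 1 2 k
  simp only [one_pow, one_mul] at this
  rw [show (3 : ℕ) = 1 + 2 from rfl, this]
  exact sum_congr rfl fun t _ => mul_comm _ _

/-- This is the binomial expansion of `(1 + 2)^(m+1)` up to its boundary. The exponential formula
would give 1/2 for the empty triangle, whereas `triangleCount 0 = 1`, whence the term `2 (m + 1)`;
the missing term `r = m + 1` is the 1 on the left. -/
theorem diagSum_multichoose (m : ℕ) :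
    4 * diagSum (fun N r => triangleCount N * Nat.multichoose (N + 2) r) m + 1 =
      3 ^ (m + 1) + 2 * (m + 1) := by
  rw [← sum_choose_mul_two_pow, sum_range_succ, diagSum, sum_range_succ, sum_range_succ]
  have : ∀ r ∈ range m, triangleCount (m - r) * Nat.multichoose (m - r + 2) r * 4 =
      Nat.choose (m + 1) r * 2 ^ (m + 1 - r) := by
    intro r hr
    have hr := mem_range.1 hr
    rw [← multichoose_sub (by omega : r ≤ m + 1), triangleCount,
      show m + 1 - r = m - r - 1 + 2 by omega, show m - r - 1 + 2 + 1 = m - r + 2 by omega]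
    ring
  rw [← sum_congr rfl this, ← sum_mul]
  simp only [Nat.sub_self, triangleCount, ← multichoose_sub (Nat.le_succ m),
    Nat.add_sub_cancel_left, Nat.choose_self, show m.succ - m + 1 = 0 + 2 by omega]
  simp
  ring

/-! ### Closed forms -/

theorem fib_two_mul_add_two (m : ℕ) :
    Nat.fib (2 * (m + 1)) = Nat.fib (2 * m) + Nat.fib (2 * m + 1) :=
  Nat.fib_add_two

theorem fib_two_mul_add_three (m : ℕ) :
    Nat.fib (2 * (m + 1) + 1) = Nat.fib (2 * m) + 2 * Nat.fib (2 * m + 1) := by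
  rw [show 2 * (m + 1) + 1 = 2 * m + 1 + 2 by ring, Nat.fib_add_two,
    show 2 * m + 1 + 1 = 2 * m + 2 from rfl, Nat.fib_add_two]
  ring

/-- The recursions are `A_{m+1} = A_m + B_m + m 2^m + 1` and `B_{m+1} = A_{m+1} + B_m`. Their
homogeneous matrix `[[1, 1], [1, 2]]` is that of a double Fibonacci step; the two closed forms have
to be proved together. -/
theorem diagSum_pairWeight (m : ℕ) :
    (diagSum pairWeight m : ℚ) =
      3 * Nat.fib (2 * m) + 4 * Nat.fib (2 * m + 1) - (m + 4) * 2 ^ m ∧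
    (diagSum pairWeight' m : ℚ) =
      4 * Nat.fib (2 * m) + 7 * Nat.fib (2 * m + 1) - (2 * m + 6) * 2 ^ m - 1 := by
  induction m with
  | zero => simp [diagSum, pairWeight, pairWeight']; norm_num
  | succ m ih =>
    have h : (diagSum pairWeight (m + 1) : ℚ) =
        3 * Nat.fib (2 * (m + 1)) + 4 * Nat.fib (2 * (m + 1) + 1) -
          ((m + 1 : ℕ) + 4) * 2 ^ (m + 1) := by
      rw [diagSum_pairWeight_succ, diagSum_triangleCount, fib_two_mul_add_two,
        fib_two_mul_add_three]
      push_cast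
      rw [ih.1, ih.2]
      ring
    refine ⟨h, ?_⟩
    rw [diagSum_succ_of_second pairWeight'_zero pairWeight'_succ]
    push_cast
    rw [h, ih.2, fib_two_mul_add_two, fib_two_mul_add_three]
    push_cast
    ring

/-- The same system as for `diagSum_pairWeight`, now with inhomogeneous term `(3^(m+1) + 2m + 1) /
4`. -/
theorem diagSum_markWeight (m : ℕ) :
    (diagSum markWeight m : ℚ) =
      3 / 2 * 3 ^ m - 1 / 2 - Nat.fib (2 * m) - Nat.fib (2 * m + 1) ∧
    (diagSum markWeight' m : ℚ) =
      9 / 4 * 3 ^ m - 1 / 4 - m / 2 - Nat.fib (2 * m) - 2 * Nat.fib (2 * m + 1) := by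
  induction m with
  | zero => simp [diagSum, markWeight, markWeight']; norm_num
  | succ m ih =>
    have hK : (diagSum (fun N r => triangleCount N * Nat.multichoose (N + 2) r) m : ℚ) =
        (3 ^ (m + 1) + 2 * (m + 1) - 1) / 4 := by
      have := diagSum_multichoose m
      qify at this
      linarith
    have h : (diagSum markWeight (m + 1) : ℚ) =
        3 / 2 * 3 ^ (m + 1) - 1 / 2 - Nat.fib (2 * (m + 1)) - Nat.fib (2 * (m + 1) + 1) := by
      rw [diagSum_markWeight_succ, fib_two_mul_add_two, fib_two_mul_add_three]
      push_cast
      rw [ih.1, ih.2, hK]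
      ring
    refine ⟨h, ?_⟩
    rw [diagSum_succ_of_second markWeight'_zero markWeight'_succ]
    push_cast
    rw [h, ih.2, fib_two_mul_add_two, fib_two_mul_add_three]
    push_cast
    ring

end Recursions

/-! ### Evaluation of the two counts. -/

section Totals

open Finset

theorem sum_Ico_shift (t N : ℕ) (f : ℕ → ℕ) :
    ∑ p ∈ Ico t (t + N), f p = ∑ p ∈ range N, f (t + p) := by
  rw [sum_Ico_eq_sum_range, Nat.add_sub_cancel_left]

theorem sum_Ico_add_shift (t p N : ℕ) (f : ℕ → ℕ) :
    ∑ v ∈ Ico (t + p) (t + N), f v = ∑ v ∈ Ico p N, f (t + v) := by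
  rw [sum_Ico_add, add_comm p, add_comm N]

theorem sum_pairs_shift (t N r : ℕ) (f : ℕ → ℕ → ℕ) :
    ∑ p ∈ Ico t (t + N), ∑ v ∈ Ico p (t + N), Nat.multichoose (t + N - v) r * f p v =
      ∑ p ∈ range N, ∑ v ∈ Ico p N, Nat.multichoose (N - v) r * f (t + p) (t + v) := by
  rw [sum_Ico_shift]
  refine sum_congr rfl fun p _ => ?_
  rw [sum_Ico_add_shift]
  refine sum_congr rfl fun v _ => ?_
  rw [Nat.add_sub_add_left]

theorem sum_marks_shift (t N r : ℕ) (f : ℕ → ℕ → ℕ) :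
    ∑ p ∈ Ico t (t + N), (Nat.multichoose (t + N - p) r * f p p +
      entryWeight r (t + N - p) * ∑ v ∈ Ico p (t + N), f p v) =
    ∑ p ∈ range N, (Nat.multichoose (N - p) r * f (t + p) (t + p) +
      entryWeight r (N - p) * ∑ v ∈ Ico p N, f (t + p) (t + v)) := by
  rw [sum_Ico_shift]
  refine sum_congr rfl fun p _ => ?_
  rw [sum_Ico_add_shift, Nat.add_sub_add_left]

theorem baseCount_true (t N : ℕ) :
    baseCount (fun _ _ => True) (t + N) t = triangleCount N := by
  rw [baseCount, ← ncard_triangleIdeals t N]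
  congr 1
  ext T
  exact and_iff_left trivial

theorem baseCount_strict (t N : ℕ) :
    baseCount (fun s T => T s (t + (N + 1) - 1)) (t + (N + 1)) t =
      if N = 0 then 0 else triangleCount N :=
  ncard_strict t N

theorem sepCount_true {t N p v : ℕ} (hpv : p ≤ v) (hv : v < N) :
    sepCount (fun _ _ => True) (t + N) t (t + p) (t + v) = avoidCount N p v := by
  rw [sepCount, ← ncard_not_reaches t N p v hpv hv]
  congr 1
  ext T
  exact and_congr_right fun _ => and_iff_right trivial

theorem sepCount_strict {t N p v : ℕ} (hpv : p ≤ v) (hv : v < N + 1) :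
    sepCount (fun s T => T s (t + (N + 1) - 1)) (t + (N + 1)) t (t + p) (t + v) =
      if p = 0 then 0 else avoidCount N (p - 1) (v - 1) :=
  ncard_strict_not_reaches t N p v hpv hv

theorem sum_pairs_true (t N r : ℕ) :
    ∑ p ∈ Ico t (t + N), ∑ v ∈ Ico p (t + N), Nat.multichoose (t + N - v) r *
      sepCount (fun _ _ => True) (t + N) t p v = pairWeight N r := by
  rw [sum_pairs_shift, pairWeight]
  simp only [colCount, ← sum_triangle]
  refine sum_congr rfl fun p _ => sum_congr rfl fun v hv => ?_
  rw [sepCount_true (mem_Ico.1 hv).1 (mem_Ico.1 hv).2]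

/-- Strictness retains only the ideals containing the corner, which is the shifted half of the
recursion; hence the weight of a triangle with one point fewer. -/
theorem sum_pairs_strict (t N r : ℕ) :
    ∑ p ∈ Ico t (t + (N + 1)), ∑ v ∈ Ico p (t + (N + 1)),
      Nat.multichoose (t + (N + 1) - v) r *
        sepCount (fun s T => T s (t + (N + 1) - 1)) (t + (N + 1)) t p v = pairWeight N r := by
  rw [sum_pairs_shift, ← sum_shifted_colCount]
  simp only [← sum_shifted_avoidCount]
  rw [← sum_triangle]
  refine sum_congr rfl fun p _ => sum_congr rfl fun v hv => ?_
  rw [sepCount_strict (mem_Ico.1 hv).1 (mem_Ico.1 hv).2]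

theorem sum_marks_true (t N r : ℕ) :
    ∑ p ∈ Ico t (t + N), (Nat.multichoose (t + N - p) r *
      sepCount (fun _ _ => True) (t + N) t p p + entryWeight r (t + N - p) *
        ∑ v ∈ Ico p (t + N), sepCount (fun _ _ => True) (t + N) t p v) = markWeight N r := by
  rw [sum_marks_shift, markWeight]
  refine sum_congr rfl fun p hp => ?_
  rw [sepCount_true le_rfl (mem_range.1 hp), rowCount]
  congr 2
  refine sum_congr rfl fun v hv => ?_
  rw [sepCount_true (mem_Ico.1 hv).1 (mem_Ico.1 hv).2]

theorem sum_marks_strict (t N r : ℕ) :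
    ∑ p ∈ Ico t (t + (N + 1)), (Nat.multichoose (t + (N + 1) - p) r *
      sepCount (fun s T => T s (t + (N + 1) - 1)) (t + (N + 1)) t p p +
        entryWeight r (t + (N + 1) - p) * ∑ v ∈ Ico p (t + (N + 1)),
          sepCount (fun s T => T s (t + (N + 1) - 1)) (t + (N + 1)) t p v) =
      markWeight N r := by
  rw [sum_marks_shift, ← sum_shifted_mark]
  refine sum_congr rfl fun p hp => ?_
  rw [sepCount_strict le_rfl (mem_range.1 hp), ← sum_shifted_row]
  congr 2
  refine sum_congr rfl fun v hv => ?_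
  rw [sepCount_strict (mem_Ico.1 hv).1 (mem_Ico.1 hv).2]

theorem ncard_isCIdeal_true (n : ℕ) (hn : 0 < n)
    (Q : (ℕ → ℕ → Prop) → (ℕ → ℕ → Prop) → Prop) :
    {p : RelPair | IsCIdeal n p.1 p.2 ∧ Q p.1 p.2}.ncard =
      {x | (IsCode n x ∧ Q (relPairOf n x).1 (relPairOf n x).2) ∧ True}.ncard := by
  rw [ncard_isCIdeal hn]
  simp only [and_true]

theorem ncard_isCIdeal_strict (n : ℕ) (hn : 0 < n)
    (Q : (ℕ → ℕ → Prop) → (ℕ → ℕ → Prop) → Prop) :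
    {p : RelPair | IsCIdeal n p.1 p.2 ∧ Q p.1 p.2 ∧ IsStrict n p.1 p.2}.ncard =
      {x | (IsCode n x ∧ Q (relPairOf n x).1 (relPairOf n x).2) ∧
        x.2 x.1.length (n - 1)}.ncard := by
  rw [ncard_isCIdeal hn fun D S => Q D S ∧ IsStrict n D S]
  congr 1
  ext ⟨d, T⟩
  constructor
  · rintro ⟨h1, h2, h3⟩
    exact ⟨⟨h1, h2⟩, h1.isStrict_iff.1 h3⟩
  · rintro ⟨⟨h1, h2⟩, h3⟩
    exact ⟨h1, h2, h1.isStrict_iff.2 h3⟩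

theorem ncard_three_true (m : ℕ) :
    {p : RelPair | IsCIdeal (m + 2) p.1 p.2 ∧ NoPathThree p.1 p.2}.ncard =
      triangleCount (m + 2) + (m + 1) * triangleCount (m + 1) + diagSum pairWeight m := by
  rw [ncard_isCIdeal_true _ (by omega), ncard_noPathThree (fun _ _ => True) m,
    diagSum_eq_of_zero (fun r => by simp [pairWeight])]
  congr 1
  · congr 1
    · rw [← baseCount_true 0, zero_add]
    · rw [← baseCount_true 1, add_comm 1]
  · refine sum_congr rfl fun r hr => ?_
    rw [← sum_pairs_true (r + 2), show r + 2 + (m - r) = m + 2 by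
      have := mem_range.1 hr; omega]

theorem ncard_three_strict_zero :
    {p : RelPair | IsCIdeal 2 p.1 p.2 ∧ NoPathThree p.1 p.2 ∧ IsStrict 2 p.1 p.2}.ncard = 1 := by
  rw [ncard_isCIdeal_strict _ (by omega), ncard_noPathThree (fun s T => T s (2 - 1)) 0]
  have h0 : baseCount (fun s T => T s (2 - 1)) 2 0 = 1 := baseCount_strict 0 1
  -- A triangle on one point has no corner; this is why `n = 2` is separate.
  have h1 : baseCount (fun s T => T s (2 - 1)) 2 1 = 0 := baseCount_strict 1 0
  simp [h0, h1]

theorem ncard_three_strict (m : ℕ) :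
    {p : RelPair | IsCIdeal (m + 3) p.1 p.2 ∧ NoPathThree p.1 p.2 ∧
      IsStrict (m + 3) p.1 p.2}.ncard =
      triangleCount (m + 2) + (m + 2) * triangleCount (m + 1) + diagSum pairWeight m := by
  rw [ncard_isCIdeal_strict _ (by omega),
    ncard_noPathThree (fun s T => T s (m + 3 - 1)) (m + 1), diagSum]
  congr 1
  · congr 1
    · have := baseCount_strict 0 (m + 2)
      rwa [zero_add, if_neg (by omega)] at this
    · have := baseCount_strict 1 (m + 1)
      rw [add_comm 1, if_neg (by omega)] at this
      rw [← this]
  · refine sum_congr rfl fun r hr => ?_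
    rw [← sum_pairs_strict (r + 2), show r + 2 + (m - r + 1) = m + 3 by
      have := mem_range.1 hr; omega]

theorem multichoose_card_sub {m t : ℕ} (ht : t ∈ range (m + 2)) :
    Nat.multichoose (m + 2 - t) t = Nat.choose (m + 1) t := by
  have := mem_range.1 ht
  rw [← multichoose_sub (by omega : t ≤ m + 1), show m + 1 - t + 1 = m + 2 - t by omega]

theorem ncard_four_true (m : ℕ) :
    {p : RelPair | IsCIdeal (m + 2) p.1 p.2 ∧ NoPathFour p.1 p.2}.ncard =
      3 ^ (m + 1) + diagSum markWeight m := by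
  rw [ncard_isCIdeal_true _ (by omega), ncard_noPathFour (fun _ _ => True) m,
    diagSum_eq_of_zero (fun r => by simp [markWeight]), ← sum_choose_mul_two_pow]
  congr 1
  · refine sum_congr rfl fun t ht => ?_
    have := mem_range.1 ht
    have h := baseCount_true t (m + 2 - t)
    rw [show t + (m + 2 - t) = m + 2 by omega] at h
    rw [multichoose_card_sub ht, h, triangleCount, show m + 2 - t - 1 = m + 1 - t by omega]
  · refine sum_congr rfl fun r hr => ?_
    rw [← sum_marks_true (r + 2), show r + 2 + (m - r) = m + 2 by
      have := mem_range.1 hr; omega]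

/-- Ideals with the corner are half of all ideals, except for the one-point triangle at `t = m + 1`,
where there are none; the added 1 is the binomial term missing there. -/
theorem sum_baseCount_strict (m : ℕ) :
    2 * ∑ t ∈ range (m + 2), Nat.multichoose (m + 2 - t) t *
      baseCount (fun s T => T s (m + 2 - 1)) (m + 2) t + 1 = 3 ^ (m + 1) := by
  rw [← sum_choose_mul_two_pow, sum_range_succ, sum_range_succ _ (m + 1), mul_add, mul_sum]
  have h0 := baseCount_strict (m + 1) 0
  rw [show m + 1 + (0 + 1) = m + 2 from rfl, if_pos rfl] at h0
  rw [h0, mul_zero, mul_zero, add_zero, Nat.sub_self, pow_zero, Nat.choose_self, mul_one]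
  congr 1
  refine sum_congr rfl fun t ht => ?_
  have := mem_range.1 ht
  have h := baseCount_strict t (m + 1 - t)
  rw [show t + (m + 1 - t + 1) = m + 2 by omega, if_neg (by omega)] at h
  rw [multichoose_card_sub (mem_range.2 (by omega)), h, triangleCount,
    show 2 ^ (m + 1 - t) = 2 ^ (m + 1 - t - 1) * 2 by
      rw [← pow_succ]; congr 1; omega]
  ring

theorem ncard_four_strict_zero :
    {p : RelPair | IsCIdeal 2 p.1 p.2 ∧ NoPathFour p.1 p.2 ∧ IsStrict 2 p.1 p.2}.ncard = 1 := by
  rw [ncard_isCIdeal_strict _ (by omega), ncard_noPathFour (fun s T => T s (2 - 1)) 0,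
    range_zero, sum_empty, add_zero]
  have := sum_baseCount_strict 0
  simp only [zero_add] at this ⊢
  omega

theorem ncard_four_strict (m : ℕ) :
    2 * {p : RelPair | IsCIdeal (m + 3) p.1 p.2 ∧ NoPathFour p.1 p.2 ∧
      IsStrict (m + 3) p.1 p.2}.ncard + 1 = 3 ^ (m + 2) + 2 * diagSum markWeight m := by
  rw [ncard_isCIdeal_strict _ (by omega),
    ncard_noPathFour (fun s T => T s (m + 3 - 1)) (m + 1), diagSum,
    ← sum_baseCount_strict (m + 1), mul_add, add_right_comm]
  congr 2
  refine sum_congr rfl fun r hr => ?_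
  rw [← sum_marks_strict (r + 2), show r + 2 + (m - r + 1) = m + 3 by
    have := mem_range.1 hr; omega]

/-- The number of ideals of class at most two in the combinatorial model. -/
theorem card_class_two {n : ℕ} (hn : 2 ≤ n) :
    (({Φ : Set (DRoot n) | IsUp DRoot.add Φ ∧ iterSum DRoot.add Φ 2 = ∅}.ncard : ℕ) : ℚ) =
      5 * (F (2 * n - 3) : ℚ) - 2 ^ (n - 2) := by
  rw [ncard_eq_of_criterion 2 NoPathThree fun Φ h hs => iterSum_two_eq_empty_iff h hs]
  obtain ⟨m, rfl⟩ := Nat.exists_eq_add_of_le' hn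
  rw [ncard_three_true, show 2 * (m + 2) - 3 = 2 * m + 1 by omega, F]
  rcases m with _ | m
  · rw [ncard_three_strict_zero]
    simp [triangleCount, diagSum, pairWeight]
    norm_num
  · rw [ncard_three_strict]
    push_cast
    rw [(diagSum_pairWeight m).1, (diagSum_pairWeight (m + 1)).1,
      show 2 * (m + 1) + 1 + 1 = 2 * (m + 1 + 1) by ring, fib_two_mul_add_two (m + 1),
      fib_two_mul_add_three, fib_two_mul_add_two]
    simp only [triangleCount, show m + 1 + 2 - 1 = m + 2 from rfl,
      show m + 1 + 1 - 1 = m + 1 from rfl,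
      Nat.add_sub_cancel]
    push_cast
    ring

/-- The number of ideals of class at most three in the combinatorial model. -/
theorem card_class_three {n : ℕ} (hn : 2 ≤ n) :
    (({Φ : Set (DRoot n) | IsUp DRoot.add Φ ∧ iterSum DRoot.add Φ 3 = ∅}.ncard : ℕ) : ℚ) =
      13 / 2 * 3 ^ (n - 2) - 3 / 2 + 4 * (F (2 * n) : ℚ) - 7 * (F (2 * n - 1) : ℚ) := by
  rw [ncard_eq_of_criterion 3 NoPathFour fun Φ h hs => iterSum_three_eq_empty_iff h hs]
  obtain ⟨m, rfl⟩ := Nat.exists_eq_add_of_le' hn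
  rw [ncard_four_true, F, F, show 2 * (m + 2) - 1 + 1 = 2 * (m + 1 + 1) by omega,
    show 2 * (m + 2) + 1 = 2 * (m + 1 + 1) + 1 by ring, fib_two_mul_add_three (m + 1),
    fib_two_mul_add_two (m + 1)]
  rcases m with _ | m
  · rw [ncard_four_strict_zero]
    simp [diagSum, markWeight]
    norm_num [Nat.fib_add_two]
  · have h := ncard_four_strict m
    rw [show m + 3 = m + 1 + 2 from rfl] at h
    qify at h
    rw [Nat.cast_add, Nat.cast_add, (diagSum_markWeight (m + 1)).1,
      fib_two_mul_add_three (m + 1), fib_two_mul_add_two (m + 1), fib_two_mul_add_three m,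
      fib_two_mul_add_two m]
    rw [(diagSum_markWeight m).1] at h
    rw [show m + 1 + 2 - 2 = m + 1 from rfl, show m + 1 + 1 = m + 2 from rfl]
    push_cast at h ⊢
    simp only [pow_succ] at h ⊢
    linarith

end Totals

end TypeDIdeals

theorem corollaryD3 {g : Type*} [LieRing g] [LieAlgebra ℂ g] [FiniteDimensional ℂ g]
    [LieAlgebra.IsSemisimple ℂ g] (H : LieSubalgebra ℂ g) [H.IsCartanSubalgebra]
    (b : (LieAlgebra.IsKilling.rootSystem H).Base) (n : ℕ) (hn : 2 ≤ n)
    (hD : TypeDIdeals.IsTypeD b n) :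
    (({I ∈ TypeDIdeals.adNilpotentIdeals b | TypeDIdeals.nilpotenceClass I ≤ 2}.ncard : ℕ) : ℚ)
        = 5 * (TypeDIdeals.F (2 * n - 3) : ℚ) - 2 ^ (n - 2) ∧
    (({I ∈ TypeDIdeals.adNilpotentIdeals b | TypeDIdeals.nilpotenceClass I ≤ 3}.ncard : ℕ) : ℚ)
        = 13 / 2 * 3 ^ (n - 2) - 3 / 2 + 4 * (TypeDIdeals.F (2 * n) : ℚ)
          - 7 * (TypeDIdeals.F (2 * n - 1) : ℚ) := by
  rw [TypeDIdeals.ncard_ideals_of_isTypeD b hn hD, TypeDIdeals.ncard_ideals_of_isTypeD b hn hD]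
  exact ⟨TypeDIdeals.card_class_two hn, TypeDIdeals.card_class_three hn⟩
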